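/- Let $n\ge 2$ be an integer and consider the radial Euler equations for $U(t,r)$, $\rho(t,r)$, $S(t,r)$ ($r>0$), $$U_t+UU_r+(p_SS_r+p_\rho\rho_r)/\rho=0,\qquad \rho_t+(U\rho)_r+\tfrac{n-1}{r}U\rho=0,\qquad S_t+US_r=0,$$ where $\rho$ takes values in an open interval $J\subseteq(0,\infty)$, $S$ in an open interval $I$, and $p=P(\rho,S)$ is a smooth equation of state on $J\times I$. Assume that either $P_\rho$ (the squared sound speed) vanishes identically on no non-empty open subset of $J\times I$, or $P=\kappa(S)$ is entropic with $\kappa$ constant on no non-empty open subinterval of $I$. Let $e(\rho,S)=\int P\rho^{-2}\,d\rho$ be a smooth internal energy. A kinematic conserved integral is a pair of smooth functions $\Phi(t,r,U,\rho,S)$ (density) and $\Psi(t,r,U,\rho,S)$ (moving flux) such that $D_t(r^{n-1}\Phi)+D_r\big(r^{n-1}(\Psi+U\Phi)\big)=0$ holds as a consequence of the radial Euler equations, i.e. at every point of the first-order jet space that satisfies these equations, where $D_t,D_r$ are total derivatives. Each such pair satisfies $$\frac{d}{dt}\int_{V(t)}\Phi\,r^{n-1}dr=-\big(r^{n-1}\Psi\big)\Big|_{\partial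 V(t)}$$ for every $C^1$ solution and every radial interval $V(t)$ transported by the flow. The pairs with $\Psi\equiv0$ are exactly $(\rho f(S),0)$ with $f$ smooth. Call a pair trivial if $\Phi=\Theta_r+\frac{n-1}{r}\Theta$ and $\Psi+U\Phi=-\Theta_t$ for a smooth $\Theta(t,r)$, and call two pairs equivalent if they differ by the sum of a trivial pair and a pair $(\rho f(S),0)$. (i) Energy, $\Phi=\rho(\frac12U^2+e)$, $\Psi=pU$, is a kinematic conserved integral for every such equation of state, and it is not equivalent to $0$. If the equation of state is of none of the three forms in (ii), then the kinematic conserved integrals are exactly the pairs equivalent to a constant multiple of energy. (ii) Kinematic conserved integrals that are not equivalent to a multiple of energy exist if and only if, on $J\times I$, the equation of state is ideal polytropic, $p=p_0+\kappa(S)\rho^{1+2/n}$ (with a constant $p_0$, which does not enter the Euler equations), or barotropic, $p=P(\rho)$, or entropic, $p=\kappa(S)$. Moreover: - If $p=p_0+\kappa(S)\rho^{1+2/n}$ is not barotropic, the kinematic conserved integrals are exactly the pairs equivalent to a linear combination of energy, dilational energy $$\Phi=t\rho(\tfrac12U^2+\tilde e)-\tfrac12r\rho U,\quad \Psi=(tU-\tfrac12r)\tilde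 p,$$ and similarity energy $$\Phi=t^2\rho(\tfrac12U^2+\tilde e)-tr\rho U+\tfrac12r^2\rho,\quad \Psi=t(tU-r)\tilde p,$$ where $\tilde p=\kappa(S)\rho^{1+2/n}$ and $\tilde e=\frac n2\kappa(S)\rho^{2/n}$. - If $p=P(\rho)$ is barotropic and not ideal polytropic, they are exactly the pairs equivalent to a linear combination of energy and the enthalpy flux $$\frac{d}{dt}\int_{V(t)}U\,dr=-\big(e_1+p/\rho-\tfrac12U^2\big)\Big|_{\partial V(t)},\qquad e_1=\int p(\rho)\rho^{-2}\,d\rho,$$ that is, $\Phi=r^{1-n}U$ and $\Psi=r^{1-n}(e_1+p/\rho-\frac12U^2)$. - If the equation of state is both ideal polytropic and barotropic, they are exactly the pairs equivalent to a linear combination of energy, dilational energy, similarity energy and enthalpy flux. In each of these three cases the listed pairs are linearly independent modulo equivalence. - If $p=\kappa(S)$ is entropic, they are exactly the pairs equivalent to an entropy-weighted energy $\Phi=\frac12\rho U^2F(S)-K(S)$, $\Psi=UK(S)$, with $F$ smooth and $K=\int F\kappa'\,dS$; such a pair is equivalent to $c$ times energy, $c$ a constant, if and only if $F\equiv c$.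 -/

import Mathlib

open Set
open scoped ContDiff

noncomputable section

namespace RadialFlow

/-- A point `(t, r, U, ρ, S)`: the arguments of a kinematic density or flux. -/
abbrev Kin : Type := ℝ × ℝ × ℝ × ℝ × ℝ

namespace Kin

/-- Time. -/
abbrev t (x : Kin) : ℝ := x.1

/-- Radius. -/
abbrev r (x : Kin) : ℝ := x.2.1

/-- Radial velocity. -/
abbrev U (x : Kin) : ℝ := x.2.2.1

/-- Density. -/
abbrev ρ (x : Kin) : ℝ := x.2.2.2.1

/-- Entropy. -/
abbrev S (x : Kin) : ℝ := x.2.2.2.2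

end Kin

/-- The domain `t ∈ ℝ`, `r > 0`, `U ∈ ℝ`, `ρ ∈ J`, `S ∈ I`. -/
def kinDomain (J I : Set ℝ) : Set Kin :=
  {x | 0 < x.r ∧ x.ρ ∈ J ∧ x.S ∈ I}

/-- The partial derivative `p_ρ` of the equation of state `p = P(ρ, S)`. -/
def pRho (P : ℝ → ℝ → ℝ) (ρ S : ℝ) : ℝ := deriv (fun y => P y S) ρ

/-- The partial derivative `p_S` of the equation of state `p = P(ρ, S)`. -/
def pS (P : ℝ → ℝ → ℝ) (ρ S : ℝ) : ℝ := deriv (fun y => P ρ y) S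

/-- A point of the first-order jet space of the fluid variables `U, ρ, S` over `(t, r)`. -/
structure Jet where
  (t r U ρ S : ℝ)
  (Ut ρt St : ℝ)
  (Ur ρr Sr : ℝ)

namespace Jet

/-- The zeroth-order part of a jet. -/
def base (j : Jet) : Kin := (j.t, j.r, j.U, j.ρ, j.S)

/-- The total time derivative
`D_t f = f_t + U_t f_U + ρ_t f_ρ + S_t f_S` of a kinematic function. -/
def Dt (j : Jet) (f : Kin → ℝ) : ℝ := fderiv ℝ f j.base (1, 0, j.Ut, j.ρt, j.St)

/-- The total radial derivative
`D_r f = f_r + U_r f_U + ρ_r f_ρ + S_r f_S` of a kinematic function. -/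
def Dr (j : Jet) (f : Kin → ℝ) : ℝ := fderiv ℝ f j.base (0, 1, j.Ur, j.ρr, j.Sr)

/-- The jet lies on the surface in jet space which is cut out by the radial Euler equations. -/
structure OnShell (n : ℕ) (J I : Set ℝ) (P : ℝ → ℝ → ℝ) (j : Jet) : Prop where
  r_pos : 0 < j.r
  ρ_mem : j.ρ ∈ J
  S_mem : j.S ∈ I
  velocity_eqn : j.Ut + j.U * j.Ur + (pS P j.ρ j.S * j.Sr + pRho P j.ρ j.S * j.ρr) / j.ρ = 0
  density_eqn : j.ρt + (j.Ur * j.ρ + j.U * j.ρr) + ((n : ℝ) - 1) / j.r * j.U * j.ρ = 0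
  entropy_eqn : j.St + j.U * j.Sr = 0

end Jet

/-- A pair `(Φ, Ψ)` of a kinematic density `Φ` and a kinematic moving flux `Ψ`.
The radial flux of the pair is `Ψ + U Φ`. Pairs form a real vector space. -/
abbrev Pair : Type := (Kin → ℝ) × (Kin → ℝ)

/-- The pair is smooth and is a kinematic radial conservation law
`D_t (r^(n-1) Φ) + D_r (r^(n-1) (Ψ + U Φ)) = 0` of the radial Euler equations. -/
structure IsConservationLaw (n : ℕ) (J I : Set ℝ) (P : ℝ → ℝ → ℝ) (q : Pair) : Prop where
  smooth_density : ContDiffOn ℝ ∞ q.1 (kinDomain J I)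
  smooth_flux : ContDiffOn ℝ ∞ q.2 (kinDomain J I)
  law : ∀ j : Jet, j.OnShell n J I P →
    j.Dt (fun x => x.r ^ (n - 1) * q.1 x)
      + j.Dr (fun x => x.r ^ (n - 1) * (q.2 x + x.U * q.1 x)) = 0

/-- A classical solution `(U, ρ, S)`, as functions of `t` and `r`, of the radial Euler equations
on an open set `O` of the half plane `r > 0`. -/
structure IsRadialFlow (n : ℕ) (J I : Set ℝ) (P : ℝ → ℝ → ℝ) (O : Set (ℝ × ℝ))
    (U ρ S : ℝ → ℝ → ℝ) : Prop where
  isOpen : IsOpen O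
  r_pos : ∀ y ∈ O, 0 < y.2
  diff_U : ContDiffOn ℝ 1 (fun y : ℝ × ℝ => U y.1 y.2) O
  diff_ρ : ContDiffOn ℝ 1 (fun y : ℝ × ℝ => ρ y.1 y.2) O
  diff_S : ContDiffOn ℝ 1 (fun y : ℝ × ℝ => S y.1 y.2) O
  ρ_mem : ∀ y ∈ O, ρ y.1 y.2 ∈ J
  S_mem : ∀ y ∈ O, S y.1 y.2 ∈ I
  velocity_eqn : ∀ t r : ℝ, (t, r) ∈ O →
    deriv (fun τ => U τ r) t + U t r * deriv (U t) r
      + (pS P (ρ t r) (S t r) * deriv (S t) r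
          + pRho P (ρ t r) (S t r) * deriv (ρ t) r) / ρ t r = 0
  density_eqn : ∀ t r : ℝ, (t, r) ∈ O →
    deriv (fun τ => ρ τ r) t + deriv (fun y => U t y * ρ t y) r
      + ((n : ℝ) - 1) / r * U t r * ρ t r = 0
  entropy_eqn : ∀ t r : ℝ, (t, r) ∈ O →
    deriv (fun τ => S τ r) t + U t r * deriv (S t) r = 0

/-- The radial domain `a(t) ≤ r ≤ b(t)`, for `t` in the open set `T`, stays in `O` and is
transported by the velocity `U`. -/
structure IsTransported (O : Set (ℝ × ℝ)) (U : ℝ → ℝ → ℝ) (T : Set ℝ) (a b : ℝ → ℝ) : Prop where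
  isOpen : IsOpen T
  le : ∀ t ∈ T, a t ≤ b t
  mem : ∀ t ∈ T, ∀ r ∈ Icc (a t) (b t), (t, r) ∈ O
  inner : ∀ t ∈ T, HasDerivAt a (U t (a t)) t
  outer : ∀ t ∈ T, HasDerivAt b (U t (b t)) t

/-- The balance `d/dt ∫_{V(t)} Φ r^(n-1) dr = -(r^(n-1) Ψ)|_{∂V(t)}` holds for every classical
solution and every transported radial domain. -/
def HasMovingBalance (n : ℕ) (J I : Set ℝ) (P : ℝ → ℝ → ℝ) (q : Pair) : Prop :=
  ∀ (O : Set (ℝ × ℝ)) (U ρ S : ℝ → ℝ → ℝ) (T : Set ℝ) (a b : ℝ → ℝ),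
    IsRadialFlow n J I P O U ρ S → IsTransported O U T a b →
      ∀ t ∈ T, HasDerivAt
        (fun τ => ∫ r in (a τ)..(b τ), q.1 (τ, r, U τ r, ρ τ r, S τ r) * r ^ (n - 1))
        (-(b t ^ (n - 1) * q.2 (t, b t, U t (b t), ρ t (b t), S t (b t))
            - a t ^ (n - 1) * q.2 (t, a t, U t (a t), ρ t (a t), S t (a t)))) t

/-- The pair is locally trivial: `Φ = D_r Θ + (n-1)/r Θ` and `Ψ + U Φ = -D_t Θ`. As `Φ` involves
no derivatives of the fluid variables, `Θ` depends on `t` and `r` only. -/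
def IsLocallyTrivial (n : ℕ) (J I : Set ℝ) (q : Pair) : Prop :=
  ∃ Θ : ℝ → ℝ → ℝ, ContDiffOn ℝ ∞ (fun y : ℝ × ℝ => Θ y.1 y.2) {y | 0 < y.2} ∧
    ∀ x ∈ kinDomain J I,
      q.1 x = deriv (Θ x.t) x.r + ((n : ℝ) - 1) / x.r * Θ x.t x.r ∧
      q.2 x + x.U * q.1 x = -deriv (fun τ => Θ τ x.r) x.t

/-- The pair `(ρ f(S), 0)`, whose moving flux vanishes. -/
def advected (f : ℝ → ℝ) : Pair := (fun x => x.ρ * f x.S, fun _ => 0)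

/-- Two pairs differ by an integral invariant `(ρ f(S), 0)` and a locally trivial pair. -/
def Equivalent (n : ℕ) (J I : Set ℝ) (q q' : Pair) : Prop :=
  ∃ f : ℝ → ℝ, ContDiffOn ℝ ∞ f I ∧ IsLocallyTrivial n J I (q - q' - advected f)

/-- `p = P(ρ)`. -/
def IsBarotropic (J I : Set ℝ) (P : ℝ → ℝ → ℝ) (p : ℝ → ℝ) : Prop :=
  ∀ ρ ∈ J, ∀ S ∈ I, P ρ S = p ρ

/-- `p = κ(S)`. -/
def IsEntropic (J I : Set ℝ) (P : ℝ → ℝ → ℝ) (κ : ℝ → ℝ) : Prop :=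
  ∀ ρ ∈ J, ∀ S ∈ I, P ρ S = κ S

/-- `p = κ(S) ρ^(1 + 2/n)`. -/
def idealPressure (n : ℕ) (κ : ℝ → ℝ) (ρ S : ℝ) : ℝ := κ S * ρ ^ (1 + 2 / (n : ℝ))

/-- `e = (n/2) κ(S) ρ^(2/n)`. -/
def idealEnergy (n : ℕ) (κ : ℝ → ℝ) (ρ S : ℝ) : ℝ := (n : ℝ) / 2 * κ S * ρ ^ (2 / (n : ℝ))

/-- `p = κ(S) ρ^(1 + 2/n)` up to the additive constant `p₀`, which does not enter the
Euler equations. -/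
def IsIdealPolytropic (n : ℕ) (J I : Set ℝ) (P : ℝ → ℝ → ℝ) (p₀ : ℝ) (κ : ℝ → ℝ) : Prop :=
  ∀ ρ ∈ J, ∀ S ∈ I, P ρ S = p₀ + idealPressure n κ ρ S

/-- Either `p_ρ` (the squared sound speed) vanishes on no non-empty open set, or the equation of
state is entropic and `p_S` vanishes on no non-empty open set. -/
def IsNondegenerate (J I : Set ℝ) (P : ℝ → ℝ → ℝ) : Prop :=
  (J ×ˢ I ⊆ closure {x | x ∈ J ×ˢ I ∧ pRho P x.1 x.2 ≠ 0}) ∨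
  ((∃ κ, IsEntropic J I P κ) ∧ J ×ˢ I ⊆ closure {x | x ∈ J ×ˢ I ∧ pS P x.1 x.2 ≠ 0})

/-- `e` is a smooth internal energy `∫ P / ρ² dρ`; it is unique up to a function of `S`. -/
structure IsInternalEnergy (J I : Set ℝ) (P e : ℝ → ℝ → ℝ) : Prop where
  smooth : ContDiffOn ℝ ∞ (fun y : ℝ × ℝ => e y.1 y.2) (J ×ˢ I)
  hasDerivAt : ∀ ρ ∈ J, ∀ S ∈ I, HasDerivAt (fun y => e y S) (P ρ S / ρ ^ 2) ρ

/-- Energy: `Φ = ρ (U²/2 + e)`, `Ψ = p U`. -/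
def energy (p e : ℝ → ℝ → ℝ) : Pair :=
  (fun x => x.ρ * (x.U ^ 2 / 2 + e x.ρ x.S),
   fun x => p x.ρ x.S * x.U)

/-- Dilational energy: `Φ = t ρ (U²/2 + e) - r ρ U / 2`, `Ψ = (t U - r/2) p`. -/
def dilationalEnergy (p e : ℝ → ℝ → ℝ) : Pair :=
  (fun x => x.t * (x.ρ * (x.U ^ 2 / 2 + e x.ρ x.S)) - x.r * x.ρ * x.U / 2,
   fun x => (x.t * x.U - x.r / 2) * p x.ρ x.S)

/-- Similarity energy: `Φ = t² ρ (U²/2 + e) - t r ρ U + r² ρ / 2`, `Ψ = t (t U - r) p`. -/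
def similarityEnergy (p e : ℝ → ℝ → ℝ) : Pair :=
  (fun x => x.t ^ 2 * (x.ρ * (x.U ^ 2 / 2 + e x.ρ x.S)) - x.t * x.r * x.ρ * x.U
      + x.r ^ 2 * x.ρ / 2,
   fun x => x.t * (x.t * x.U - x.r) * p x.ρ x.S)

/-- Enthalpy flux: `r^(n-1) Φ = U`, `r^(n-1) Ψ = e + p/ρ - U²/2`. -/
def enthalpyFlux (n : ℕ) (p e : ℝ → ℝ) : Pair :=
  (fun x => x.U / x.r ^ (n - 1),
   fun x => (e x.ρ + p x.ρ / x.ρ - x.U ^ 2 / 2) / x.r ^ (n - 1))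

/-- Entropy-weighted energy: `Φ = ρ U² F(S) / 2 - K(S)`, `Ψ = U K(S)`. -/
def weightedEnergy (F K : ℝ → ℝ) : Pair :=
  (fun x => x.ρ * x.U ^ 2 * F x.S / 2 - K x.S,
   fun x => x.U * K x.S)

/-- `F` is smooth and `K = ∫ F κ' dS`. -/
structure IsWeight (I : Set ℝ) (κ F K : ℝ → ℝ) : Prop where
  smooth : ContDiffOn ℝ ∞ F I
  hasDerivAt : ∀ S ∈ I, HasDerivAt K (F S * deriv κ S) S

end RadialFlow

end

/-! On shell the derivatives U_r, ρ_r, S_r are free, so a conservation law amounts to four linear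
determining equations: Ψ_U = ρ Φ_ρ - Φ, ρ Ψ_ρ = p_ρ Φ_U, ρ Ψ_S = p_S Φ_U, and a balance in t and r
(`isConservationLaw_iff`). If Φ_U = 0, the solution is an advected pair plus a pair in t and r
alone, and the latter is trivial by the Poincaré lemma. Hence two laws are equivalent exactly when
their Φ_U agree (`IsConservationLaw.equivalent_iff`), and the classification reduces to finding all
possible w = Φ_U.

The main point is that w is affine in U where p_ρ does not vanish, whatever the equation of state
(`IsLaw.dU_dU_dU`). Put a = p_ρ and ρ a_ρ = (2 - σ) a. Eliminating Ψ and cross-differentiating gives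
the first-order relation `IsLaw.sound_relation` for w. If σ = 0, it yields (U² - a) w_UU = 0
directly. Otherwise it leads to the overdetermined system `IsReduced`, whose integrability
conditions are linear relations between h = U w_U - ρ w_ρ and w_UU, with coefficients built from U,
a, g = 1 - 2/σ and the ρ-derivatives of g. If ρ g_ρ = 0 they give w_UU = 0. If ρ g_ρ ≠ 0, a nonzero
h would impose incompatible equations on g (`IsReduced.h_eq_zero`), so h = 0 and again w_UU = 0.

Comparing powers of U then gives w = c₃ r^(1-n) + ρ ((c₀ + c₁ t + c₂ t²) U - r (c₁ + 2 c₂ t)/2)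
(`exists_normal_form`). Here c₃ ≠ 0 forces p_S = 0, while c₁ ≠ 0 or c₂ ≠ 0 forces n ρ p_ρρ = 2 p_ρ
and n ρ p_ρS = (n + 2) p_S, which integrate to the ideal polytropic law. The entropic case gives w =
ρ U F(S) (`exists_normal_form_entropic`). The listed pairs realise all these w.

The argument divides by functions that may vanish somewhere. It is therefore carried out in a field
with commuting derivations, `KinField`. Germs of smooth functions along a filter for which every
open set or its exterior is large form such a field: a germ is zero or invertible. Identities of
germs return to the domain by density and continuity (`forall_eq_zero_of_generic`). -/

namespace RadialFlow

/-! ### Differential algebra of the determining equations -/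

/-- A field with commuting derivations `∂_t, ∂_r, ∂_U, ρ ∂_ρ, ∂_S` and coordinates `r, U, ρ`. -/
structure KinField (K : Type*) [Field K] where
  (dt dr dl dU dS : Derivation ℤ K K)
  (r U ρ : K)
  dr_dt : ∀ x, dr (dt x) = dt (dr x)
  dl_dt : ∀ x, dl (dt x) = dt (dl x)
  dU_dt : ∀ x, dU (dt x) = dt (dU x)
  dS_dt : ∀ x, dS (dt x) = dt (dS x)
  dl_dr : ∀ x, dl (dr x) = dr (dl x)
  dU_dr : ∀ x, dU (dr x) = dr (dU x)
  dS_dr : ∀ x, dS (dr x) = dr (dS x)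
  dU_dl : ∀ x, dU (dl x) = dl (dU x)
  dS_dl : ∀ x, dS (dl x) = dl (dS x)
  dS_dU : ∀ x, dS (dU x) = dU (dS x)
  dt_r : dt r = 0
  dr_r : dr r = 1
  dl_r : dl r = 0
  dU_r : dU r = 0
  dS_r : dS r = 0
  dt_U : dt U = 0
  dr_U : dr U = 0
  dl_U : dl U = 0
  dU_U : dU U = 1
  dS_U : dS U = 0
  dt_ρ : dt ρ = 0
  dr_ρ : dr ρ = 0
  dl_ρ : dl ρ = ρ
  dU_ρ : dU ρ = 0
  dS_ρ : dS ρ = 0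
  ρ_ne : ρ ≠ 0

namespace KinField

variable {K : Type*} [Field K] (F : KinField K)

attribute [simp] dr_dt dl_dt dU_dt dS_dt dl_dr dU_dr dS_dr dU_dl dS_dl dS_dU
  dt_r dr_r dl_r dU_r dS_r dt_U dr_U dl_U dU_U dS_U dt_ρ dr_ρ dl_ρ dU_ρ dS_ρ

@[simp] lemma derivation_ofNat (D : Derivation ℤ K K) (k : ℕ) [k.AtLeastTwo] :
    D (ofNat(k) : K) = 0 := D.map_natCast k

lemma r_ne : F.r ≠ 0 := fun h => by
  have := F.dr_r
  rw [h, map_zero] at this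
  exact zero_ne_one this

/-- The determining equations of a conservation law with density `f`, moving flux `s` and
pressure `p`, where `ρ a = ρ p_ρ`. -/
structure IsLaw (m : ℕ) (p a f s : K) : Prop where
  dt_p : F.dt p = 0
  dr_p : F.dr p = 0
  dU_p : F.dU p = 0
  dl_p : F.dl p = F.ρ * a
  dU_s : F.dU s = F.dl f - f
  dl_s : F.dl s = a * F.dU f
  dS_s : F.ρ * F.dS s = F.dS p * F.dU f
  balance : F.r * (F.dt f + F.U * F.dr f + F.dr s) + m * (s + F.U * (f - F.dl f)) = 0

namespace IsLaw

variable {F} {m : ℕ} {p a f s : K} (H : F.IsLaw m p a f s)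
include H

lemma dt_a : F.dt a = 0 := by
  have h := congrArg F.dt H.dl_p
  rw [← F.dl_dt, H.dt_p] at h
  simpa [F.ρ_ne] using h.symm

lemma dr_a : F.dr a = 0 := by
  have h := congrArg F.dr H.dl_p
  rw [← F.dl_dr, H.dr_p] at h
  simpa [F.ρ_ne] using h.symm

lemma dU_a : F.dU a = 0 := by
  have h := congrArg F.dU H.dl_p
  rw [F.dU_dl, H.dU_p] at h
  simpa [F.ρ_ne] using h.symm

/-- Equality of the mixed derivatives of `s` in U and ρ eliminates the flux and leaves a wave-type
equation for the density. -/
lemma dl_y : F.dl (F.dl f) = F.dl f + a * F.dU (F.dU f) := by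
  have h1 := congrArg F.dU H.dl_s
  have h2 := congrArg F.dl H.dU_s
  simp [H.dU_a] at h1 h2
  linear_combination h1 - h2

/-- Differentiating the balance in U, and in ρ for `dl_balance`, replaces the flux by its known
gradient, so that only `f` is left. -/
lemma dU_balance : F.r * (F.dt (F.dU f) + F.U * F.dr (F.dU f) + F.dr (F.dl f))
    = m * F.U * (F.dl (F.dU f) - F.dU f) := by
  have h1 := congrArg F.dU H.balance
  simp [H.dU_s] at h1
  linear_combination h1

lemma dl_balance : F.r * (F.dt (F.dl f) + F.U * F.dr (F.dl f))
    + a * (F.r * F.dr (F.dU f) + m * (F.dU f - F.U * F.dU (F.dU f))) = 0 := by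
  have h1 := congrArg F.dl H.balance
  simp [H.dl_s, H.dr_a, H.dl_y] at h1
  linear_combination h1

end IsLaw

variable {F}

/-- The coefficients are constants for `dU` and `dU U = 1`, so repeated differentiation isolates
them from the top down; characteristic zero removes the factorials. -/
lemma quartic_eq_zero [CharZero K] {c₀ c₁ c₂ c₃ c₄ : K} (h₀ : F.dU c₀ = 0) (h₁ : F.dU c₁ = 0)
    (h₂ : F.dU c₂ = 0) (h₃ : F.dU c₃ = 0) (h₄ : F.dU c₄ = 0)
    (h : c₀ + c₁ * F.U + c₂ * F.U ^ 2 + c₃ * F.U ^ 3 + c₄ * F.U ^ 4 = 0) :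
    c₀ = 0 ∧ c₁ = 0 ∧ c₂ = 0 ∧ c₃ = 0 ∧ c₄ = 0 := by
  have e1 := congrArg F.dU h
  simp [h₀, h₁, h₂, h₃, h₄, Derivation.leibniz_pow] at e1
  have e2 := congrArg F.dU e1
  simp [h₁, h₂, h₃, h₄, Derivation.leibniz_pow] at e2
  have e3 := congrArg F.dU e2
  simp [h₂, h₃, h₄, Derivation.leibniz_pow] at e3
  have e4 := congrArg F.dU e3
  simp [h₃, h₄] at e4
  subst e4
  simp at e3
  subst e3
  simp at e2
  subst e2
  simp at e1
  subst e1
  simpa using h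

lemma quadratic_eq_zero [CharZero K] {c₀ c₁ c₂ : K} (h₀ : F.dU c₀ = 0) (h₁ : F.dU c₁ = 0)
    (h₂ : F.dU c₂ = 0) (h : c₀ + c₁ * F.U + c₂ * F.U ^ 2 = 0) : c₀ = 0 ∧ c₁ = 0 ∧ c₂ = 0 := by
  obtain ⟨e₀, e₁, e₂, -⟩ := quartic_eq_zero (F := F) h₀ h₁ h₂ (map_zero _) (map_zero _)
    (c₃ := 0) (c₄ := 0) (by simpa using h)
  exact ⟨e₀, e₁, e₂⟩

end KinField
end RadialFlow

/-! ### Integrability conditions of the reduced system -/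

namespace RadialFlow
namespace KinField
variable {K : Type*} [Field K] {F : KinField K}

/-- The reduced system for `w = Φ_U` and `y = ρ Φ_ρ`, with `h = U w_U - ρ w_ρ` and `v = w_UU`,
where `a = p_ρ` and `g = 1 - 2 / s` for `ρ a_ρ = (2 - s) a`. -/
structure IsReduced (F : KinField K) (m : ℕ) (a g g₁ g₂ w y h v B Y : K) : Prop where
  dt_a : F.dt a = 0
  dr_a : F.dr a = 0
  dU_a : F.dU a = 0
  dt_g : F.dt g = 0
  dr_g : F.dr g = 0
  dU_g : F.dU g = 0
  dl_g : F.dl g = g₁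
  dl_g₁ : F.dl g₁ = g₂
  dl_a : (1 - g) * F.dl a = -2 * g * a
  dr_w : F.r * F.dr w = m * (-w + F.dl w + g * h)
  dr_y : F.r * F.dr y = -F.r * F.dt w - m * F.U * g * h
  dt_y : F.r * F.dt y = F.U * F.r * F.dt w + m * B * h
  dU_y : F.dU y = F.dl w
  dl_y : F.dl y = y + a * F.dU w
  h_eq : h = F.U * F.dU w - F.dl w
  v_eq : F.dU (F.dU w) = v
  B_eq : B = g * F.U ^ 2 + a * (1 - g)
  Y_eq : Y = (2 * g + g₁) * h + B * v

namespace IsReduced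

variable {m : ℕ} {a g g₁ g₂ w y h v B Y : K} (R : F.IsReduced m a g g₁ g₂ w y h v B Y)
include R

lemma dt_g₁ : F.dt g₁ = 0 := by rw [← R.dl_g, ← F.dl_dt, R.dt_g, map_zero]
lemma dr_g₁ : F.dr g₁ = 0 := by rw [← R.dl_g, ← F.dl_dr, R.dr_g, map_zero]
lemma dU_g₁ : F.dU g₁ = 0 := by rw [← R.dl_g, F.dU_dl, R.dU_g, map_zero]
lemma dt_g₂ : F.dt g₂ = 0 := by rw [← R.dl_g₁, ← F.dl_dt, R.dt_g₁, map_zero]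
lemma dU_g₂ : F.dU g₂ = 0 := by rw [← R.dl_g₁, F.dU_dl, R.dU_g₁, map_zero]

lemma dt_B : F.dt B = 0 := by simp [R.B_eq, R.dt_g, R.dt_a]
lemma dr_B : F.dr B = 0 := by simp [R.B_eq, R.dr_g, R.dr_a, Derivation.leibniz_pow]
lemma dU_B : F.dU B = 2 * g * F.U := by
  simp [R.B_eq, R.dU_g, R.dU_a, Derivation.leibniz_pow]; ring
lemma dl_B : F.dl B = g₁ * F.U ^ 2 - 2 * g * a - a * g₁ := by
  simp [R.B_eq, R.dl_g, Derivation.leibniz_pow]; linear_combination R.dl_a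

lemma dl_dl_w : F.dl (F.dl w) = F.dl w + a * v := by
  have h1 := congrArg F.dl R.dU_y
  have h2 := congrArg F.dU R.dl_y
  simp [R.dU_a, R.dU_y, R.v_eq] at h1 h2
  linear_combination h2

lemma dU_h : F.dU h = F.U * v + F.dU w - F.dl (F.dU w) := by
  simp [R.h_eq, R.v_eq]

lemma dl_h : F.dl h = F.U * F.dl (F.dU w) - F.dl w - a * v := by
  simp [R.h_eq, R.dl_dl_w]; ring

/-- The wave equation of `w`, expressed through the first-order quantity `h`; it trades derivatives
of `h` against `v`. -/
lemma wave : (F.U ^ 2 - a) * v = F.U * F.dU h + F.dl h - h := by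
  rw [R.dU_h, R.dl_h, R.h_eq]; ring

lemma dU_dU_h : F.dU (F.dU h) = 2 * v + F.U * F.dU v - F.dl v := by
  have := congrArg F.dU R.dU_h
  simp [R.v_eq] at this
  linear_combination this

/-- As y_U = ρ w_ρ, the formulas for y_r and w_r give two expressions for the r-derivative of ρ w_ρ;
their difference can be solved for w_tU. -/
lemma dt_dU_w : F.r * F.dt (F.dU w) = -m * Y := by
  have h1 := congrArg F.dU R.dr_y
  have h2 := congrArg F.dl R.dr_w
  simp [R.dU_y, R.dU_g, R.dl_g, R.dl_dl_w] at h1 h2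
  rw [R.Y_eq]
  linear_combination h1 - h2 + m * g * R.wave + m * v * R.B_eq

/-- The same use of y_U = ρ w_ρ, now with the formula for y_t. -/
lemma dl_dt_w : F.r * (F.dl (F.dt w) - F.dt w) = -m * F.U * Y + m * F.dU (B * h) := by
  have h1 := congrArg F.dU R.dt_y
  simp [R.dU_y] at h1 ⊢
  linear_combination h1 + F.U * R.dt_dU_w

/-- The ρ- and U-derivatives of w_t commute. The relation that results no longer contains t or r
derivatives. -/
lemma dl_h_relation (hm : (m : K) ≠ 0) : 2 * g₁ * F.dl h + (g₂ - g₁) * h = 4 * g * a * v := by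
  have h1 := congrArg F.dU R.dl_dt_w
  have h2 := congrArg F.dl R.dt_dU_w
  have h3 := R.dt_dU_w
  simp [R.dU_g, R.dU_g₁, R.dl_g, R.dl_g₁, R.dU_B, R.dl_B, R.Y_eq, R.dU_dU_h] at h1 h2 h3
  apply mul_left_cancel₀ hm
  linear_combination h2 - h3 - h1 - m * (g₁ - 2 * g) * R.wave

lemma dr_h : F.r * F.dr h = m * (-h + F.dl h + g * (F.U * F.dU h - F.dl h) - g₁ * h) := by
  have h1 := congrArg F.dU R.dr_w
  have h2 := congrArg F.dl R.dr_w
  have h3 := congrArg F.dr R.h_eq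
  have h5 := R.dl_h
  simp [R.dU_g, R.dl_g, R.dl_dl_w] at h1 h2 h3
  linear_combination F.r * h3 + F.U * h1 - h2 + m * R.h_eq - m * h5

lemma dr_v : F.r * F.dr v = m * (-v + F.dl v + g * F.dU (F.dU h)) := by
  have h1 := congrArg F.dU R.dr_w
  simp [R.dU_g] at h1
  have h2 := congrArg F.dU h1
  simp [R.dU_g, R.v_eq] at h2
  linear_combination h2

lemma dt_v : F.r * F.dt v = -m * F.dU Y := by
  have h1 := congrArg F.dU R.dt_dU_w
  simp [R.v_eq] at h1
  linear_combination h1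

lemma dl_dt_dU_w : F.r * F.dt (F.dl (F.dU w)) = -m * F.dl Y := by
  have h1 := congrArg F.dl R.dt_dU_w
  simp at h1
  linear_combination h1

/-- The r- and t-derivatives of w_U commute. All derivatives of `h` and `v` cancel, which leaves a
linear relation whose coefficients do not involve t or r. -/
lemma v_relation (hm : (m : K) ≠ 0) :
    ((g * (1 + m * g) + m * g₁ * (1 - g)) * F.U ^ 2
        + (1 - g) * (1 - 3 * m * g - m * g₁) * a) * v
      + ((1 + m * g) * (2 * g + g₁) + m * g₁ * (2 + g₁) + m * (1 - g) * g₂) * h = 0 := by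
  have ha := congrArg F.dr R.dt_dU_w
  have hb := congrArg F.dt (congrArg F.dU R.dr_w)
  have hc := congrArg F.dt R.dU_h
  have hd := R.dl_dt_dU_w
  have he := R.dt_v
  simp [R.dU_g, R.dt_g] at ha hb hc
  have hY1 := congrArg F.dr R.Y_eq
  have hY2 := congrArg F.dl R.Y_eq
  have hY3 := congrArg F.dU R.Y_eq
  simp [R.dr_g, R.dr_g₁, R.dl_g, R.dl_g₁, R.dU_g, R.dU_g₁, R.dr_B, R.dl_B, R.dU_B]
    at hY1 hY2 hY3
  have hh := R.dr_h
  have hv := R.dr_v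
  have hE := R.dt_dU_w
  rw [R.dU_dU_h] at hv
  rw [hc] at hb
  rw [hY1] at ha
  rw [hY2] at hd
  rw [hY3] at he
  rw [R.Y_eq] at hE
  rw [R.B_eq] at *
  apply mul_left_cancel₀ hm
  linear_combination -F.r * ha + F.r * hb + (1 - m + m * g) * hE + m * (1 - g) * hd
    + m * g * F.U * he + m * (2 * g + g₁) * hh + m * (g * F.U ^ 2 + a * (1 - g)) * hv

end IsReduced
end KinField
end RadialFlow

/-! ### The reduced system has no solution with w_UU ≠ 0 -/

namespace RadialFlow
namespace KinField
variable {K : Type*} [Field K] {F : KinField K}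
namespace IsReduced

variable {m : ℕ} {a g g₁ g₂ w y h v B Y : K} (R : F.IsReduced m a g g₁ g₂ w y h v B Y)
include R

lemma dt_h : F.r * F.dt h = -F.r * F.dt w - m * F.dU (B * h) := by
  have h1 := congrArg F.dt R.h_eq
  have h2 := R.dl_dt_w
  have h3 := R.dt_dU_w
  simp at h1 h2 ⊢
  linear_combination F.r * h1 + F.U * h3 - h2

/-- Commuting t and r on `y` determines w_tt, since y_r contains w_t. -/
lemma dt_dt_w : F.r ^ 2 * F.dt (F.dt w) =
    2 * m * g * F.U * (F.r * F.dt w + m * F.dU (B * h)) + m * B * h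
      - m ^ 2 * F.U * (-F.U * Y + F.dU (B * h))
      - m ^ 2 * B * (-h + F.dl h + g * (F.U * F.dU h - F.dl h) - g₁ * h) := by
  have hp := congrArg F.dt R.dr_y
  have hq := congrArg F.dr R.dt_y
  have hw := congrArg F.dt R.dr_w
  have h1 := R.dl_dt_w
  have h2 := R.dt_h
  have h3 := R.dr_h
  simp [R.dt_g, R.dr_B] at hp hq hw h1 h2 ⊢
  linear_combination F.r * hp - F.r * hq + R.dt_y - F.U * F.r * hw - m * F.U * h1
    - 2 * m * g * F.U * h2 - m * B * h3

/-- The U-derivative of the formula for w_tt must agree with the t-derivative of the formula for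
w_tU. The factor under `dU` is the coefficient of `v` in `v_relation`. -/
lemma dt_w_relation (hm : (m : K) ≠ 0) : g₁ * (F.r * F.dt w) =
    F.dU (((g * (1 + m * g) + m * g₁ * (1 - g)) * F.U ^ 2
        + (1 - g) * (1 - 3 * m * g - m * g₁) * a) * h) := by
  have h1 := congrArg F.dU R.dt_dt_w
  have h2 := congrArg F.dt R.dt_dU_w
  have h3 := congrArg F.dt R.Y_eq
  have h4 := R.dt_h
  have h5 := R.dt_v
  have h6 := congrArg F.dU R.Y_eq
  have h7 := R.dt_dU_w
  have h9 := R.wave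
  have h9' := congrArg F.dU h9
  simp [R.dU_a, R.dU_g, R.dU_g₁, R.dU_B, R.dt_g, R.dt_g₁, R.dt_B, R.dU_dU_h,
    Derivation.leibniz_pow] at h1 h2 h3 h4 h5 h6 h7 h9 h9' ⊢
  rw [h3] at h2
  rw [h6] at h5 h1
  rw [R.Y_eq] at h7 h1
  rw [R.B_eq] at *
  apply mul_left_cancel₀ hm
  linear_combination h1 - F.r * h2 + m * (2 * g + g₁) * h4 + m * (g * F.U ^ 2 + a * (1 - g)) * h5
    + 2 * m * g * F.U * h7 + m ^ 2 * (1 - g) * (g * F.U ^ 2 + a * (1 - g)) * h9'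
    + 2 * m ^ 2 * g * F.U * (1 - g) * h9
lemma g₁_eq_zero_of_linear [CharZero K] {c d : ℕ} (hc : (c : K) ≠ 0) (h : c * g = d) : g₁ = 0 := by
  have := congrArg F.dl h
  simpa [R.dl_g, hc] using this

/-- A nonzero `h` would have logarithmic derivatives in U and in t that are rational in U. Their
compatibility is a quartic in U; its coefficients overdetermine `g`, which is not constant in ρ
because `g₁ ≠ 0`. -/
lemma h_eq_zero [CharZero K] (hm : (m : K) ≠ 0) (ha : a ≠ 0) (hg : 1 - g ≠ 0) (hg₁ : g₁ ≠ 0) :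
    h = 0 := by
  by_contra hh
  have hU : F.U ≠ 0 := fun e => by simpa [e] using F.dU_U
  have lin : ∀ c d : ℕ, (c : K) ≠ 0 → (c : K) * g ≠ d := fun c d hc e =>
    hg₁ (R.g₁_eq_zero_of_linear hc e)
  have hg0 : g ≠ 0 := fun e => lin 1 0 (by simp) (by simp [e])
  have hmg : 1 + m * g ≠ 0 := fun e => by
    have := congrArg F.dl e
    simp [R.dl_g, hm, hg₁] at this
  have h3 : 1 - 3 * m * g ≠ 0 := fun e => by
    have := congrArg F.dl e
    simp [R.dl_g, hm, hg₁] at this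
  -- Coefficients: `v_relation` becomes L v + nu h = 0 with L = al U² + la a. `M1`, `M0` will govern
  -- the U-derivative of `h`, and `G1`, `G0` its t-derivative. None depends on U or t, except that
  -- `L` contains U.
  obtain ⟨al, hal⟩ : ∃ x, x = g * (1 + m * g) + m * g₁ * (1 - g) := ⟨_, rfl⟩
  obtain ⟨la, hla⟩ : ∃ x, x = (1 - g) * (1 - 3 * m * g - m * g₁) := ⟨_, rfl⟩
  obtain ⟨nu, hnu⟩ : ∃ x, x = (1 + m * g) * (2 * g + g₁) + m * g₁ * (2 + g₁)
    + m * (1 - g) * g₂ := ⟨_, rfl⟩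
  obtain ⟨G1, hG1⟩ : ∃ x, x = al + m * g₁ * g := ⟨_, rfl⟩
  obtain ⟨G0, hG0⟩ : ∃ x, x = a * (la + m * g₁ * (1 - g)) := ⟨_, rfl⟩
  obtain ⟨M1, hM1⟩ : ∃ x, x = -2 * g₁ * nu + (g₁ + g₂) * al := ⟨_, rfl⟩
  obtain ⟨M0, hM0⟩ : ∃ x, x = a * ((2 * g₁ + 4 * g) * nu + (g₁ + g₂) * la) := ⟨_, rfl⟩
  obtain ⟨L, hL⟩ : ∃ x, x = al * F.U ^ 2 + la * a := ⟨_, rfl⟩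
  have al_U : F.dU al = 0 := by simp [hal, R.dU_g, R.dU_g₁]
  have la_U : F.dU la = 0 := by simp [hla, R.dU_g, R.dU_g₁]
  have nu_U : F.dU nu = 0 := by simp [hnu, R.dU_g, R.dU_g₁, R.dU_g₂]
  have al_t : F.dt al = 0 := by simp [hal, R.dt_g, R.dt_g₁]
  have la_t : F.dt la = 0 := by simp [hla, R.dt_g, R.dt_g₁]
  have nu_t : F.dt nu = 0 := by simp [hnu, R.dt_g, R.dt_g₁, R.dt_g₂]
  have G1_U : F.dU G1 = 0 := by simp [hG1, al_U, R.dU_g, R.dU_g₁]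
  have G0_U : F.dU G0 = 0 := by simp [hG0, la_U, R.dU_g, R.dU_g₁, R.dU_a]
  have M1_U : F.dU M1 = 0 := by simp [hM1, al_U, nu_U, R.dU_g₁, R.dU_g₂]
  have M0_U : F.dU M0 = 0 := by simp [hM0, la_U, nu_U, R.dU_g, R.dU_g₁, R.dU_g₂, R.dU_a]
  have M1_t : F.dt M1 = 0 := by simp [hM1, al_t, nu_t, R.dt_g₁, R.dt_g₂]
  have M0_t : F.dt M0 = 0 := by simp [hM0, la_t, nu_t, R.dt_g, R.dt_g₁, R.dt_g₂, R.dt_a]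
  have L_U : F.dU L = 2 * al * F.U := by
    simp [hL, al_U, la_U, R.dU_a, Derivation.leibniz_pow]; ring
  have L_t : F.dt L = 0 := by simp [hL, al_t, la_t, R.dt_a, Derivation.leibniz_pow]
  have hv : L * v = -nu * h := by
    have := R.v_relation hm
    rw [← hal, ← hla, ← hnu, ← hL] at this
    linear_combination this
  have hw : g₁ * (F.r * F.dt w) = F.dU (L * h) := by
    have := R.dt_w_relation hm
    rwa [← hal, ← hla, ← hL] at this
  -- If `L = 0`, then al = la = 0, and `g` is a root of a polynomial with integer coefficients in m.
  -- Its ρ-derivative forces 8 g = 3, which contradicts `g₁ ≠ 0`.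
  have hLne : L ≠ 0 := by
    intro e
    obtain ⟨e0, -, e2⟩ := quadratic_eq_zero (F := F) (c₀ := la * a) (c₁ := 0) (c₂ := al)
      (by simp [la_U, R.dU_a]) (by simp) al_U (by linear_combination e - hL)
    have e3 : 1 - 3 * m * g - m * g₁ = 0 := by simpa [hla, ha, hg] using e0
    have e4 : 1 - 3 * m * g + 4 * m * g ^ 2 = 0 := by
      linear_combination e2 - hal + (1 - g) * e3
    have e5 := congrArg F.dl e4
    simp [R.dl_g, Derivation.leibniz_pow] at e5
    have e6 : m * g₁ * (8 * g - 3) = 0 := by linear_combination e5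
    have e7 : 8 * g - 3 = 0 := by simpa [hm, hg₁] using e6
    exact lin 8 3 (by simp) (by push_cast; linear_combination e7)
  -- Eliminate the ρ-derivative of `h` between `dl_h_relation` and `wave`, then remove `v` by `hv`.
  have hQ : 2 * g₁ * L * (F.U * F.dU h) = (M1 * F.U ^ 2 + M0) * h := by
    have h8 := R.dl_h_relation hm
    have h9 := R.wave
    rw [hM1, hM0]
    linear_combination -2 * g₁ * L * h9 - L * h8 + (2 * g₁ * (F.U ^ 2 - a) - 4 * g * a) * hv
      + (g₁ + g₂) * h * hL
  have hT : g₁ * (F.r * F.dt h)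
      = -(2 * G1 * F.U * h + (G1 * F.U ^ 2 + G0) * F.dU h) := by
    have h4 := R.dt_h
    simp [R.dU_B, L_U] at h4 hw
    rw [R.B_eq] at h4
    rw [hG1, hG0]
    linear_combination g₁ * h4 - hw - F.dU h * hL
  -- The coefficients of `hQ` do not depend on t, so differentiating it in t shows that the
  -- logarithmic t-derivative `κ` of `h` does not depend on U.
  obtain ⟨κ, hκ⟩ : ∃ κ, F.dt h = κ * h := ⟨F.dt h / h, by field_simp⟩
  have hκU : F.dU κ = 0 := by
    have e1 := congrArg F.dt hQ
    have e2 := congrArg F.dU hκ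
    simp [R.dt_g₁, L_t, M1_t, M0_t, Derivation.leibniz_pow] at e1 e2
    have e3 : (2 * g₁ * L * F.U * h) * F.dU κ = 0 := by
      linear_combination e1 - 2 * g₁ * L * F.U * e2 - κ * hQ + (M1 * F.U ^ 2 + M0) * hκ
    simpa [hg₁, hLne, hU, hh] using e3
  -- Insert `hQ` and `hκ` into `hT` and divide by `h`. The terms with κ are odd in U, so the even
  -- coefficients constrain `g` alone.
  obtain ⟨c0, -, c2, -, c4⟩ := quartic_eq_zero (F := F) (c₀ := G0 * M0)
    (c₁ := 2 * g₁ ^ 2 * F.r * κ * la * a) (c₂ := 4 * g₁ * G1 * la * a + G0 * M1 + G1 * M0)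
    (c₃ := 2 * g₁ ^ 2 * F.r * κ * al) (c₄ := 4 * g₁ * G1 * al + G1 * M1)
    (by simp [G0_U, M0_U]) (by simp [R.dU_g₁, hκU, la_U, R.dU_a, Derivation.leibniz_pow])
    (by simp [G0_U, M0_U, G1_U, M1_U, R.dU_g₁, la_U, R.dU_a])
    (by simp [R.dU_g₁, hκU, al_U, Derivation.leibniz_pow])
    (by simp [G1_U, M1_U, R.dU_g₁, al_U]) (by
      apply mul_right_cancel₀ hh
      rw [zero_mul]
      linear_combination 2 * g₁ * L * F.U * hT - (G1 * F.U ^ 2 + G0) * hQ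
        - 2 * g₁ ^ 2 * F.r * L * F.U * hκ
        - (2 * g₁ ^ 2 * F.r * κ * F.U + 4 * g₁ * G1 * F.U ^ 2) * h * hL)
  have hG0ne : G0 ≠ 0 := by
    have : G0 = a * ((1 - g) * (1 - 3 * m * g)) := by rw [hG0, hla]; ring
    rw [this]
    exact mul_ne_zero ha (mul_ne_zero hg h3)
  have hM0z : M0 = 0 := by simpa [hG0ne] using c0
  have hLL : -m * g₁ * Y = F.dU (F.dU (L * h)) := by
    have e := congrArg F.dU hw
    rw [← e]
    have := R.dt_dU_w
    simp [R.dU_g₁]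
    linear_combination -g₁ * this
  by_cases hG : G1 = 0
  · have hM1z : M1 = 0 := by simpa [hG, hG0ne] using c2
    have hUh : F.dU h = 0 := by simpa [hM0z, hM1z, hg₁, hLne, hU] using hQ
    have e1 : -m * g₁ * Y = 2 * al * h := by
      rw [hLL]; simp [hUh, L_U, al_U]; ring
    have e2 : -m * g₁ * ((2 * g + g₁) * L - B * nu) = 2 * al * L := by
      apply mul_right_cancel₀ hh
      linear_combination L * e1 + m * g₁ * L * R.Y_eq + m * g₁ * B * hv
    rw [R.B_eq, hL] at e2
    obtain ⟨-, -, e3⟩ := quadratic_eq_zero (F := F)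
      (c₀ := -m * g₁ * ((2 * g + g₁) * (la * a) - a * (1 - g) * nu) - 2 * al * (la * a)) (c₁ := 0)
      (c₂ := -m * g₁ * ((2 * g + g₁) * al - g * nu) - 2 * al ^ 2)
      (by simp [R.dU_g, R.dU_g₁, R.dU_a, al_U, la_U, nu_U]) (by simp)
      (by simp [R.dU_g, R.dU_g₁, al_U, nu_U, Derivation.leibniz_pow])
      (by linear_combination e2)
    -- `G1 = 0` is a first-order equation for `g`. Together with M0 = M1 = 0 it yields either the
    -- contradiction `e8` or a polynomial equation for `g`, excluded by `lin`.
    have e4 : m * g₁ = -g * (1 + m * g) := by linear_combination hG - hG1 - hal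
    have e5 : al = g ^ 2 * (1 + m * g) := by linear_combination hG - hG1 - g * e4
    have hal0 : al ≠ 0 := by rw [e5]; exact mul_ne_zero (pow_ne_zero _ hg0) hmg
    have e6 : (2 * g₁ + 4 * g) * nu + (g₁ + g₂) * la = 0 := by simpa [hM0, ha] using hM0z
    have e7 : 2 * g₁ * nu = (g₁ + g₂) * al := by linear_combination -hM1z + hM1
    by_cases hk : g₁ + g₂ = 0
    · have hnu0 : nu = 0 := by simpa [hk, hg₁] using e7
      rw [hnu0] at e3
      have e8 : al * (g * (1 + m * g) * g₁) = 0 := by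
        linear_combination e3 + (2 * g + g₁) * al * e4 + 2 * al * e5
      simp [hal0, hg0, hmg, hg₁] at e8
    · have e8 : (g₁ + 2 * g) * al + g₁ * la = 0 := by
        apply mul_left_cancel₀ hk
        linear_combination g₁ * e6 - (g₁ + 2 * g) * e7
      have e9 : g * (1 + m * g) * (1 - 3 * m * g + 2 * m * g ^ 2) = 0 := by
        rw [e5, hla] at e8
        linear_combination -m * e8 + (g ^ 2 * (1 + m * g) + (1 - g) * (1 - 3 * m * g)
          - (1 - g) * (m * g₁ - g * (1 + m * g))) * e4
      have e10 : 1 - 3 * m * g + 2 * m * g ^ 2 = 0 := by simpa [hg0, hmg] using e9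
      have e11 := congrArg F.dl e10
      simp [R.dl_g, Derivation.leibniz_pow] at e11
      have e12 : m * g₁ * (4 * g - 3) = 0 := by linear_combination e11
      have e13 : 4 * g - 3 = 0 := by simpa [hm, hg₁] using e12
      exact lin 4 3 (by simp) (by push_cast; linear_combination e13)
  · have hM1e : M1 = -4 * g₁ * al := by
      apply mul_left_cancel₀ hG
      linear_combination c4
    have e1 : g * la = (1 - g) * al := by
      have : (4 * g₁ * (m * g₁) * a) * (g * la - (1 - g) * al) = 0 := by
        rw [hM1e, hM0z, hG1, hG0] at c2
        linear_combination c2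
      have h4 : 4 * g₁ * (m * g₁) * a ≠ 0 := by simp [hg₁, hm, ha]
      linear_combination (mul_eq_zero.1 this).resolve_left h4
    -- With `G1 ≠ 0` the even coefficients give an explicit equation for `g`. It makes L h
    -- independent of U, hence Y = 0, and the U² coefficient in `e7` reduces to 8 m g⁴ = 0.
    have e2 : g₁ = -4 * g ^ 2 := by
      have : m * (1 - g) * (g₁ + 4 * g ^ 2) = 0 := by
        rw [hla, hal] at e1
        linear_combination -e1
      have := (mul_eq_zero.1 this).resolve_left (mul_ne_zero hm hg)
      linear_combination this
    have e3 : g₂ = 32 * g ^ 3 := by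
      have := congrArg F.dl e2
      simp [R.dl_g₁, R.dl_g, Derivation.leibniz_pow] at this
      linear_combination this - 8 * g * e2
    have e4 : F.dU (L * h) = 0 := by
      have : (2 * g₁ * F.U) * (L * F.dU h + 2 * al * F.U * h) = 0 := by
        rw [hM1e, hM0z] at hQ
        linear_combination hQ
      have := (mul_eq_zero.1 this).resolve_left (by simp [hg₁, hU])
      simp [L_U]
      linear_combination this
    have e5 : Y = 0 := by
      rw [e4, map_zero] at hLL
      simpa [hm, hg₁] using hLL
    have e6 : (2 * g + g₁) * L - B * nu = 0 := by
      apply mul_right_cancel₀ hh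
      rw [R.Y_eq] at e5
      linear_combination L * e5 - B * hv
    rw [R.B_eq, hL] at e6
    obtain ⟨-, -, e7⟩ := quadratic_eq_zero (F := F)
      (c₀ := (2 * g + g₁) * (la * a) - a * (1 - g) * nu) (c₁ := 0)
      (c₂ := (2 * g + g₁) * al - g * nu)
      (by simp [R.dU_g, R.dU_g₁, R.dU_a, la_U, nu_U]) (by simp)
      (by simp [R.dU_g, R.dU_g₁, al_U, nu_U]) (by linear_combination e6)
    rw [hal, hnu, e3, e2] at e7
    have e8 : 8 * m * g ^ 4 = 0 := by linear_combination -e7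
    simp [hm, hg0] at e8

/-- For `g₁ = 0`, `dl_h_relation` becomes g a v = 0, and at g = 0 `v_relation` becomes a v = 0. For
`g₁ ≠ 0`, h = 0 turns `wave` into (U² - a) v = 0, and U² - a is nonzero because its U-derivative is
2 U. -/
lemma v_eq_zero [CharZero K] (hm : (m : K) ≠ 0) (ha : a ≠ 0) (hg : 1 - g ≠ 0) : v = 0 := by
  by_cases hg₁ : g₁ = 0
  · have hg₂ : g₂ = 0 := by rw [← R.dl_g₁, hg₁, map_zero]
    have e1 := R.dl_h_relation hm
    simp [hg₁, hg₂, ha] at e1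
    rcases e1 with e1 | e1
    · have e2 := R.v_relation hm
      simpa [hg₁, hg₂, e1, ha] using e2
    · exact e1
  · have e1 := R.wave
    simp [R.h_eq_zero hm ha hg hg₁] at e1
    refine e1.resolve_left fun e2 => ?_
    have e3 := congrArg F.dU e2
    simp [R.dU_a, Derivation.leibniz_pow] at e3
    simpa [e3] using F.dU_U

end IsReduced
end KinField
end RadialFlow

/-! ### The velocity derivative of a density is affine in the velocity -/

namespace RadialFlow
namespace KinField
variable {K : Type*} [Field K] {F : KinField K}
namespace IsLaw

variable {m : ℕ} {p a f s : K} (H : F.IsLaw m p a f s)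
include H

/-- By `dl_y`, applying ρ ∂_ρ - 1 to `dl_balance` and a ∂_U to `dU_balance` produces the same second
derivatives in t and U. They cancel, and after division by `a` a relation of first order in f_U
remains. -/
lemma sound_relation (ha : a ≠ 0) {σ : K} (hσ : F.dl a = (2 - σ) * a) :
    σ * (F.r * F.dr (F.dU f) + m * (F.dU f - F.U * F.dU (F.dU f)))
      + 2 * m * (F.U * F.dU (F.dU f) - F.dl (F.dU f)) = 0 := by
  have h1 := congrArg F.dl H.dl_balance
  have h2 := congrArg F.dU H.dU_balance
  have h3 := H.dl_balance
  simp [H.dl_y, hσ, H.dt_a, H.dr_a] at h1 h2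
  apply mul_left_cancel₀ ha
  linear_combination h3 - h1 + a * h2

lemma dU_dU_dU [CharZero K] (hm : (m : K) ≠ 0) (ha : a ≠ 0) : F.dU (F.dU (F.dU f)) = 0 := by
  obtain ⟨σ, hσ⟩ : ∃ σ, F.dl a = (2 - σ) * a := ⟨2 - F.dl a / a, by field_simp; ring⟩
  have hE := H.sound_relation ha hσ
  have hσd : ∀ D : Derivation ℤ K K, (∀ x, D (F.dl x) = F.dl (D x)) → D a = 0 → D σ = 0 := by
    intro D hD h0
    have := congrArg D hσ
    simpa [hD, h0, ha] using this
  have hl := congrArg F.dU H.dl_y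
  simp [H.dU_a] at hl
  by_cases h0 : σ = 0
  -- With σ = 0 the relation says that f_U is homogeneous: U f_UU = ρ ∂_ρ f_U. Its derivatives,
  -- compared with the wave equation, force f_UUU = 0.
  · have h1 : F.U * F.dU (F.dU f) - F.dl (F.dU f) = 0 := by simpa [h0, hm] using hE
    have h2 := congrArg F.dU h1
    have h3 := congrArg F.dl h1
    simp at h2 h3
    have h4 : (F.U ^ 2 - a) * F.dU (F.dU (F.dU f)) = 0 := by
      linear_combination F.U * h2 + h3 - h1 + hl
    refine (mul_eq_zero.1 h4).resolve_left fun e2 => ?_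
    have e3 := congrArg F.dU e2
    simp [H.dU_a, Derivation.leibniz_pow] at e3
    simpa [e3] using F.dU_U
  -- The choice g = 1 - 2/σ solves the relation for the r-derivative of f_U; 1 - g = 2/σ is nonzero,
  -- as `v_eq_zero` requires.
  · have hg : ∀ D : Derivation ℤ K K, D σ = 0 → D (1 - 2 / σ) = 0 := by
      intro D hD
      simp [Derivation.leibniz_div, hD]
    have hi : σ * σ⁻¹ = 1 := mul_inv_cancel₀ h0
    have R : F.IsReduced m a (1 - 2 / σ) _ _ (F.dU f) (F.dl f) _ _ _ _ :=
      { dt_a := H.dt_a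
        dr_a := H.dr_a
        dU_a := H.dU_a
        dt_g := hg _ (hσd _ (fun x => (F.dl_dt x).symm) H.dt_a)
        dr_g := hg _ (hσd _ (fun x => (F.dl_dr x).symm) H.dr_a)
        dU_g := hg _ (hσd _ F.dU_dl H.dU_a)
        dl_g := rfl
        dl_g₁ := rfl
        dl_a := by rw [hσ]; field_simp; ring
        dr_w := by
          field_simp
          linear_combination hE
        dr_y := by
          apply mul_left_cancel₀ h0
          have e := H.dU_balance
          field_simp
          linear_combination σ * e - F.U * hE
        dt_y := by
          apply mul_left_cancel₀ (pow_ne_zero 2 h0)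
          have e := H.dU_balance
          have e' := H.dl_balance
          field_simp
          linear_combination σ * e' - F.U * σ * e + (F.U ^ 2 - a) * hE
        dU_y := F.dU_dl f
        dl_y := H.dl_y
        h_eq := rfl
        v_eq := rfl
        B_eq := rfl
        Y_eq := rfl }
    exact R.v_eq_zero hm ha (by simp [h0])

end IsLaw
end KinField
end RadialFlow

/-! ### Normal forms of the density -/

namespace RadialFlow
namespace KinField
variable {K : Type*} [Field K] {F : KinField K}
namespace IsLaw

variable {m : ℕ} {p a f s : K} (H : F.IsLaw m p a f s)
include H

lemma dl_dl_dU (hv : F.dU (F.dU (F.dU f)) = 0) : F.dl (F.dl (F.dU f)) = F.dl (F.dU f) := by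
  have h := congrArg F.dU H.dl_y
  simpa [H.dU_a, hv] using h

lemma dU_dS_p : F.dU (F.dS p) = 0 := by rw [← F.dS_dU, H.dU_p, map_zero]
lemma dr_dS_p : F.dr (F.dS p) = 0 := by rw [← F.dS_dr, H.dr_p, map_zero]
lemma dt_dS_p : F.dt (F.dS p) = 0 := by rw [← F.dS_dt, H.dt_p, map_zero]
lemma dl_dS_p : F.dl (F.dS p) = F.ρ * F.dS a := by rw [← F.dS_dl, H.dl_p]; simp

/-- Commuting the S-derivative of `s` with those in U, ρ and r eliminates the flux, here and in the
next two lemmas. -/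
lemma dS_y : F.ρ * (F.dl (F.dS f) - F.dS f) = F.dS p * F.dU (F.dU f) := by
  have e1 := congrArg F.dS H.dU_s
  have e2 := congrArg F.dU H.dS_s
  simp [H.dU_dS_p] at e1 e2
  linear_combination e2 - F.ρ * e1

lemma dS_w : F.ρ * a * F.dU (F.dS f) = F.dS p * (F.dl (F.dU f) - F.dU f) := by
  have e1 := congrArg F.dS H.dl_s
  have e2 := congrArg F.dl H.dS_s
  simp [H.dl_dS_p] at e1 e2
  linear_combination e2 - F.ρ * e1 - H.dS_s

lemma dS_balance : F.r * (F.dt (F.dS f) + F.U * F.dr (F.dS f)) * F.ρ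
    + F.dS p * (F.r * F.dr (F.dU f) + m * (F.dU f - F.U * F.dU (F.dU f))) = 0 := by
  have e1 := congrArg F.dS H.balance
  have e2 := congrArg F.dr H.dS_s
  simp [H.dr_dS_p] at e1 e2
  linear_combination F.ρ * e1 - F.r * e2 - m * H.dS_s + m * F.U * H.dS_y

/-- The form of `Φ` in the non-entropic case: `Φ_U = α + E U - r E_t / 2`, where `E / ρ` is a
quadratic polynomial in `t` and `r ^ m α` is a constant. -/
theorem normal_form [CharZero K] (hm : (m : K) ≠ 0) (ha : a ≠ 0)
    {E α : K} (hE : E = F.dU (F.dU f)) (hα : α = F.dU f - E * F.U + F.r * F.dt E / 2) :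
    (F.dU E = 0 ∧ F.dr E = 0 ∧ F.dS E = 0 ∧ F.dl E = E ∧ F.dt (F.dt (F.dt E)) = 0) ∧
    (F.dU α = 0 ∧ F.dl α = 0 ∧ F.dt α = 0 ∧ F.dS α = 0 ∧ F.r * F.dr α = -m * α) ∧
    F.dS p * α = 0 ∧ F.dt E * ((m + 1) * F.dl a - 2 * a) = 0 ∧
    F.dt E * ((m + 1) * F.dl (F.dS p) - (m + 3) * F.dS p) = 0 := by
  have hv := H.dU_dU_dU hm ha
  have hw2 := H.dl_dl_dU hv
  have r0 := F.r_ne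
  -- On f_U the operator ρ ∂_ρ is idempotent, so f_U splits into the part A + β U constant in ρ and
  -- the part Γ + x U proportional to ρ. The term of ρ Φ_ρ without U is `z`.
  obtain ⟨x, hx⟩ : ∃ x, x = F.dl E := ⟨_, rfl⟩
  obtain ⟨Γ, hΓ⟩ : ∃ Γ, Γ = F.dl (F.dU f - E * F.U) := ⟨_, rfl⟩
  obtain ⟨A, hA⟩ : ∃ A, A = F.dU f - E * F.U - Γ := ⟨_, rfl⟩
  obtain ⟨β, hβ⟩ : ∃ β, β = E - x := ⟨_, rfl⟩
  obtain ⟨z, hz⟩ : ∃ z, z = F.dl f - Γ * F.U - x * F.U ^ 2 / 2 := ⟨_, rfl⟩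
  have EU : F.dU E = 0 := by rw [hE, hv]
  have xl : F.dl x = x := by
    have := congrArg F.dU hw2
    simpa [hx, hE] using this
  have xU : F.dU x = 0 := by simp [hx, EU]
  have βl : F.dl β = 0 := by rw [hβ, map_sub, xl, ← hx, sub_self]
  have βU : F.dU β = 0 := by simp [hβ, xU, EU]
  have Γl : F.dl Γ = Γ := by simp [hΓ, hw2, ← hx, xl]
  have ΓU : F.dU Γ = 0 := by simp [hΓ, ← hE, EU]
  have Al : F.dl A = 0 := by
    have e := congrArg F.dl hA
    rw [map_sub, ← hΓ, Γl, sub_self] at e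
    exact e
  have AU : F.dU A = 0 := by simp [hA, ← hE, EU, ΓU]
  have hw : F.dU f = A + Γ + (β + x) * F.U := by rw [hA, hβ]; ring
  have hy : F.dl f = z + Γ * F.U + x * F.U ^ 2 / 2 := by rw [hz]; ring
  have hyU : F.dl (F.dU f) = Γ + x * F.U := by rw [hw]; simp [Al, Γl, βl, xl]; ring
  have zU : F.dU z = 0 := by
    rw [hz]; simp [hyU, ΓU, xU, Derivation.leibniz_pow, Derivation.leibniz_div]; ring
  have zl : F.dl z = z + a * (β + x) := by
    have := H.dl_y
    rw [hy, ← hE] at this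
    simp [Γl, xl, Derivation.leibniz_div] at this
    linear_combination this - a * hβ
  have D1 := H.dU_balance
  have D2 := H.dl_balance
  rw [hyU] at D1
  rw [← hE] at D2
  rw [hw, hy] at D1 D2
  simp [Derivation.leibniz_pow, Derivation.leibniz_div] at D1 D2
  -- Each coefficient of U in the two differentiated balances vanishes separately.
  obtain ⟨a0, a1, a2⟩ := quadratic_eq_zero (F := F) (c₀ := F.r * (F.dt A + F.dt Γ + F.dr z))
    (c₁ := F.r * (F.dt β + F.dt x + F.dr A + 2 * F.dr Γ) + m * A)
    (c₂ := F.r * (F.dr β + 3 * F.dr x / 2) + m * β)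
    (by simp [AU, ΓU, zU]) (by simp [AU, ΓU, βU, xU])
    (by simp [βU, xU, Derivation.leibniz_div])
    (by linear_combination D1)
  have xr : F.dr x = 0 := by
    have := congrArg F.dl a2
    simpa [Derivation.leibniz_div, xl, βl, r0] using this
  rw [xr] at D2
  obtain ⟨b0, b1, b2⟩ := quadratic_eq_zero (F := F)
    (c₀ := F.r * F.dt z + a * (F.r * (F.dr A + F.dr Γ) + m * (A + Γ)))
    (c₁ := F.r * (F.dt Γ + F.dr z + a * F.dr β))
    (c₂ := F.r * (F.dt x / 2 + F.dr Γ))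
    (by simp [AU, ΓU, zU, H.dU_a]) (by simp [ΓU, βU, zU, H.dU_a])
    (by simp [ΓU, xU, Derivation.leibniz_div])
    (by linear_combination D2 - a * m * F.U * hβ)
  have Γr : F.dr Γ = -F.dt x / 2 := by
    linear_combination (mul_eq_zero.1 b2).resolve_left r0
  have zr : F.dr z = -F.dt A - F.dt Γ := by
    linear_combination (mul_eq_zero.1 a0).resolve_left r0
  have βr : F.r * F.dr β = -m * β := by
    rw [xr] at a2; linear_combination a2
  have Ar : F.r * F.dr A = -m * A - F.r * F.dt β := by
    rw [Γr] at a1; linear_combination a1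
  have At : F.r * F.dt A = -m * a * β := by
    have := (mul_eq_zero.1 b1).resolve_left r0
    rw [zr] at this
    linear_combination -F.r * this + a * βr
  -- If β ≠ 0, `At` forces ρ a_ρ = 0. Commuting r and t on `A` gives r² β_tt = -m a β, and commuting
  -- r with ∂_t² on `β` then leaves 2 m a β = 0.
  have β0 : β = 0 := by
    by_contra hβ0
    have e1 : F.dl a = 0 := by
      have := congrArg F.dl At
      simpa [Al, βl, hβ0, Nat.cast_ne_zero.1 hm] using this
    have e2 := congrArg F.dr At
    have e3 := congrArg F.dt Ar
    have e4 := congrArg F.dt βr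
    simp [H.dr_a] at e2 e3 e4
    have e5 : F.r ^ 2 * F.dt (F.dt β) = -m * a * β := by
      linear_combination F.r * e3 - F.r * e2 - (m - 1) * At + m * a * βr
    have e6 := congrArg F.dr e5
    have e7 := congrArg F.dt e4
    simp [H.dr_a, Derivation.leibniz_pow] at e6 e7
    have e8 : 2 * m * a * β = 0 := by
      linear_combination -F.r * e6 + F.r ^ 2 * e7 - (m - 2) * e5 + m * a * βr
    simp [hm, ha, hβ0] at e8
  have xE : x = E := by linear_combination hβ - β0
  rw [xE] at xr Γr xl zl hw
  rw [β0, mul_zero] at At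
  have At0 : F.dt A = 0 := (mul_eq_zero.1 At).resolve_left r0
  rw [β0, map_zero, mul_zero, sub_zero] at Ar
  rw [At0, neg_zero, zero_sub] at zr
  -- This corrects `Γ` to a function without r. Commuting r and t on `z` then gives a polynomial
  -- identity in r with r-free coefficients, whence E_ttt = 0 and γ = 0.
  obtain ⟨γ, hγ⟩ : ∃ γ, γ = Γ + F.r * F.dt E / 2 := ⟨_, rfl⟩
  have γr : F.dr γ = 0 := by
    simp [hγ, Γr, xr, Derivation.leibniz_div]; ring
  have zt : F.r * F.dt z = -a * (m * γ - (m + 1) * F.r * F.dt E / 2) := by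
    linear_combination b0 - a * Ar - a * F.r * Γr + a * m * hγ
  have hΓt : F.dt (F.dt Γ) = F.dt (F.dt γ) - F.r * F.dt (F.dt (F.dt E)) / 2 := by
    have e1 : 2 * γ = 2 * Γ + F.r * F.dt E := by rw [hγ]; ring
    have e2 := congrArg F.dt (congrArg F.dt e1)
    simp at e2
    linear_combination -e2 / 2
  have c1 : F.r ^ 2 * F.dt (F.dt γ) - F.r ^ 3 * F.dt (F.dt (F.dt E)) / 2 = -m * a * γ := by
    have e1 := congrArg F.dr zt
    have e2 := congrArg F.dt zr
    simp [H.dr_a, γr, xr, Derivation.leibniz_div] at e1 e2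
    linear_combination -F.r * e1 + F.r ^ 2 * e2 + zt - F.r ^ 2 * hΓt
  have c2 : 2 * F.dt (F.dt γ) - 3 * F.r * F.dt (F.dt (F.dt E)) / 2 = 0 := by
    have e1 := congrArg F.dr c1
    simp [H.dr_a, γr, xr, Derivation.leibniz_div, Derivation.leibniz_pow] at e1
    apply mul_left_cancel₀ r0
    linear_combination e1
  have Ettt : F.dt (F.dt (F.dt E)) = 0 := by
    have e1 := congrArg F.dr c2
    simp [γr, xr, Derivation.leibniz_div] at e1
    exact e1
  have γ0 : γ = 0 := by
    have e1 : F.dt (F.dt γ) = 0 := by linear_combination c2 / 2 + 3 * F.r * Ettt / 4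
    rw [e1, Ettt] at c1
    have e2 : m * a * γ = 0 := by linear_combination c1
    simpa [hm, ha, Nat.cast_ne_zero.1 hm] using e2
  have hαA : α = A := by linear_combination hα + hw + F.U * β0 - hγ + γ0
  have hw' : F.dU f = A + E * F.U - F.r * F.dt E / 2 := by linear_combination hα.symm + hαA
  have zt' : F.dt z = (m + 1) / 2 * a * F.dt E := by
    apply mul_left_cancel₀ r0
    rw [γ0] at zt
    linear_combination zt
  -- Compatibility of the formulas for ∂_t z and ρ ∂_ρ z: unless E is stationary, the pressure
  -- satisfies n ρ p_ρρ = 2 p_ρ, as m + 1 = n.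
  have hEa : F.dt E * ((m + 1) * F.dl a - 2 * a) = 0 := by
    have e1 := congrArg F.dl zt'
    have e2 := congrArg F.dt zl
    simp [H.dt_a, β0, xl, Derivation.leibniz_div] at e1 e2
    linear_combination 2 * e2 - 2 * e1 + 2 * zt'
  rw [hαA]
  have pU := H.dU_dS_p
  have pt := H.dt_dS_p
  have ρ0 := F.ρ_ne
  have s1 := H.dS_y
  rw [← hE] at s1
  have s2 : F.ρ * a * F.dU (F.dS f) = -F.dS p * A := by
    have e1 : 2 * F.dU f = 2 * A + 2 * E * F.U - F.r * F.dt E := by rw [hw']; ring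
    have e3 := congrArg F.dl e1
    simp [Al, xl] at e3
    linear_combination H.dS_w + F.dS p / 2 * e3 - F.dS p * hw'
  have s3 : F.dU (F.dS f) = F.dS A + F.dS E * F.U - F.r * F.dt (F.dS E) / 2 := by
    have e1 : 2 * F.dU f = 2 * A + 2 * E * F.U - F.r * F.dt E := by rw [hw']; ring
    have e2 := congrArg F.dS e1
    simp at e2
    linear_combination e2 / 2
  -- Powers of U in the two formulas for Φ_SU: `E` does not depend on S, and a nonzero `A` forces
  -- p_S = 0 once `A` is also known not to depend on S.
  obtain ⟨s4, s5, -⟩ := quadratic_eq_zero (F := F)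
    (c₀ := F.ρ * a * (2 * F.dS A - F.r * F.dt (F.dS E)) + 2 * F.dS p * A)
    (c₁ := F.ρ * a * (2 * F.dS E)) (c₂ := 0)
    (by simp [H.dU_a, pU, AU, EU, ← F.dS_dU]) (by simp [H.dU_a, EU, ← F.dS_dU]) (map_zero _)
    (by linear_combination 2 * s2 - 2 * F.ρ * a * s3)
  have ES : F.dS E = 0 := by simpa [ρ0, ha] using s5
  rw [ES, map_zero, mul_zero, zero_div, sub_zero, zero_mul, add_zero] at s3
  have AS : F.dS A = 0 := by
    have e1 := congrArg F.dU s1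
    simp [pU, EU, ρ0] at e1
    rw [s3, ← F.dS_dl, Al, map_zero] at e1
    linear_combination -e1
  rw [AS] at s3
  have pA : F.dS p * A = 0 := by
    rw [ES, AS, map_zero] at s4
    linear_combination s4 / 2
  have s6 := H.dS_balance
  rw [← hE] at s6
  have s7 : F.dr (F.dS f) = 0 := by
    have e1 := congrArg F.dU s6
    simp [pU, s3, ← hE, xr, EU] at e1
    simpa [ρ0, r0] using e1
  have s8 : F.ρ * F.dt (F.dS f) = (m + 1) / 2 * F.dS p * F.dt E := by
    have e1 : 2 * F.dU f = 2 * A + 2 * E * F.U - F.r * F.dt E := by rw [hw']; ring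
    have e2 := congrArg F.dr e1
    simp [xr] at e2
    rw [s7] at s6
    apply mul_left_cancel₀ r0
    linear_combination s6 - F.dS p * F.r / 2 * e2 - F.dS p * m * hw' - F.dS p * Ar
  refine ⟨⟨EU, xr, ES, xl, Ettt⟩, ⟨AU, Al, At0, AS, Ar⟩, pA, hEa, ?_⟩
  -- Commuting t and ρ on Φ_S gives the second pressure condition attached to E_t.
  have e1 := congrArg F.dt s1
  have e2 := congrArg F.dl s8
  simp [pt, xl, Derivation.leibniz_div] at e1 e2
  linear_combination 2 * e1 - 2 * e2 + 4 * s8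
/-- The form of `Φ` in the entropic case: `Φ_U = E U` with `E / ρ` a function of `S`. -/
theorem normal_form_entropic [CharZero K] (hm : (m : K) ≠ 0) (ha : a = 0) (hp : F.dS p ≠ 0)
    {E : K} (hE : E = F.dU (F.dU f)) :
    F.dU E = 0 ∧ F.dt E = 0 ∧ F.dr E = 0 ∧ F.dl E = E ∧ F.dU f = E * F.U := by
  have r0 := F.r_ne
  have ρ0 := F.ρ_ne
  have hl : F.dl (F.dU f) = F.dU f := by
    have e := H.dS_w
    rw [ha, mul_zero, zero_mul] at e
    linear_combination (mul_eq_zero.1 e.symm).resolve_left hp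
  have El : F.dl E = E := by
    have := congrArg F.dU hl
    simpa [hE] using this
  have EU : F.dU E = 0 := by
    have e := congrArg F.dU H.dS_y
    have e' := congrArg F.dS hl
    simp at e'
    simpa [H.dU_dS_p, hp, ← hE, e'] using e
  have hy : F.dt (F.dl f) + F.U * F.dr (F.dl f) = 0 := by
    have e := H.dl_balance
    rw [ha, zero_mul, add_zero] at e
    exact (mul_eq_zero.1 e).resolve_left r0
  obtain ⟨y, hy1⟩ : ∃ y, y = F.dU f - E * F.U := ⟨_, rfl⟩
  have yU : F.dU y = 0 := by simp [hy1, ← hE, EU]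
  have hw : F.dU f = y + E * F.U := by rw [hy1]; ring
  have e1 := congrArg F.dU hy
  simp [hl] at e1
  have e2 := congrArg F.dU e1
  simp [hl, ← hE] at e2
  have wr := congrArg F.dr hw
  simp at wr
  -- Two U-derivatives of the transport equation `hy` leave E_t + 2 y_r + 3 U E_r = 0, whose
  -- coefficients vanish separately.
  obtain ⟨e3, e4, -⟩ := quadratic_eq_zero (F := F) (c₀ := F.dt E + 2 * F.dr y)
    (c₁ := 3 * F.dr E) (c₂ := 0) (by simp [EU, yU]) (by simp [EU]) (map_zero _)
    (by linear_combination e2 - 2 * wr)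
  have Er : F.dr E = 0 := by simpa using e4
  have e5 : F.r * F.dr y + m * y = F.r * F.dt E := by
    have s1 := H.dS_y
    rw [← hE] at s1
    have s1t := congrArg F.dt s1
    have s1r := congrArg F.dr s1
    have s6 := H.dS_balance
    have yS := congrArg F.dS hy
    simp [H.dt_dS_p, H.dr_dS_p] at s1t s1r yS
    rw [← hE] at s6
    apply mul_left_cancel₀ hp
    linear_combination s6 + F.r * s1t + F.r * F.U * s1r - F.r * F.ρ * yS
      - F.dS p * F.r * wr - F.dS p * m * hw
  -- `e3` and `e5` give m y = (3/2) r E_t; the r-derivative, with y_r = -E_t/2, yields (m + 3) E_t =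
  -- 0.
  have Et : F.dt E = 0 := by
    have e6 : m * y = 3 / 2 * F.r * F.dt E := by linear_combination e5 - F.r / 2 * e3
    have e7 := congrArg F.dr (show 2 * (m * y) = 3 * F.r * F.dt E by rw [e6]; ring)
    simp [Er] at e7
    have e8 : ((m : K) + 3) * F.dt E = 0 := by linear_combination -e7 + m * e3
    refine (mul_eq_zero.1 e8).resolve_left ?_
    exact_mod_cast (Nat.succ_ne_zero (m + 2))
  have y0 : y = 0 := by
    have e6 : m * y = 0 := by linear_combination e5 - F.r / 2 * e3 + 3 / 2 * F.r * Et
    exact (mul_eq_zero.1 e6).resolve_left hm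
  exact ⟨EU, Et, Er, El, by rw [hw, y0, zero_add]⟩

/-- A density which is independent of `U`. -/
theorem normal_form_of_dU_eq_zero (h : F.dU f = 0) :
    (F.dU (F.dl f) = 0 ∧ F.dt (F.dl f) = 0 ∧ F.dr (F.dl f) = 0 ∧ F.dl (F.dl f) = F.dl f) ∧
    (F.dU (F.dl f - f) = 0 ∧ F.dl (F.dl f - f) = 0 ∧ F.dS (F.dl f - f) = 0) ∧
    F.dl s = 0 ∧ F.dS s = 0 := by
  have r0 := F.r_ne
  have hl := H.dl_y
  rw [h, map_zero, mul_zero, add_zero] at hl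
  have hU : F.dU (F.dl f) = 0 := by rw [F.dU_dl, h, map_zero]
  have hS : F.dS s = 0 := by
    have e := H.dS_s
    rw [h, mul_zero] at e
    exact (mul_eq_zero.1 e).resolve_left F.ρ_ne
  have hr : F.dr (F.dl f) = 0 := by
    have e := H.dU_balance
    simpa [h, r0] using e
  have ht : F.dt (F.dl f) = 0 := by
    have e := H.dl_balance
    simpa [h, r0, hr] using e
  refine ⟨⟨hU, ht, hr, hl⟩, ⟨by rw [map_sub, hU, h, sub_zero], by rw [map_sub, hl, sub_self], ?_⟩,
    by rw [H.dl_s, h, mul_zero], hS⟩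
  rw [← H.dU_s, F.dS_dU, hS, map_zero]

end IsLaw
end KinField
end RadialFlow

/-! ### Germs of smooth functions along a generic filter -/

noncomputable section
namespace RadialFlow
open Filter Topology

section Germ
variable {E : Type*} [NormedAddCommGroup E] [NormedSpace ℝ E]

/-- A filter with a basis of open sets for which every open set is large or has a large
exterior. -/
class IsGeneric (l : Filter E) : Prop where
  neBot : l.NeBot
  interior_mem : ∀ s ∈ l, interior s ∈ l
  mem_or : ∀ V : Set E, IsOpen V → V ∈ l ∨ interior Vᶜ ∈ l

attribute [instance] IsGeneric.neBot

omit [NormedSpace ℝ E] in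
-- By Baire some ultrafilter refines the residual filter on `O`. For open V the set V ∪ ext V is
-- open and dense, so the ultrafilter selects one of the two. Keeping the sets whose interior it
-- contains gives a filter with a basis of open sets.
lemma exists_isGeneric [CompleteSpace E] {O : Set E} (hO : IsOpen O) (hne : O.Nonempty) :
    ∃ l : Filter E, IsGeneric l ∧ O ∈ l := by
  have : (residual E ⊓ 𝓟 O).NeBot := by
    rw [inf_principal_neBot_iff]
    intro s hs
    obtain ⟨x, hx, hx'⟩ := (dense_of_mem_residual hs).inter_open_nonempty O hO hne
    exact ⟨x, hx', hx⟩
  let 𝒱 : Ultrafilter E := Ultrafilter.of (residual E ⊓ 𝓟 O)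
  have h𝒱 : (𝒱 : Filter E) ≤ residual E ⊓ 𝓟 O := Ultrafilter.of_le _
  let l : Filter E :=
    { sets := {s | interior s ∈ 𝒱}
      univ_sets := by
        rw [mem_ofPred_eq, interior_univ]
        exact univ_mem
      sets_of_superset := fun hs hst => mem_of_superset hs (interior_mono hst)
      inter_sets := fun hs ht => by
        simp only [mem_ofPred_eq, interior_inter] at *
        exact inter_mem hs ht }
  have hl : ∀ s, s ∈ l ↔ interior s ∈ 𝒱 := fun s => Iff.rfl
  refine ⟨l, ⟨⟨fun h => ?_⟩, fun s hs => ?_, fun V hV => ?_⟩, ?_⟩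
  · have : (∅ : Set E) ∈ l := by rw [h]; exact mem_bot
    rw [hl, interior_empty] at this
    exact 𝒱.empty_notMem this
  · rw [hl, interior_interior]; exact hs
  · rw [hl, hl, hV.interior_eq, interior_interior, ← Ultrafilter.union_mem_iff]
    have hd : Dense (V ∪ interior Vᶜ) := by
      rw [interior_compl, dense_iff_closure_eq, closure_union]
      refine eq_univ_of_forall fun x => ?_
      by_cases hx : x ∈ closure V
      · exact Or.inl hx
      · exact Or.inr (subset_closure hx)
    exact (h𝒱.trans inf_le_left) (residual_of_dense_open (hV.union isOpen_interior) hd)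
  · rw [hl, hO.interior_eq]
    exact (h𝒱.trans inf_le_right) (mem_principal_self O)

variable (l : Filter E)

/-- The ring of germs of smooth functions along a filter. -/
def SmoothGerm : Subring (Germ l ℝ) where
  carrier := {γ | ∃ f : E → ℝ, (∀ᶠ x in l, ContDiffAt ℝ ∞ f x) ∧ γ = (f : Germ l ℝ)}
  zero_mem' := ⟨0, Eventually.of_forall fun _ => contDiffAt_const, rfl⟩
  one_mem' := ⟨1, Eventually.of_forall fun _ => contDiffAt_const, rfl⟩
  add_mem' := by
    rintro _ _ ⟨f, hf, rfl⟩ ⟨g, hg, rfl⟩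
    exact ⟨f + g, by filter_upwards [hf, hg] with x h h' using h.add h', rfl⟩
  mul_mem' := by
    rintro _ _ ⟨f, hf, rfl⟩ ⟨g, hg, rfl⟩
    exact ⟨f * g, by filter_upwards [hf, hg] with x h h' using h.mul h', rfl⟩
  neg_mem' := by
    rintro _ ⟨f, hf, rfl⟩
    exact ⟨-f, by filter_upwards [hf] with x h using h.neg, rfl⟩

namespace SmoothGerm
variable {l}

/-- The germ of a smooth function. -/
def mk (f : E → ℝ) (hf : ∀ᶠ x in l, ContDiffAt ℝ ∞ f x) : SmoothGerm l := ⟨f, f, hf, rfl⟩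

lemma exists_mk (γ : SmoothGerm l) : ∃ f hf, γ = mk f hf := by
  obtain ⟨_, f, hf, rfl⟩ := γ
  exact ⟨f, hf, rfl⟩

lemma mk_eq_mk {f g : E → ℝ} {hf : ∀ᶠ x in l, ContDiffAt ℝ ∞ f x}
    {hg : ∀ᶠ x in l, ContDiffAt ℝ ∞ g x} : mk f hf = mk g hg ↔ f =ᶠ[l] g := by
  rw [Subtype.ext_iff]; exact Germ.coe_eq

lemma mk_eq_zero {f : E → ℝ} {hf : ∀ᶠ x in l, ContDiffAt ℝ ∞ f x} :
    mk f hf = 0 ↔ ∀ᶠ x in l, f x = 0 := by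
  rw [Subtype.ext_iff]; exact Germ.coe_eq (g := fun _ => (0 : ℝ))

variable [hl : IsGeneric l]

/-- The set where `f` is smooth and nonzero can be taken open, and the filter contains it or its
exterior. This dichotomy makes the ring of germs a field. -/
lemma eventually_eq_or_ne {f : E → ℝ} (hf : ∀ᶠ x in l, ContDiffAt ℝ ∞ f x) :
    (∀ᶠ x in l, f x = 0) ∨ ∀ᶠ x in l, f x ≠ 0 := by
  have hO := hl.interior_mem _ hf
  set O := interior {x | ContDiffAt ℝ ∞ f x} with hOdef
  have hV : IsOpen (O ∩ f ⁻¹' {0}ᶜ) := by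
    refine ContinuousOn.isOpen_inter_preimage (fun x hx => ?_) isOpen_interior
      isOpen_compl_singleton
    have : ContDiffAt ℝ ∞ f x := interior_subset hx
    exact this.continuousAt.continuousWithinAt
  rcases hl.mem_or _ hV with h | h
  · exact Or.inr (mem_of_superset h fun x hx => hx.2)
  · refine Or.inl ?_
    filter_upwards [h, hO] with x hx hx'
    by_contra hne
    exact interior_subset hx ⟨hx', hne⟩

instance : Field (SmoothGerm l) where
  __ := (inferInstance : CommRing (SmoothGerm l))
  inv γ := ⟨(γ : Germ l ℝ)⁻¹, by
    obtain ⟨f, hf, rfl⟩ := exists_mk γ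
    rcases eventually_eq_or_ne hf with h | h
    · refine ⟨0, Eventually.of_forall fun _ => contDiffAt_const, ?_⟩
      refine Germ.coe_eq.2 ?_
      filter_upwards [h] with x hx
      simp [hx]
    · exact ⟨f⁻¹, by filter_upwards [hf, h] with x h1 h2 using h1.inv h2, rfl⟩⟩
  exists_pair_ne := ⟨0, 1, fun h => by
    rw [Subtype.ext_iff] at h
    exact zero_ne_one h⟩
  mul_inv_cancel γ h := by
    obtain ⟨f, hf, rfl⟩ := exists_mk γ
    rcases eventually_eq_or_ne hf with h' | h'
    · exact absurd (mk_eq_zero.2 h') h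
    · rw [Subtype.ext_iff]
      refine Germ.coe_eq.2 ?_
      filter_upwards [h'] with x hx using mul_inv_cancel₀ hx
  inv_zero := by
    rw [Subtype.ext_iff]
    exact Germ.coe_eq.2 (Eventually.of_forall fun x => inv_zero)
  nnqsmul := _
  qsmul := _

instance : CharZero (SmoothGerm l) := by
  refine charZero_of_inj_zero fun n hn => ?_
  have : ((n : SmoothGerm l) : Germ l ℝ) = ((fun _ => (n : ℝ) : E → ℝ) : Germ l ℝ) := by
    rw [SubringClass.coe_natCast]; rfl
  rw [hn] at this
  have h : (fun _ : E => (0 : ℝ)) =ᶠ[l] fun _ => (n : ℝ) := Germ.coe_eq.1 this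
  obtain ⟨x, hx⟩ := h.exists
  have hx' : (0 : ℝ) = n := hx
  exact_mod_cast hx'.symm

omit hl in
lemma _root_.ContDiffAt.fderiv_apply_const {f : E → ℝ} {x : E} (hf : ContDiffAt ℝ ∞ f x) (v : E) :
    ContDiffAt ℝ ∞ (fun y => fderiv ℝ f y v) x :=
  (hf.fderiv_right (m := ∞) (by simp)).clm_apply contDiffAt_const

/-- Large sets have large interior, so functions with the same germ agree near almost every point
and have the same derivative there. -/
lemma fderiv_congr {f g : E → ℝ} (h : f =ᶠ[l] g) (v : E) :
    (fun x => fderiv ℝ f x v) =ᶠ[l] fun x => fderiv ℝ g x v := by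
  filter_upwards [hl.interior_mem _ h] with x hx
  have : f =ᶠ[𝓝 x] g := mem_interior_iff_mem_nhds.1 hx
  rw [this.fderiv_eq]

/-- Differentiation of germs in the direction `v`. -/
def dir (v : E) : Derivation ℤ (SmoothGerm l) (SmoothGerm l) :=
  Derivation.mk' (AddMonoidHom.toIntLinearMap
    { toFun := fun γ => ⟨Germ.liftOn (γ : Germ l ℝ)
          (fun f => ((fun x => fderiv ℝ f x v : E → ℝ) : Germ l ℝ))
          fun f g h => Germ.coe_eq.2 (fderiv_congr h v), by
        obtain ⟨f, hf, rfl⟩ := exists_mk γ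
        exact ⟨_, hf.mono fun _ hx => hx.fderiv_apply_const v, rfl⟩⟩
      map_zero' := by
        rw [Subtype.ext_iff]
        refine Germ.coe_eq.2 (Eventually.of_forall fun x => ?_)
        simp
      map_add' := fun γ γ' => by
        obtain ⟨f, hf, rfl⟩ := exists_mk γ
        obtain ⟨g, hg, rfl⟩ := exists_mk γ'
        rw [Subtype.ext_iff]
        refine Germ.coe_eq.2 ?_
        filter_upwards [hf, hg] with x h1 h2
        rw [fderiv_fun_add (h1.differentiableAt (by simp)) (h2.differentiableAt (by simp))]
        rfl })
    fun γ γ' => by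
      obtain ⟨f, hf, rfl⟩ := exists_mk γ
      obtain ⟨g, hg, rfl⟩ := exists_mk γ'
      rw [Subtype.ext_iff]
      refine Germ.coe_eq.2 ?_
      filter_upwards [hf, hg] with x h1 h2
      rw [fderiv_fun_mul (h1.differentiableAt (by simp)) (h2.differentiableAt (by simp))]
      rfl

lemma dir_mk (v : E) (f : E → ℝ) (hf : ∀ᶠ x in l, ContDiffAt ℝ ∞ f x) :
    dir v (mk f hf) = mk (fun x => fderiv ℝ f x v)
      (hf.mono fun _ hx => hx.fderiv_apply_const v) := rfl

lemma dir_comm (u v : E) (γ : SmoothGerm l) : dir u (dir v γ) = dir v (dir u γ) := by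
  obtain ⟨f, hf, rfl⟩ := exists_mk γ
  simp only [dir_mk, mk_eq_mk]
  filter_upwards [hf] with x hx
  have hd : DifferentiableAt ℝ (fderiv ℝ f) x :=
    (hx.fderiv_right (m := ∞) (by simp)).differentiableAt (by simp)
  have key : ∀ w w' : E, fderiv ℝ (fun y => fderiv ℝ f y w) x w' = fderiv ℝ (fderiv ℝ f) x w' w := by
    intro w w'
    rw [fderiv_clm_apply hd (differentiableAt_const w)]
    simp
  rw [key, key]
  exact (hx.isSymmSndFDerivAt (by
    rw [minSmoothness_of_isRCLikeNormedField]; exact ENat.LEInfty.out)) u v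

end SmoothGerm
end Germ

end RadialFlow
end

/-! ### Kinematic coordinates and the field of kinematic germs -/

noncomputable section
namespace RadialFlow
open Filter Topology

namespace Kin
/-- The coordinate directions. -/
abbrev eT : Kin := (1, 0, 0, 0, 0)
abbrev eR : Kin := (0, 1, 0, 0, 0)
abbrev eU : Kin := (0, 0, 1, 0, 0)
abbrev eρ : Kin := (0, 0, 0, 1, 0)
abbrev eS : Kin := (0, 0, 0, 0, 1)
end Kin
open Kin

lemma contDiff_t : ContDiff ℝ ∞ Kin.t := contDiff_fst
lemma contDiff_r : ContDiff ℝ ∞ Kin.r := contDiff_snd.fst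
lemma contDiff_U : ContDiff ℝ ∞ Kin.U := contDiff_snd.snd.fst
lemma contDiff_ρ : ContDiff ℝ ∞ Kin.ρ := contDiff_snd.snd.snd.fst
lemma contDiff_S : ContDiff ℝ ∞ Kin.S := contDiff_snd.snd.snd.snd

lemma isOpen_kinDomain {J I : Set ℝ} (hJ : IsOpen J) (hI : IsOpen I) :
    IsOpen (kinDomain J I) :=
  (isOpen_Ioi.preimage contDiff_r.continuous).inter
    ((hJ.preimage contDiff_ρ.continuous).inter (hI.preimage contDiff_S.continuous))

lemma fderiv_t (x : Kin) (v : Kin) : fderiv ℝ Kin.t x v = v.1 := by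
  have : HasFDerivAt Kin.t (ContinuousLinearMap.fst ℝ ℝ (ℝ × ℝ × ℝ × ℝ)) x := hasFDerivAt_fst
  rw [this.fderiv]; rfl

lemma fderiv_r (x : Kin) (v : Kin) : fderiv ℝ Kin.r x v = v.2.1 := by
  have : Kin.r = ((ContinuousLinearMap.fst ℝ ℝ (ℝ × ℝ × ℝ)).comp
      (ContinuousLinearMap.snd ℝ ℝ (ℝ × ℝ × ℝ × ℝ)) : Kin →L[ℝ] ℝ) := rfl
  rw [this, ContinuousLinearMap.fderiv]; rfl

lemma fderiv_U (x : Kin) (v : Kin) : fderiv ℝ Kin.U x v = v.2.2.1 := by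
  have : Kin.U = ((ContinuousLinearMap.fst ℝ ℝ (ℝ × ℝ)).comp
      ((ContinuousLinearMap.snd ℝ ℝ (ℝ × ℝ × ℝ)).comp (ContinuousLinearMap.snd ℝ ℝ (ℝ × ℝ × ℝ × ℝ))) : Kin →L[ℝ] ℝ) := rfl
  rw [this, ContinuousLinearMap.fderiv]; rfl

lemma fderiv_ρ (x : Kin) (v : Kin) : fderiv ℝ Kin.ρ x v = v.2.2.2.1 := by
  have : Kin.ρ = ((ContinuousLinearMap.fst ℝ ℝ ℝ).comp ((ContinuousLinearMap.snd ℝ ℝ (ℝ × ℝ)).comp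
      ((ContinuousLinearMap.snd ℝ ℝ (ℝ × ℝ × ℝ)).comp (ContinuousLinearMap.snd ℝ ℝ (ℝ × ℝ × ℝ × ℝ)))) : Kin →L[ℝ] ℝ) := rfl
  rw [this, ContinuousLinearMap.fderiv]; rfl

/-- A field with commuting derivations `∂_t, ∂_r, ∂_U, ∂_ρ, ∂_S`. -/
def KinField.ofPartial {K : Type*} [Field K] (D : Fin 5 → Derivation ℤ K K) (r U ρ : K)
    (hD : ∀ i j x, D i (D j x) = D j (D i x))
    (hr : ∀ i, D i r = if i = 1 then 1 else 0) (hU : ∀ i, D i U = if i = 2 then 1 else 0)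
    (hρ : ∀ i, D i ρ = if i = 3 then 1 else 0) (h0 : ρ ≠ 0) : KinField K where
  dt := D 0
  dr := D 1
  dU := D 2
  dl := ρ • D 3
  dS := D 4
  r := r
  U := U
  ρ := ρ
  dr_dt := hD _ _
  dU_dt := hD _ _
  dS_dt := hD _ _
  dU_dr := hD _ _
  dS_dr := hD _ _
  dS_dU := hD _ _
  dl_dt x := by simp [hρ, hD 0 3]
  dl_dr x := by simp [hρ, hD 1 3]
  dU_dl x := by simp [hρ, hD 2 3]
  dS_dl x := by simp [hρ, hD 4 3]
  dt_r := by simp [hr]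
  dr_r := by simp [hr]
  dl_r := by simp [hr]
  dU_r := by simp [hr]
  dS_r := by simp [hr]
  dt_U := by simp [hU]
  dr_U := by simp [hU]
  dl_U := by simp [hU]
  dU_U := by simp [hU]
  dS_U := by simp [hU]
  dt_ρ := by simp [hρ]
  dr_ρ := by simp [hρ]
  dl_ρ := by simp [hρ]
  dU_ρ := by simp [hρ]
  dS_ρ := by simp [hρ]
  ρ_ne := h0

/-- The coordinate directions of the kinematic space. -/
def Kin.dirs : Fin 5 → Kin := ![eT, eR, eU, eρ, eS]

/-- The differential field of germs of smooth kinematic functions. -/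
def germField (l : Filter Kin) [hl : IsGeneric l] (h : ∀ᶠ x in l, x.ρ ≠ 0) :
    KinField (SmoothGerm l) :=
  KinField.ofPartial (fun i => SmoothGerm.dir (Kin.dirs i))
    (SmoothGerm.mk Kin.r (Eventually.of_forall fun _ => contDiff_r.contDiffAt))
    (SmoothGerm.mk Kin.U (Eventually.of_forall fun _ => contDiff_U.contDiffAt))
    (SmoothGerm.mk Kin.ρ (Eventually.of_forall fun _ => contDiff_ρ.contDiffAt))
    (fun _ _ _ => SmoothGerm.dir_comm _ _ _)
    (fun i => by
      rw [SmoothGerm.dir_mk]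
      fin_cases i <;> exact SmoothGerm.mk_eq_mk (hg := Eventually.of_forall fun _ =>
        contDiffAt_const).2 (Eventually.of_forall fun x => fderiv_r x _))
    (fun i => by
      rw [SmoothGerm.dir_mk]
      fin_cases i <;> exact SmoothGerm.mk_eq_mk (hg := Eventually.of_forall fun _ =>
        contDiffAt_const).2 (Eventually.of_forall fun x => fderiv_U x _))
    (fun i => by
      rw [SmoothGerm.dir_mk]
      fin_cases i <;> exact SmoothGerm.mk_eq_mk (hg := Eventually.of_forall fun _ =>
        contDiffAt_const).2 (Eventually.of_forall fun x => fderiv_ρ x _))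
    (fun h0 => by
      obtain ⟨x, h1, h2⟩ := (h.and (SmoothGerm.mk_eq_zero.1 h0)).exists
      exact h1 h2)

end RadialFlow
end

/-! ### From the jet condition to the determining equations -/

noncomputable section
namespace RadialFlow
open Filter Topology Kin

/-- The pressure as a function of the kinematic variables. -/
def kinPressure (P : ℝ → ℝ → ℝ) : Kin → ℝ := fun x => P x.ρ x.S

lemma contDiffOn_thermo {J I : Set ℝ} {P : ℝ → ℝ → ℝ}
    (hP : ContDiffOn ℝ ∞ (fun y : ℝ × ℝ => P y.1 y.2) (J ×ˢ I)) :
    ContDiffOn ℝ ∞ (fun x : Kin => P x.ρ x.S) (kinDomain J I) :=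
  hP.comp (contDiff_ρ.prodMk contDiff_S).contDiffOn fun _ hx => ⟨hx.2.1, hx.2.2⟩

/-- Partial derivatives are derivatives along coordinate lines. -/
lemma fderiv_eq_of_hasDerivAt {f : Kin → ℝ} {x v : Kin} {d : ℝ} (hf : DifferentiableAt ℝ f x)
    {γ : ℝ → Kin} {s : ℝ} (hγ : HasDerivAt γ v s) (hx : γ s = x)
    (h : HasDerivAt (fun τ => f (γ τ)) d s) : fderiv ℝ f x v = d := by
  subst hx
  exact (hf.hasFDerivAt.comp_hasDerivAt s hγ).unique h

lemma hasDerivAt_line_t (x : Kin) : HasDerivAt (fun τ => ((τ, x.2) : Kin)) eT x.t :=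
  (hasDerivAt_id _).prodMk (hasDerivAt_const _ _)
lemma hasDerivAt_line_r (x : Kin) : HasDerivAt (fun τ => ((x.1, τ, x.2.2) : Kin)) eR x.r :=
  (hasDerivAt_const _ _).prodMk ((hasDerivAt_id _).prodMk (hasDerivAt_const _ _))
lemma hasDerivAt_line_U (x : Kin) : HasDerivAt (fun τ => ((x.1, x.2.1, τ, x.2.2.2) : Kin)) eU x.U :=
  (hasDerivAt_const _ _).prodMk ((hasDerivAt_const _ _).prodMk
    ((hasDerivAt_id _).prodMk (hasDerivAt_const _ _)))
lemma hasDerivAt_line_ρ (x : Kin) :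
    HasDerivAt (fun τ => ((x.1, x.2.1, x.2.2.1, τ, x.2.2.2.2) : Kin)) eρ x.ρ :=
  (hasDerivAt_const _ _).prodMk ((hasDerivAt_const _ _).prodMk
    ((hasDerivAt_const _ _).prodMk ((hasDerivAt_id _).prodMk (hasDerivAt_const _ _))))
lemma hasDerivAt_line_S (x : Kin) :
    HasDerivAt (fun τ => ((x.1, x.2.1, x.2.2.1, x.2.2.2.1, τ) : Kin)) eS x.S :=
  (hasDerivAt_const _ _).prodMk ((hasDerivAt_const _ _).prodMk
    ((hasDerivAt_const _ _).prodMk ((hasDerivAt_const _ _).prodMk (hasDerivAt_id _))))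

lemma fderiv_line_ρ {f : Kin → ℝ} {x : Kin} (hf : DifferentiableAt ℝ f x) :
    fderiv ℝ f x eρ = deriv (fun τ => f (x.1, x.2.1, x.2.2.1, τ, x.2.2.2.2)) x.ρ :=
  ((HasFDerivAt.comp_hasDerivAt (f := fun τ => ((x.1, x.2.1, x.2.2.1, τ, x.2.2.2.2) : Kin)) x.ρ
    (hf.hasFDerivAt : HasFDerivAt f _ _) (hasDerivAt_line_ρ x)).deriv).symm

lemma fderiv_line_S {f : Kin → ℝ} {x : Kin} (hf : DifferentiableAt ℝ f x) :
    fderiv ℝ f x eS = deriv (fun τ => f (x.1, x.2.1, x.2.2.1, x.2.2.2.1, τ)) x.S :=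
  ((HasFDerivAt.comp_hasDerivAt (f := fun τ => ((x.1, x.2.1, x.2.2.1, x.2.2.2.1, τ) : Kin)) x.S
    (hf.hasFDerivAt : HasFDerivAt f _ _) (hasDerivAt_line_S x)).deriv).symm

lemma fderiv_coord {f : Kin → ℝ} (x : Kin) (a b c d e : ℝ) :
    fderiv ℝ f x (a, b, c, d, e) = a * fderiv ℝ f x eT + b * fderiv ℝ f x eR
      + c * fderiv ℝ f x eU + d * fderiv ℝ f x eρ + e * fderiv ℝ f x eS := by
  have : ((a, b, c, d, e) : Kin) = a • eT + b • eR + c • eU + d • eρ + e • eS := by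
    simp
  rw [this]
  simp only [map_add, map_smul, smul_eq_mul]

/-- The determining equations of a conservation law, at a point. -/
structure IsDetermining (n : ℕ) (P : ℝ → ℝ → ℝ) (q : Pair) (x : Kin) : Prop where
  flux_U : fderiv ℝ q.2 x eU = x.ρ * fderiv ℝ q.1 x eρ - q.1 x
  flux_ρ : x.ρ * fderiv ℝ q.2 x eρ = pRho P x.ρ x.S * fderiv ℝ q.1 x eU
  flux_S : x.ρ * fderiv ℝ q.2 x eS = pS P x.ρ x.S * fderiv ℝ q.1 x eU
  balance : x.r * (fderiv ℝ q.1 x eT + x.U * fderiv ℝ q.1 x eR + fderiv ℝ q.2 x eR)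
    + ((n : ℝ) - 1) * (q.2 x + x.U * (q.1 x - x.ρ * fderiv ℝ q.1 x eρ)) = 0

/-- The extra factor r avoids the exponent m - 1, which is truncated at m = 0. -/
lemma fderiv_pow_mul {f : Kin → ℝ} {x : Kin} (hf : DifferentiableAt ℝ f x) (m : ℕ) (v : Kin) :
    x.r * fderiv ℝ (fun y : Kin => y.r ^ m * f y) x v
      = x.r ^ m * (x.r * fderiv ℝ f x v + m * v.2.1 * f x) := by
  have hr : DifferentiableAt ℝ Kin.r x := contDiff_r.contDiffAt.differentiableAt (by simp)
  have e : fderiv ℝ (fun y : Kin => y.r ^ m * f y) x v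
      = x.r ^ m * fderiv ℝ f x v + f x * (m * x.r ^ (m - 1) * v.2.1) := by
    have := ((hr.hasFDerivAt.pow m).mul hf.hasFDerivAt).fderiv
    have h2 := congrArg (fun L => L v) this
    refine h2.trans ?_
    simp [fderiv_r, nsmul_eq_mul]
  rw [e]
  rcases m with _ | m
  · simp
  · simp; ring

lemma fderiv_flux {q : Pair} {x : Kin} (h1 : DifferentiableAt ℝ q.1 x)
    (h2 : DifferentiableAt ℝ q.2 x) (v : Kin) :
    fderiv ℝ (fun y : Kin => q.2 y + y.U * q.1 y) x v
      = fderiv ℝ q.2 x v + x.U * fderiv ℝ q.1 x v + v.2.2.1 * q.1 x := by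
  have hU : DifferentiableAt ℝ Kin.U x := contDiff_U.contDiffAt.differentiableAt (by simp)
  have := (h2.hasFDerivAt.add (hU.hasFDerivAt.mul h1.hasFDerivAt)).fderiv
  have h2 := congrArg (fun L => L v) this
  refine h2.trans ?_
  simp [fderiv_U]; ring

/-- The Euler equations remove the time derivatives. What remains is affine in U_r, ρ_r, S_r, with
the defects of the determining equations as coefficients; the factors r and ρ clear denominators. -/
lemma jet_law {n : ℕ} (hn : 1 ≤ n) {J I : Set ℝ} {P : ℝ → ℝ → ℝ} {q : Pair} {j : Jet}
    (hj : j.OnShell n J I P) (hρ : j.ρ ≠ 0) (h1 : DifferentiableAt ℝ q.1 j.base)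
    (h2 : DifferentiableAt ℝ q.2 j.base) :
    j.r * (j.Dt (fun x => x.r ^ (n - 1) * q.1 x)
      + j.Dr (fun x => x.r ^ (n - 1) * (q.2 x + x.U * q.1 x))) * j.ρ
    = j.r ^ (n - 1) * (j.ρ * (j.r * (fderiv ℝ q.1 j.base eT + j.U * fderiv ℝ q.1 j.base eR
          + fderiv ℝ q.2 j.base eR)
        + ((n : ℝ) - 1) * (q.2 j.base + j.U * (q.1 j.base - j.ρ * fderiv ℝ q.1 j.base eρ)))
      + j.r * j.Ur * j.ρ * (fderiv ℝ q.2 j.base eU - (j.ρ * fderiv ℝ q.1 j.base eρ - q.1 j.base))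
      + j.r * j.ρr * (j.ρ * fderiv ℝ q.2 j.base eρ
          - pRho P j.ρ j.S * fderiv ℝ q.1 j.base eU)
      + j.r * j.Sr * (j.ρ * fderiv ℝ q.2 j.base eS
          - pS P j.ρ j.S * fderiv ℝ q.1 j.base eU)) := by
  have hU : DifferentiableAt ℝ Kin.U j.base := contDiff_U.contDiffAt.differentiableAt (by simp)
  have hr := hj.r_pos.ne'
  have e1 := hj.velocity_eqn
  have e2 := hj.density_eqn
  have e3 := hj.entropy_eqn
  have d1 := fderiv_pow_mul h1 (n - 1) (1, 0, j.Ut, j.ρt, j.St)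
  have d2 := fderiv_pow_mul (f := fun y => q.2 y + y.U * q.1 y) (h2.add (hU.mul h1)) (n - 1)
    (0, 1, j.Ur, j.ρr, j.Sr)
  rw [fderiv_flux h1 h2, fderiv_coord (f := q.1), fderiv_coord (f := q.2)] at d2
  rw [fderiv_coord (f := q.1)] at d1
  simp only [Nat.cast_sub hn, Nat.cast_one] at d1 d2
  have b1 : j.base.r = j.r := rfl
  have b2 : j.base.U = j.U := rfl
  rw [b1] at d1 d2
  rw [b2] at d2
  field_simp at e1 e2
  unfold Jet.Dt Jet.Dr
  linear_combination j.ρ * d1 + j.ρ * d2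
    + j.r ^ (n - 1) * j.r * fderiv ℝ q.1 j.base eU * e1
    + j.r ^ (n - 1) * fderiv ℝ q.1 j.base eρ * j.ρ * e2
    + j.r ^ (n - 1) * j.r * fderiv ℝ q.1 j.base eS * j.ρ * e3

lemma isConservationLaw_iff {n : ℕ} (hn : 1 ≤ n) {J I : Set ℝ} (hJ : IsOpen J) (hI : IsOpen I)
    (hJpos : J ⊆ Ioi 0) {P : ℝ → ℝ → ℝ} {q : Pair} :
    IsConservationLaw n J I P q ↔ ContDiffOn ℝ ∞ q.1 (kinDomain J I) ∧
      ContDiffOn ℝ ∞ q.2 (kinDomain J I) ∧ ∀ x ∈ kinDomain J I, IsDetermining n P q x := by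
  have hO := isOpen_kinDomain hJ hI
  have hdiff : ∀ {f : Kin → ℝ}, ContDiffOn ℝ ∞ f (kinDomain J I) → ∀ x ∈ kinDomain J I,
      DifferentiableAt ℝ f x := fun hf x hx =>
    (hf.contDiffAt (hO.mem_nhds hx)).differentiableAt (by simp)
  constructor
  · intro H
    refine ⟨H.smooth_density, H.smooth_flux, fun x hx => ?_⟩
    obtain ⟨hr, hρ, hS⟩ := hx
    have hρ0 : x.ρ ≠ 0 := (hJpos hρ).ne'
    -- Every choice of radial derivatives extends to a jet on shell, so the affine expression
    -- vanishes for all `a`, `b`, `c`; the zero and unit choices isolate its coefficients.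
    have key : ∀ a b c : ℝ, _ := fun a b c => by
      let j : Jet := ⟨x.t, x.r, x.U, x.ρ, x.S,
        -(x.U * a + (pS P x.ρ x.S * c + pRho P x.ρ x.S * b) / x.ρ),
        -((a * x.ρ + x.U * b) + ((n : ℝ) - 1) / x.r * x.U * x.ρ), -(x.U * c), a, b, c⟩
      have hj : j.OnShell n J I P := ⟨hr, hρ, hS, by simp only [j]; ring, by simp only [j]; ring,
        by simp only [j]; ring⟩
      have := jet_law hn hj hρ0 (hdiff H.smooth_density x ⟨hr, hρ, hS⟩)
        (hdiff H.smooth_flux x ⟨hr, hρ, hS⟩)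
      rw [H.law j hj, mul_zero, zero_mul] at this
      exact (mul_eq_zero.1 this.symm).resolve_left (pow_ne_zero _ hr.ne')
    have k0 := key 0 0 0
    have k1 := key 1 0 0
    have k2 := key 0 1 0
    have k3 := key 0 0 1
    simp only [Jet.base] at k0 k1 k2 k3
    have hr0 : x.r ≠ 0 := hr.ne'
    refine ⟨?_, ?_, ?_, ?_⟩
    · apply mul_left_cancel₀ (mul_ne_zero hr0 hρ0)
      linear_combination k1 - k0
    · apply mul_left_cancel₀ hr0
      linear_combination k2 - k0
    · apply mul_left_cancel₀ hr0
      linear_combination k3 - k0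
    · apply mul_left_cancel₀ hρ0
      linear_combination k0
  · rintro ⟨h1, h2, h3⟩
    refine ⟨h1, h2, fun j hj => ?_⟩
    have hx : j.base ∈ kinDomain J I := ⟨hj.r_pos, hj.ρ_mem, hj.S_mem⟩
    have hρ0 : j.ρ ≠ 0 := (hJpos hj.ρ_mem).ne'
    have := jet_law hn hj hρ0 (hdiff h1 _ hx) (hdiff h2 _ hx)
    have D := h3 _ hx
    have d1 : fderiv ℝ q.2 j.base eU = j.ρ * fderiv ℝ q.1 j.base eρ - q.1 j.base := D.flux_U
    have d2 : j.ρ * fderiv ℝ q.2 j.base eρ = pRho P j.ρ j.S * fderiv ℝ q.1 j.base eU := D.flux_ρ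
    have d3 : j.ρ * fderiv ℝ q.2 j.base eS = pS P j.ρ j.S * fderiv ℝ q.1 j.base eU := D.flux_S
    have d4 : j.r * (fderiv ℝ q.1 j.base eT + j.U * fderiv ℝ q.1 j.base eR
          + fderiv ℝ q.2 j.base eR)
        + ((n : ℝ) - 1) * (q.2 j.base + j.U * (q.1 j.base - j.ρ * fderiv ℝ q.1 j.base eρ)) = 0 :=
      D.balance
    rw [d1, d2, d3, d4] at this
    simp only [sub_self, mul_zero, add_zero] at this
    simpa [hρ0, hj.r_pos.ne'] using this

end RadialFlow
end

/-! ### Transfer between functions and germs -/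

noncomputable section
namespace RadialFlow
open Filter Topology Kin

/-- The derivative of `f` in the direction `v`. -/
def pd (v : Kin) (f : Kin → ℝ) : Kin → ℝ := fun x => fderiv ℝ f x v

lemma _root_.ContDiffOn.pd {f : Kin → ℝ} {Ω : Set Kin} (hΩ : IsOpen Ω) (hf : ContDiffOn ℝ ∞ f Ω)
    (v : Kin) : ContDiffOn ℝ ∞ (pd v f) Ω := fun _ hx =>
  ((hf.contDiffAt (hΩ.mem_nhds hx)).fderiv_apply_const v).contDiffWithinAt

lemma eventually_contDiffAt {l : Filter Kin} {f : Kin → ℝ} {Ω : Set Kin} (hΩ : IsOpen Ω)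
    (h : Ω ∈ l) (hf : ContDiffOn ℝ ∞ f Ω) : ∀ᶠ x in l, ContDiffAt ℝ ∞ f x :=
  mem_of_superset h fun _ hx => hf.contDiffAt (hΩ.mem_nhds hx)

namespace SmoothGerm
variable {l : Filter Kin} {f g : Kin → ℝ}

lemma eq_iff_of_coe {γ δ : SmoothGerm l} (hγ : (γ : Germ l ℝ) = (f : Germ l ℝ))
    (hδ : (δ : Germ l ℝ) = (g : Germ l ℝ)) : γ = δ ↔ f =ᶠ[l] g := by
  rw [Subtype.ext_iff, hγ, hδ]; exact Germ.coe_eq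

end SmoothGerm

open SmoothGerm

/-- A point with g ≠ 0 gives an open set of such points, which meets the dense set `Ω'`. A generic
filter containing this intersection would contradict the hypothesis on germs. -/
lemma forall_eq_zero_of_generic {Ω Ω' : Set Kin} (hΩ : IsOpen Ω) (hΩ' : IsOpen Ω')
    (hd : Ω ⊆ closure Ω') {g : Kin → ℝ} (hg : ContinuousOn g Ω)
    (H : ∀ l : Filter Kin, IsGeneric l → Ω ∈ l → Ω' ∈ l → ∀ᶠ x in l, g x = 0) :
    ∀ x ∈ Ω, g x = 0 := by
  intro x hx
  by_contra hne
  have hV : IsOpen (Ω ∩ g ⁻¹' {0}ᶜ) := hg.isOpen_inter_preimage hΩ isOpen_compl_singleton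
  have hn : ((Ω ∩ g ⁻¹' {0}ᶜ) ∩ Ω').Nonempty := mem_closure_iff.1 (hd hx) _ hV ⟨hx, hne⟩
  obtain ⟨l, hl, hO⟩ := exists_isGeneric (hV.inter hΩ') hn
  have h1 := H l hl (mem_of_superset hO fun y hy => hy.1.1) (mem_of_superset hO fun y hy => hy.2)
  obtain ⟨y, hy, hy'⟩ := (h1.and hO).exists
  exact hy'.1.2 hy

section
variable {n : ℕ} {J I : Set ℝ} {P : ℝ → ℝ → ℝ} {q : Pair}

lemma pRho_eq (hJ : IsOpen J) (hI : IsOpen I)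
    (hP : ContDiffOn ℝ ∞ (fun y : ℝ × ℝ => P y.1 y.2) (J ×ˢ I)) {x : Kin}
    (hx : x ∈ kinDomain J I) : pRho P x.ρ x.S = pd eρ (kinPressure P) x :=
  (fderiv_line_ρ (((contDiffOn_thermo hP).contDiffAt
    ((isOpen_kinDomain hJ hI).mem_nhds hx)).differentiableAt (by simp))).symm

lemma pS_eq (hJ : IsOpen J) (hI : IsOpen I)
    (hP : ContDiffOn ℝ ∞ (fun y : ℝ × ℝ => P y.1 y.2) (J ×ˢ I)) {x : Kin}
    (hx : x ∈ kinDomain J I) : pS P x.ρ x.S = pd eS (kinPressure P) x :=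
  (fderiv_line_S (((contDiffOn_thermo hP).contDiffAt
    ((isOpen_kinDomain hJ hI).mem_nhds hx)).differentiableAt (by simp))).symm

lemma pd_kinPressure_eq_zero {x : Kin} (hx : DifferentiableAt ℝ (kinPressure P) x) :
    pd eT (kinPressure P) x = 0 ∧ pd eR (kinPressure P) x = 0 ∧ pd eU (kinPressure P) x = 0 :=
  ⟨fderiv_eq_of_hasDerivAt hx (hasDerivAt_line_t x) rfl
      (hasDerivAt_const x.t (P x.ρ x.S)),
    fderiv_eq_of_hasDerivAt hx (hasDerivAt_line_r x) rfl
      (hasDerivAt_const x.r (P x.ρ x.S)),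
    fderiv_eq_of_hasDerivAt hx (hasDerivAt_line_U x) rfl
      (hasDerivAt_const x.U (P x.ρ x.S))⟩

lemma isLaw_germ (hn : 1 ≤ n) (hJ : IsOpen J) (hI : IsOpen I) (hJpos : J ⊆ Ioi 0)
    (hP : ContDiffOn ℝ ∞ (fun y : ℝ × ℝ => P y.1 y.2) (J ×ˢ I))
    (H : IsConservationLaw n J I P q) {l : Filter Kin} [IsGeneric l] (hl : kinDomain J I ∈ l)
    (h : ∀ᶠ x in l, x.ρ ≠ 0) (hp : ∀ᶠ x in l, ContDiffAt ℝ ∞ (kinPressure P) x)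
    (ha : ∀ᶠ x in l, ContDiffAt ℝ ∞ (pd eρ (kinPressure P)) x)
    (h1 : ∀ᶠ x in l, ContDiffAt ℝ ∞ q.1 x) (h2 : ∀ᶠ x in l, ContDiffAt ℝ ∞ q.2 x) :
    (germField l h).IsLaw (n - 1) (mk _ hp) (mk _ ha) (mk _ h1) (mk _ h2) := by
  have hD := ((isConservationLaw_iff hn hJ hI hJpos).1 H).2.2
  refine ⟨?_, ?_, ?_, rfl, ?_, ?_, ?_, ?_⟩
  · exact (eq_iff_of_coe (f := pd eT (kinPressure P)) (g := fun _ => 0) rfl rfl).2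
      (hp.mono fun x hx => (pd_kinPressure_eq_zero (hx.differentiableAt (by simp))).1)
  · exact (eq_iff_of_coe (f := pd eR (kinPressure P)) (g := fun _ => 0) rfl rfl).2
      (hp.mono fun x hx => (pd_kinPressure_eq_zero (hx.differentiableAt (by simp))).2.1)
  · exact (eq_iff_of_coe (f := pd eU (kinPressure P)) (g := fun _ => 0) rfl rfl).2
      (hp.mono fun x hx => (pd_kinPressure_eq_zero (hx.differentiableAt (by simp))).2.2)
  · refine (eq_iff_of_coe (f := pd eU q.2) (g := fun x => x.ρ * pd eρ q.1 x - q.1 x) rfl rfl).2 ?_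
    filter_upwards [hl] with x hx using (hD x hx).flux_U
  · refine (eq_iff_of_coe (f := fun x => x.ρ * pd eρ q.2 x)
      (g := fun x => pd eρ (kinPressure P) x * pd eU q.1 x) rfl rfl).2 ?_
    filter_upwards [hl] with x hx
    rw [← pRho_eq hJ hI hP hx]
    exact (hD x hx).flux_ρ
  · refine (eq_iff_of_coe (f := fun x => x.ρ * pd eS q.2 x)
      (g := fun x => pd eS (kinPressure P) x * pd eU q.1 x) rfl rfl).2 ?_
    filter_upwards [hl] with x hx
    rw [← pS_eq hJ hI hP hx]
    exact (hD x hx).flux_S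
  · refine (eq_iff_of_coe (f := fun x => x.r * (pd eT q.1 x + x.U * pd eR q.1 x + pd eR q.2 x)
      + ((n - 1 : ℕ) : ℝ) * (q.2 x + x.U * (q.1 x - x.ρ * pd eρ q.1 x))) (g := fun _ => 0)
      rfl rfl).2 ?_
    filter_upwards [hl] with x hx
    rw [Nat.cast_sub hn, Nat.cast_one]
    exact (hD x hx).balance

end

end RadialFlow
end

/-! ### Normal form for a nonvanishing sound speed -/

noncomputable section
namespace RadialFlow
open Filter Topology Kin SmoothGerm

lemma convex_kinDomain {J I : Set ℝ} (hJ : IsPreconnected J) (hI : IsPreconnected I) :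
    Convex ℝ (kinDomain J I) := by
  intro x hx y hy a b ha hb hab
  exact ⟨convex_Ioi (0 : ℝ) hx.1 hy.1 ha hb hab, hJ.ordConnected.convex hx.2.1 hy.2.1 ha hb hab,
    hI.ordConnected.convex hx.2.2 hy.2.2 ha hb hab⟩

lemma _root_.Convex.eq_of_fderiv_eq_zero {E : Type*} [NormedAddCommGroup E] [NormedSpace ℝ E]
    {Ω : Set E} (hΩ : Convex ℝ Ω) {f : E → ℝ} (hf : ∀ z ∈ Ω, DifferentiableAt ℝ f z) {x y : E}
    (hx : x ∈ Ω) (hy : y ∈ Ω) (h : ∀ z ∈ Ω, fderiv ℝ f z (y - x) = 0) : f x = f y := by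
  have hmem : ∀ s ∈ Icc (0 : ℝ) 1, x + s • (y - x) ∈ Ω := fun s hs =>
    hΩ.add_smul_sub_mem hx hy hs
  have hd : ∀ s ∈ Icc (0 : ℝ) 1, HasDerivAt (fun s : ℝ => f (x + s • (y - x))) 0 s := fun s hs => by
    have hγ : HasDerivAt (fun s : ℝ => x + s • (y - x)) (y - x) s := by
      simpa using ((hasDerivAt_id s).smul_const (y - x)).const_add x
    have := (hf _ (hmem s hs)).hasFDerivAt.comp_hasDerivAt s hγ
    rwa [h _ (hmem s hs)] at this
  have := constant_of_has_deriv_right_zero (fun s hs => (hd s hs).continuousAt.continuousWithinAt)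
    (fun s hs => (hd s (Ico_subset_Icc_self hs)).hasDerivWithinAt) 1 (by simp)
  simpa using this.symm

section
variable {n : ℕ} {J I : Set ℝ} {P : ℝ → ℝ → ℝ} {q : Pair}

lemma eventually_ρ_ne (hJpos : J ⊆ Ioi 0) {l : Filter Kin} (hl : kinDomain J I ∈ l) :
    ∀ᶠ x in l, x.ρ ≠ 0 := mem_of_superset hl fun _ hx => (hJpos hx.2.1).ne'

/-- A smooth function whose germs are constants is constant. -/
lemma eq_of_generic (hJ : IsOpen J) (hI : IsOpen I) (hJc : IsPreconnected J)
    (hIc : IsPreconnected I) (hJpos : J ⊆ Ioi 0) {Ω' : Set Kin} (hΩ' : IsOpen Ω')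
    (hd : kinDomain J I ⊆ closure Ω') {g : Kin → ℝ} (hg : ContDiffOn ℝ ∞ g (kinDomain J I))
    (H : ∀ (l : Filter Kin) [IsGeneric l] (h : ∀ᶠ x in l, x.ρ ≠ 0)
      (hh : ∀ᶠ x in l, ContDiffAt ℝ ∞ g x), kinDomain J I ∈ l → Ω' ∈ l →
      (germField l h).dt (mk g hh) = 0 ∧ (germField l h).dr (mk g hh) = 0 ∧
      (germField l h).dU (mk g hh) = 0 ∧ (germField l h).dl (mk g hh) = 0 ∧
      (germField l h).dS (mk g hh) = 0) :
    ∀ x ∈ kinDomain J I, ∀ y ∈ kinDomain J I, g x = g y := by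
  have hO := isOpen_kinDomain hJ hI
  have key : ∀ v, (∀ l : Filter Kin, IsGeneric l → kinDomain J I ∈ l → Ω' ∈ l →
      ∀ᶠ x in l, pd v g x = 0) → ∀ x ∈ kinDomain J I, pd v g x = 0 := fun v =>
    forall_eq_zero_of_generic hO hΩ' hd (hg.pd hO v).continuousOn
  have hT := key eT fun l _ h1 h2 => (eq_iff_of_coe (f := pd eT g) (g := fun _ => 0) rfl rfl).1
    (H l (eventually_ρ_ne hJpos h1)
    (eventually_contDiffAt hO h1 hg) h1 h2).1
  have hR := key eR fun l _ h1 h2 => (eq_iff_of_coe (f := pd eR g) (g := fun _ => 0) rfl rfl).1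
    (H l (eventually_ρ_ne hJpos h1)
    (eventually_contDiffAt hO h1 hg) h1 h2).2.1
  have hU := key eU fun l _ h1 h2 => (eq_iff_of_coe (f := pd eU g) (g := fun _ => 0) rfl rfl).1
    (H l (eventually_ρ_ne hJpos h1)
    (eventually_contDiffAt hO h1 hg) h1 h2).2.2.1
  have hS := key eS fun l _ h1 h2 => (eq_iff_of_coe (f := pd eS g) (g := fun _ => 0) rfl rfl).1
    (H l (eventually_ρ_ne hJpos h1)
    (eventually_contDiffAt hO h1 hg) h1 h2).2.2.2.2
  have hρ := key eρ fun l _ h1 h2 => by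
    have e := (eq_iff_of_coe (f := fun x => x.ρ * pd eρ g x) (g := fun _ => 0) rfl rfl).1
      (H l (eventually_ρ_ne hJpos h1) (eventually_contDiffAt hO h1 hg) h1 h2).2.2.2.1
    filter_upwards [e, eventually_ρ_ne hJpos h1] with x hx hx'
    exact (mul_eq_zero.1 hx).resolve_left hx'
  intro x hx y hy
  refine (convex_kinDomain hJc hIc).eq_of_fderiv_eq_zero
    (fun z hz => (hg.contDiffAt (hO.mem_nhds hz)).differentiableAt (by simp)) hx hy fun z hz => ?_
  obtain ⟨a, b, c, d, e⟩ : Kin := y - x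
  rw [fderiv_coord]
  have h1 : fderiv ℝ g z eT = 0 := hT z hz
  have h2 : fderiv ℝ g z eR = 0 := hR z hz
  have h3 : fderiv ℝ g z eU = 0 := hU z hz
  have h4 : fderiv ℝ g z eρ = 0 := hρ z hz
  have h5 : fderiv ℝ g z eS = 0 := hS z hz
  simp [h1, h2, h3, h4, h5]

lemma kinDomain_subset_closure {Q : ℝ → ℝ → Prop}
    (h : J ×ˢ I ⊆ closure {x : ℝ × ℝ | x ∈ J ×ˢ I ∧ Q x.1 x.2}) :
    kinDomain J I ⊆ closure {x | x ∈ kinDomain J I ∧ Q x.ρ x.S} := by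
  rintro ⟨t, r, U, ρ, S⟩ ⟨hr, hρ, hS⟩
  have hc : Continuous fun y : ℝ × ℝ => ((t, r, U, y) : Kin) := by fun_prop
  have := (hc.continuousAt (x := (ρ, S))).continuousWithinAt.mem_closure_image
    (h ⟨hρ, hS⟩)
  refine closure_mono ?_ this
  rintro _ ⟨y, ⟨⟨h1, h2⟩, h3⟩, rfl⟩
  exact ⟨⟨hr, h1, h2⟩, h3⟩

lemma isOpen_kinDomain_inter (hJ : IsOpen J) (hI : IsOpen I) {g : Kin → ℝ}
    (hg : ContDiffOn ℝ ∞ g (kinDomain J I)) : IsOpen {x | x ∈ kinDomain J I ∧ g x ≠ 0} :=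
  hg.continuousOn.isOpen_inter_preimage (isOpen_kinDomain hJ hI) isOpen_compl_singleton

end

section
variable {K : Type*} [Field K] (F : KinField K)

lemma _root_.Derivation.div_eq_zero (D : Derivation ℤ K K) {x y : K} (h : y * D x = x * D y) :
    D (x / y) = 0 := by
  rw [Derivation.leibniz_div, smul_eq_mul, smul_eq_mul, smul_eq_mul, h, sub_self, mul_zero]

/-- The coefficients of the quadratic polynomial `E / ρ` of time `T`. -/
lemma KinField.coeff_const [CharZero K] {E T : K}
    (hE : F.dU E = 0 ∧ F.dr E = 0 ∧ F.dS E = 0 ∧ F.dl E = E ∧ F.dt (F.dt (F.dt E)) = 0)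
    (hT : F.dt T = 1 ∧ F.dr T = 0 ∧ F.dU T = 0 ∧ F.dl T = 0 ∧ F.dS T = 0) (c : K)
    (hc : c = (E - T * F.dt E + T ^ 2 * F.dt (F.dt E) / 2) / F.ρ ∨
      c = (F.dt E - T * F.dt (F.dt E)) / F.ρ ∨ c = F.dt (F.dt E) / 2 / F.ρ) :
    F.dt c = 0 ∧ F.dr c = 0 ∧ F.dU c = 0 ∧ F.dl c = 0 ∧ F.dS c = 0 := by
  obtain ⟨h1, h2, h3, h4, h5⟩ := hE
  obtain ⟨t1, t2, t3, t4, t5⟩ := hT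
  have ρ0 := F.ρ_ne
  have e1 : F.dr (F.dt E) = 0 := by simp [h2]
  have e2 : F.dU (F.dt E) = 0 := by simp [h1]
  have e3 : F.dS (F.dt E) = 0 := by simp [h3]
  have e4 : F.dl (F.dt E) = F.dt E := by simp [h4]
  rcases hc with rfl | rfl | rfl <;> refine ⟨?_, ?_, ?_, ?_, ?_⟩ <;> apply Derivation.div_eq_zero <;>
    simp [*, Derivation.leibniz_div] <;> try ring
end

section
variable {n : ℕ} {J I : Set ℝ} {P : ℝ → ℝ → ℝ} {q : Pair}

lemma pd_periodic {f : Kin → ℝ} {a : Kin} (h : ∀ x, f (x + a) = f x) (v x : Kin) :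
    pd v f (x + a) = pd v f x := by
  unfold pd
  rw [← fderiv_comp_add_right]
  simp only [h]

/-- Certain expressions in Φ_U and its derivatives have germs killed by all derivations on the dense
set where p_ρ ≠ 0, hence are constants on the convex domain. These constants are the coefficients.
-/
theorem exists_normal_form (hn : 2 ≤ n) (hJ : IsOpen J) (hI : IsOpen I) (hJc : IsPreconnected J)
    (hIc : IsPreconnected I) (hJne : J.Nonempty) (hIne : I.Nonempty) (hJpos : J ⊆ Ioi 0)
    (hP : ContDiffOn ℝ ∞ (fun y : ℝ × ℝ => P y.1 y.2) (J ×ˢ I))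
    (hd : J ×ˢ I ⊆ closure {x | x ∈ J ×ˢ I ∧ pRho P x.1 x.2 ≠ 0})
    (H : IsConservationLaw n J I P q) :
    ∃ c₀ c₁ c₂ c₃ : ℝ, (∀ x ∈ kinDomain J I, pd eU q.1 x = c₃ / x.r ^ (n - 1)
        + x.ρ * ((c₀ + c₁ * x.t + c₂ * x.t ^ 2) * x.U - x.r * (c₁ + 2 * c₂ * x.t) / 2)) ∧
      (c₃ ≠ 0 → ∀ x ∈ kinDomain J I, pd eS (kinPressure P) x = 0) ∧
      (c₁ ≠ 0 ∨ c₂ ≠ 0 → ∀ x ∈ kinDomain J I,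
        n * (x.ρ * pd eρ (pd eρ (kinPressure P)) x) = 2 * pd eρ (kinPressure P) x ∧
        n * (x.ρ * pd eρ (pd eS (kinPressure P)) x) = (n + 2) * pd eS (kinPressure P) x) := by
  have hO := isOpen_kinDomain hJ hI
  have hp : ContDiffOn ℝ ∞ (kinPressure P) (kinDomain J I) := contDiffOn_thermo hP
  have ha := hp.pd hO eρ
  have hpS := hp.pd hO eS
  set Ω' : Set Kin := {x | x ∈ kinDomain J I ∧ pd eρ (kinPressure P) x ≠ 0} with hΩ'
  have hΩo : IsOpen Ω' := isOpen_kinDomain_inter hJ hI ha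
  have hcl : kinDomain J I ⊆ closure Ω' := by
    refine (kinDomain_subset_closure (Q := fun ρ S => pRho P ρ S ≠ 0) hd).trans (closure_mono ?_)
    rintro x ⟨h1, h2⟩
    exact ⟨h1, by rwa [← pRho_eq hJ hI hP h1]⟩
  set E : Kin → ℝ := pd eU (pd eU q.1) with hE
  set α : Kin → ℝ := fun x => pd eU q.1 x - E x * x.U + x.r * pd eT E x / 2 with hα
  have sw : ContDiffOn ℝ ∞ (pd eU q.1) (kinDomain J I) := H.smooth_density.pd hO eU
  have sE : ContDiffOn ℝ ∞ E (kinDomain J I) := sw.pd hO eU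
  have sE1 : ContDiffOn ℝ ∞ (pd eT E) (kinDomain J I) := sE.pd hO eT
  have sE2 : ContDiffOn ℝ ∞ (pd eT (pd eT E)) (kinDomain J I) := sE1.pd hO eT
  have sα : ContDiffOn ℝ ∞ α (kinDomain J I) :=
    (sw.sub (sE.mul contDiff_U.contDiffOn)).add ((contDiff_r.contDiffOn.mul sE1).div_const 2)
  have ρ0 : ∀ x ∈ kinDomain J I, x.ρ ≠ 0 := fun x hx => (hJpos hx.2.1).ne'
  have key := fun (l : Filter Kin) (_ : IsGeneric l) (hl : kinDomain J I ∈ l) (hl' : Ω' ∈ l) =>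
    (isLaw_germ (by omega) hJ hI hJpos hP H hl (eventually_ρ_ne hJpos hl)
      (eventually_contDiffAt hO hl hp) (eventually_contDiffAt hO hl ha)
      (eventually_contDiffAt hO hl H.smooth_density)
      (eventually_contDiffAt hO hl H.smooth_flux)).normal_form
      (E := mk E (eventually_contDiffAt hO hl sE)) (α := mk α (eventually_contDiffAt hO hl sα))
      (by have : n - 1 ≠ 0 := by omega
          exact_mod_cast this)
      (fun h0 => by
        obtain ⟨x, h1, h2⟩ := ((mk_eq_zero.1 h0).and hl').exists
        exact h2.2 h1)
      rfl (Subtype.ext rfl)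
  have hT : ∀ (l : Filter Kin) (_ : IsGeneric l) (h : ∀ᶠ x in l, x.ρ ≠ 0), ∃ T : SmoothGerm l,
      T = mk Kin.t (Eventually.of_forall fun _ => contDiff_t.contDiffAt) ∧
      ((germField l h).dt T = 1 ∧ (germField l h).dr T = 0 ∧ (germField l h).dU T = 0 ∧
        (germField l h).dl T = 0 ∧ (germField l h).dS T = 0) := fun l _ h => by
    refine ⟨_, rfl, ?_, ?_, ?_, ?_, ?_⟩
    · exact (eq_iff_of_coe (f := pd eT Kin.t) (g := fun _ => 1) rfl rfl).2
        (Eventually.of_forall fun x => fderiv_t _ _)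
    · exact (eq_iff_of_coe (f := pd eR Kin.t) (g := fun _ => 0) rfl rfl).2
        (Eventually.of_forall fun x => fderiv_t _ _)
    · exact (eq_iff_of_coe (f := pd eU Kin.t) (g := fun _ => 0) rfl rfl).2
        (Eventually.of_forall fun x => fderiv_t _ _)
    · exact (eq_iff_of_coe (f := fun x => x.ρ * pd eρ Kin.t x) (g := fun _ => 0) rfl rfl).2
        (Eventually.of_forall fun x => by simp [pd, fderiv_t])
    · exact (eq_iff_of_coe (f := pd eS Kin.t) (g := fun _ => 0) rfl rfl).2
        (Eventually.of_forall fun x => fderiv_t _ _)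
  -- The Taylor coefficients at t = 0 of the quadratic polynomial E/ρ, computed from its values and
  -- derivatives at an arbitrary t.
  have k0 := eq_of_generic hJ hI hJc hIc hJpos hΩo hcl
    (g := fun x => (E x - x.t * pd eT E x + x.t ^ 2 * pd eT (pd eT E) x / 2) / x.ρ)
    (((sE.sub (contDiff_t.contDiffOn.mul sE1)).add (((contDiff_t.contDiffOn.pow 2).mul
      sE2).div_const 2)).div contDiff_ρ.contDiffOn ρ0)
    fun l _ h hh hl hl' => by
      obtain ⟨T, hT', hT⟩ := hT l _ h
      refine KinField.coeff_const _ (key l _ hl hl').1 hT _ (Or.inl ?_)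
      rw [hT']; exact Subtype.ext rfl
  have k1 := eq_of_generic hJ hI hJc hIc hJpos hΩo hcl
    (g := fun x => (pd eT E x - x.t * pd eT (pd eT E) x) / x.ρ)
    ((sE1.sub (contDiff_t.contDiffOn.mul sE2)).div contDiff_ρ.contDiffOn ρ0)
    fun l _ h hh hl hl' => by
      obtain ⟨T, hT', hT⟩ := hT l _ h
      refine KinField.coeff_const _ (key l _ hl hl').1 hT _ (Or.inr (Or.inl ?_))
      rw [hT']; exact Subtype.ext rfl
  have k2 := eq_of_generic hJ hI hJc hIc hJpos hΩo hcl
    (g := fun x => pd eT (pd eT E) x / 2 / x.ρ)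
    ((sE2.div_const 2).div contDiff_ρ.contDiffOn ρ0)
    fun l _ h hh hl hl' => by
      obtain ⟨T, hT', hT⟩ := hT l _ h
      refine KinField.coeff_const _ (key l _ hl hl').1 hT _ (Or.inr (Or.inr ?_))
      exact Subtype.ext rfl
  have k3 := eq_of_generic hJ hI hJc hIc hJpos hΩo hcl (g := fun x => x.r ^ (n - 1) * α x)
    ((contDiff_r.contDiffOn.pow _).mul sα)
    fun l _ h hh hl hl' => by
      obtain ⟨a1, a2, a3, a4, a5⟩ := (key l _ hl hl').2.1
      have e : mk _ hh = (germField l h).r ^ (n - 1) * mk α (eventually_contDiffAt hO hl sα) :=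
        Subtype.ext rfl
      have r0 := (germField l h).r_ne
      rw [e]
      refine ⟨?_, ?_, ?_, ?_, ?_⟩
      · simp [a3]
      · apply mul_left_cancel₀ r0
        obtain ⟨m, hm⟩ : ∃ m, n - 1 = m + 1 := ⟨n - 2, by omega⟩
        rw [hm] at a5 ⊢
        rw [Derivation.leibniz, Derivation.leibniz_pow]
        simp only [(germField l h).dr_r, smul_eq_mul, nsmul_eq_mul, mul_one, Nat.add_sub_cancel]
        linear_combination (germField l h).r ^ (m + 1) * a5
      · simp [a1]
      · simp [a2]
      · simp [a4]
  obtain ⟨ρ₁, hρ₁⟩ := hJne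
  obtain ⟨S₁, hS₁⟩ := hIne
  have hx₁ : ((0, 1, 0, ρ₁, S₁) : Kin) ∈ kinDomain J I := ⟨one_pos, hρ₁, hS₁⟩
  obtain ⟨c₀, hc₀⟩ : ∃ c, ∀ x ∈ kinDomain J I, (E x - x.t * pd eT E x + x.t ^ 2 * pd eT (pd eT E) x / 2) / x.ρ = c :=
    ⟨_, fun x hx => k0 x hx _ hx₁⟩
  obtain ⟨c₁, hc₁⟩ : ∃ c, ∀ x ∈ kinDomain J I, (pd eT E x - x.t * pd eT (pd eT E) x) / x.ρ = c :=
    ⟨_, fun x hx => k1 x hx _ hx₁⟩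
  obtain ⟨c₂, hc₂⟩ : ∃ c, ∀ x ∈ kinDomain J I, pd eT (pd eT E) x / 2 / x.ρ = c :=
    ⟨_, fun x hx => k2 x hx _ hx₁⟩
  obtain ⟨c₃, hc₃⟩ : ∃ c, ∀ x ∈ kinDomain J I, x.r ^ (n - 1) * α x = c :=
    ⟨_, fun x hx => k3 x hx _ hx₁⟩
  have f2 : ∀ x ∈ kinDomain J I, pd eT (pd eT E) x = 2 * c₂ * x.ρ := fun x hx => by
    have := ρ0 x hx
    rw [← hc₂ x hx]; field_simp
  have f1 : ∀ x ∈ kinDomain J I, pd eT E x = x.ρ * (c₁ + 2 * c₂ * x.t) := fun x hx => by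
    have := ρ0 x hx
    rw [← hc₁ x hx, f2 x hx]; field_simp; ring
  have f0 : ∀ x ∈ kinDomain J I, E x = x.ρ * (c₀ + c₁ * x.t + c₂ * x.t ^ 2) := fun x hx => by
    have := ρ0 x hx
    rw [← hc₀ x hx, f2 x hx, f1 x hx]; field_simp; ring
  refine ⟨c₀, c₁, c₂, c₃, fun x hx => ?_, fun h3 => ?_, fun h12 => ?_⟩
  · have hr : x.r ^ (n - 1) ≠ 0 := pow_ne_zero _ (ne_of_gt hx.1)
    have e : α x = c₃ / x.r ^ (n - 1) := by rw [← hc₃ x hx]; field_simp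
    have e' : pd eU q.1 x = α x + E x * x.U - x.r * pd eT E x / 2 := by simp only [hα]; ring
    rw [e', e, f0 x hx, f1 x hx]; ring
  · have := forall_eq_zero_of_generic hO hΩo hcl (g := fun x => pd eS (kinPressure P) x * α x)
      (hpS.mul sα).continuousOn fun l il hl hl' =>
      (eq_iff_of_coe (f := fun x => pd eS (kinPressure P) x * α x) (g := fun _ => 0) rfl rfl).1
        (key l il hl hl').2.2.1
    refine fun x hx => (mul_eq_zero.1 (this x hx)).resolve_right fun h0 => h3 ?_
    rw [← hc₃ x hx, h0, mul_zero]
  · have e1 := forall_eq_zero_of_generic hO hΩo hcl (g := fun x => pd eT E x *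
        ((((n - 1 : ℕ) : ℝ) + 1) * (x.ρ * pd eρ (pd eρ (kinPressure P)) x)
          - 2 * pd eρ (kinPressure P) x))
      (sE1.mul ((contDiffOn_const.mul (contDiff_ρ.contDiffOn.mul (ha.pd hO eρ))).sub
        (contDiffOn_const.mul ha))).continuousOn fun l il hl hl' =>
      (eq_iff_of_coe (f := fun x => pd eT E x *
        ((((n - 1 : ℕ) : ℝ) + 1) * (x.ρ * pd eρ (pd eρ (kinPressure P)) x)
          - 2 * pd eρ (kinPressure P) x)) (g := fun _ => 0) rfl rfl).1
        (key l il hl hl').2.2.2.1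
    have e2 := forall_eq_zero_of_generic hO hΩo hcl (g := fun x => pd eT E x *
        ((((n - 1 : ℕ) : ℝ) + 1) * (x.ρ * pd eρ (pd eS (kinPressure P)) x)
          - (((n - 1 : ℕ) : ℝ) + 3) * pd eS (kinPressure P) x))
      (sE1.mul ((contDiffOn_const.mul (contDiff_ρ.contDiffOn.mul (hpS.pd hO eρ))).sub
        (contDiffOn_const.mul hpS))).continuousOn fun l il hl hl' =>
      (eq_iff_of_coe (f := fun x => pd eT E x *
        ((((n - 1 : ℕ) : ℝ) + 1) * (x.ρ * pd eρ (pd eS (kinPressure P)) x)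
          - (((n - 1 : ℕ) : ℝ) + 3) * pd eS (kinPressure P) x)) (g := fun _ => 0) rfl rfl).1
        (key l il hl hl').2.2.2.2
    -- E_t may vanish at the time of `x`. The pressure does not depend on t, so the conditions can
    -- be proved at a time `τ` with E_t ≠ 0 and translated back.
    obtain ⟨τ, hτ⟩ : ∃ τ, c₁ + 2 * c₂ * τ ≠ 0 := by
      by_contra! hc
      have h0 := hc 0
      have h1 := hc 1
      rcases h12 with h | h
      · exact h (by linarith)
      · exact h (by linarith)
    rw [Nat.cast_sub (by omega), Nat.cast_one] at e1 e2
    intro x hx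
    set a : Kin := (τ - x.t, 0, 0, 0, 0) with hadef
    have ht : (x + a).t = τ := add_sub_cancel x.1 τ
    have hρ : (x + a).ρ = x.ρ := add_zero _
    have hxa : x + a ∈ kinDomain J I := by
      have hr : (x + a).r = x.r := add_zero _
      have hS : (x + a).S = x.S := add_zero _
      exact ⟨hr ▸ hx.1, hρ ▸ hx.2.1, hS ▸ hx.2.2⟩
    have per : ∀ y, kinPressure P (y + a) = kinPressure P y := fun y => by
      have hρ : (y + a).ρ = y.ρ := add_zero _
      have hS : (y + a).S = y.S := add_zero _
      simp only [kinPressure, hρ, hS]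
    have z1 := e1 _ hxa
    have z2 := e2 _ hxa
    rw [f1 _ hxa, ht, mul_eq_zero, or_iff_right (mul_ne_zero (ρ0 _ hxa) hτ), hρ,
      pd_periodic (pd_periodic per _), pd_periodic per] at z1 z2
    exact ⟨by linear_combination z1, by linear_combination z2⟩
end

end RadialFlow
end

/-! ### Potentials and locally trivial pairs -/

noncomputable section
namespace RadialFlow
open Filter Topology Kin SmoothGerm

/-- A closed one-form `A dt + B dr` on a convex open set is exact. -/
lemma exists_potential {s : Set (ℝ × ℝ)} (hs : Convex ℝ s) (hso : IsOpen s) {A B : ℝ × ℝ → ℝ}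
    (hA : DifferentiableOn ℝ A s) (hB : DifferentiableOn ℝ B s)
    (h : ∀ z ∈ s, fderiv ℝ A z (0, 1) = fderiv ℝ B z (1, 0)) :
    ∃ K : ℝ × ℝ → ℝ, ∀ z ∈ s, HasFDerivAt K
      (A z • ContinuousLinearMap.fst ℝ ℝ ℝ + B z • ContinuousLinearMap.snd ℝ ℝ ℝ) z := by
  refine hs.exists_forall_hasFDerivAt_of_fderiv_symmetric hso
    ((hA.smul_const _).add (hB.smul_const _)) fun z hz x y => ?_
  have dA := (hA.differentiableAt (hso.mem_nhds hz)).hasFDerivAt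
  have dB := (hB.differentiableAt (hso.mem_nhds hz)).hasFDerivAt
  have e := ((dA.smul_const (ContinuousLinearMap.fst ℝ ℝ ℝ)).add
    (dB.smul_const (ContinuousLinearMap.snd ℝ ℝ ℝ))).fderiv
  change fderiv ℝ (fun z => A z • ContinuousLinearMap.fst ℝ ℝ ℝ
    + B z • ContinuousLinearMap.snd ℝ ℝ ℝ) z = _ at e
  rw [e]
  obtain ⟨x₁, x₂⟩ := x
  obtain ⟨y₁, y₂⟩ := y
  have split : ∀ (L : ℝ × ℝ →L[ℝ] ℝ) (u v : ℝ), L (u, v) = u * L (1, 0) + v * L (0, 1) :=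
    fun L u v => by
      have : ((u, v) : ℝ × ℝ) = u • ((1, 0) : ℝ × ℝ) + v • ((0, 1) : ℝ × ℝ) := by simp
      rw [this, map_add, map_smul, map_smul, smul_eq_mul, smul_eq_mul]
  have := h z hz
  simp only [add_apply, ContinuousLinearMap.smulRight_apply,
    smul_apply, ContinuousLinearMap.coe_fst', ContinuousLinearMap.coe_snd',
    smul_eq_mul]
  rw [split _ x₁ x₂, split _ y₁ y₂, split (fderiv ℝ B z) x₁ x₂, split (fderiv ℝ B z) y₁ y₂, this]
  ring

section
variable {n : ℕ} {J I : Set ℝ} {P : ℝ → ℝ → ℝ} {q : Pair}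

/-- A pair whose density and radial flux depend on `t` and `r` only is locally trivial. -/
lemma isLocallyTrivial_of_balance (hn : 1 ≤ n) {χ ψ : ℝ × ℝ → ℝ}
    (hχ : ContDiffOn ℝ ∞ χ {y | 0 < y.2}) (hψ : ContDiffOn ℝ ∞ ψ {y | 0 < y.2})
    (h : ∀ y : ℝ × ℝ, 0 < y.2 → y.2 * (fderiv ℝ χ y (1, 0) + fderiv ℝ ψ y (0, 1))
      + ((n : ℝ) - 1) * ψ y = 0)
    (h1 : ∀ x ∈ kinDomain J I, q.1 x = χ (x.t, x.r))
    (h2 : ∀ x ∈ kinDomain J I, q.2 x + x.U * q.1 x = ψ (x.t, x.r)) :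
    IsLocallyTrivial n J I q := by
  set s : Set (ℝ × ℝ) := {y | 0 < y.2} with hs
  have hso : IsOpen s := isOpen_Ioi.preimage continuous_snd
  have hsc : Convex ℝ s := (convex_Ioi (0 : ℝ)).is_linear_preimage
    (LinearMap.snd ℝ ℝ ℝ).isLinear
  have hr : ContDiff ℝ ∞ fun y : ℝ × ℝ => y.2 ^ (n - 1) := contDiff_snd.pow _
  have sA : ContDiffOn ℝ ∞ (fun y : ℝ × ℝ => -(y.2 ^ (n - 1) * ψ y)) s :=
    (hr.contDiffOn.mul hψ).neg
  have sB : ContDiffOn ℝ ∞ (fun y : ℝ × ℝ => y.2 ^ (n - 1) * χ y) s := hr.contDiffOn.mul hχ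
  -- The balance says that -r^(n-1) ψ dt + r^(n-1) χ dr is closed; its potential divided by r^(n-1)
  -- is the required Θ.
  obtain ⟨K, hK⟩ := exists_potential hsc hso (sA.differentiableOn (by simp))
    (sB.differentiableOn (by simp)) fun z hz => by
      have dr := (hasFDerivAt_snd (𝕜 := ℝ) (p := z)).pow (n - 1)
      have dψ := ((hψ.contDiffAt (hso.mem_nhds hz)).differentiableAt (by simp)).hasFDerivAt
      have dχ := ((hχ.contDiffAt (hso.mem_nhds hz)).differentiableAt (by simp)).hasFDerivAt
      have e1 : fderiv ℝ (fun y : ℝ × ℝ => -(y.2 ^ (n - 1) * ψ y)) z (0, 1)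
          = -(z.2 ^ (n - 1) * fderiv ℝ ψ z (0, 1) + ψ z * (((n - 1 : ℕ) : ℝ) * z.2 ^ (n - 1 - 1))) := by
        refine (congrArg (fun L => L ((0, 1) : ℝ × ℝ)) (dr.mul dψ).neg.fderiv).trans ?_
        simp
      have e2 : fderiv ℝ (fun y : ℝ × ℝ => y.2 ^ (n - 1) * χ y) z (1, 0)
          = z.2 ^ (n - 1) * fderiv ℝ χ z (1, 0) := by
        refine (congrArg (fun L => L ((1, 0) : ℝ × ℝ)) (dr.mul dχ).fderiv).trans ?_
        simp
      rw [e1, e2]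
      have hz0 : z.2 ≠ 0 := ne_of_gt hz
      have := h z hz
      apply mul_left_cancel₀ hz0
      have e3 : ((n - 1 : ℕ) : ℝ) * (z.2 * z.2 ^ (n - 1 - 1)) = ((n : ℝ) - 1) * z.2 ^ (n - 1) := by
        rw [Nat.cast_sub hn, Nat.cast_one]
        rcases Nat.lt_or_ge 1 n with h1 | h1
        · rw [← pow_succ', Nat.sub_add_cancel (by omega)]
        · have : n = 1 := by omega
          subst this; simp
      linear_combination (-z.2 ^ (n - 1)) * this - ψ z * e3
  have hKs : ContDiffOn ℝ ∞ K s := by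
    rw [contDiffOn_infty_iff_fderiv_of_isOpen hso]
    refine ⟨fun z hz => (hK z hz).differentiableAt.differentiableWithinAt, ?_⟩
    exact ((sA.smul contDiffOn_const).add (sB.smul contDiffOn_const)).congr
      fun z hz => (hK z hz).fderiv
  refine ⟨fun t r => K (t, r) / r ^ (n - 1), hKs.div hr.contDiffOn
    fun y hy => pow_ne_zero _ (ne_of_gt hy), fun x hx => ?_⟩
  have hx0 : x.r ≠ 0 := ne_of_gt hx.1
  have hKx := hK (x.t, x.r) hx.1
  have kt : HasDerivAt (fun τ => K (τ, x.r)) (-(x.r ^ (n - 1) * ψ (x.t, x.r))) x.t := by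
    have h := hKx.comp_hasDerivAt x.t ((hasDerivAt_id x.t).prodMk (hasDerivAt_const x.t x.r))
    exact h.congr_deriv (by simp)
  have kr : HasDerivAt (fun y => K (x.t, y)) (x.r ^ (n - 1) * χ (x.t, x.r)) x.r := by
    have h := hKx.comp_hasDerivAt x.r ((hasDerivAt_const x.r x.t).prodMk (hasDerivAt_id x.r))
    exact h.congr_deriv (by simp)
  constructor
  · have e := (kr.div (hasDerivAt_pow (n - 1) x.r) (pow_ne_zero _ hx0)).deriv
    change deriv (fun y => K (x.t, y) / y ^ (n - 1)) x.r = _ at e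
    change _ = deriv (fun y => K (x.t, y) / y ^ (n - 1)) x.r
      + ((n : ℝ) - 1) / x.r * (K (x.t, x.r) / x.r ^ (n - 1))
    rw [e, h1 x hx]
    have e3 : ((n - 1 : ℕ) : ℝ) * (x.r * x.r ^ (n - 1 - 1)) = ((n : ℝ) - 1) * x.r ^ (n - 1) := by
      rw [Nat.cast_sub hn, Nat.cast_one]
      rcases Nat.lt_or_ge 1 n with h1 | h1
      · rw [← pow_succ', Nat.sub_add_cancel (by omega)]
      · have : n = 1 := by omega
        subst this; simp
    field_simp
    linear_combination K (x.t, x.r) * e3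
  · rw [(kt.div_const _).deriv, h2 x hx]
    field_simp

lemma pd_eq_zero_of_generic (hJ : IsOpen J) (hI : IsOpen I)
    {g : Kin → ℝ} (hg : ContDiffOn ℝ ∞ g (kinDomain J I)) (v : Kin)
    (H : ∀ (l : Filter Kin) [IsGeneric l] (hl : kinDomain J I ∈ l),
      dir v (mk g (eventually_contDiffAt (isOpen_kinDomain hJ hI) hl hg)) = 0) :
    ∀ x ∈ kinDomain J I, pd v g x = 0 := by
  have hO := isOpen_kinDomain hJ hI
  refine forall_eq_zero_of_generic hO hO subset_closure (hg.pd hO v).continuousOn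
    fun l il hl _ => ?_
  exact (eq_iff_of_coe (f := pd v g) (g := fun _ => 0) rfl rfl).1 (H l hl)

/-- A smooth function with vanishing partial derivatives in some directions does not depend on the
corresponding variables. -/
lemma eq_of_pd_eq_zero (hJ : IsOpen J) (hI : IsOpen I) (hJc : IsPreconnected J)
    (hIc : IsPreconnected I) {g : Kin → ℝ} (hg : ContDiffOn ℝ ∞ g (kinDomain J I)) {x y : Kin}
    (hx : x ∈ kinDomain J I) (hy : y ∈ kinDomain J I)
    (hT : y.t = x.t ∨ ∀ z ∈ kinDomain J I, pd eT g z = 0)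
    (hR : y.r = x.r ∨ ∀ z ∈ kinDomain J I, pd eR g z = 0)
    (hU : y.U = x.U ∨ ∀ z ∈ kinDomain J I, pd eU g z = 0)
    (hρ : y.ρ = x.ρ ∨ ∀ z ∈ kinDomain J I, pd eρ g z = 0)
    (hS : y.S = x.S ∨ ∀ z ∈ kinDomain J I, pd eS g z = 0) : g x = g y := by
  have hO := isOpen_kinDomain hJ hI
  refine (convex_kinDomain hJc hIc).eq_of_fderiv_eq_zero
    (fun z hz => (hg.contDiffAt (hO.mem_nhds hz)).differentiableAt (by simp)) hx hy fun z hz => ?_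
  have e : y - x = (y.t - x.t, y.r - x.r, y.U - x.U, y.ρ - x.ρ, y.S - x.S) := rfl
  have aux : ∀ {a b : ℝ} {v : Kin}, (b = a ∨ ∀ z ∈ kinDomain J I, pd v g z = 0) →
      (b - a) * fderiv ℝ g z v = 0 := fun h => by
    rcases h with h | h
    · rw [h, sub_self, zero_mul]
    · exact mul_eq_zero_of_right _ (h z hz)
  rw [e, fderiv_coord, aux hT, aux hR, aux hU, aux hρ, aux hS]
  simp

end

end RadialFlow
end

/-! ### Densities independent of the velocity -/

noncomputable section
namespace RadialFlow
open Filter Topology Kin SmoothGerm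

section
variable {n : ℕ} {J I : Set ℝ} {P : ℝ → ℝ → ℝ} {q : Pair}

/-- A conservation law whose density does not depend on the velocity is the sum of an integral
invariant and of a law in `t` and `r`. -/
lemma IsConservationLaw.exists_of_pd_U_eq_zero (hn : 1 ≤ n) (hJ : IsOpen J) (hI : IsOpen I)
    (hJc : IsPreconnected J) (hIc : IsPreconnected I) (hJne : J.Nonempty) (hIne : I.Nonempty)
    (hJpos : J ⊆ Ioi 0) (hP : ContDiffOn ℝ ∞ (fun y : ℝ × ℝ => P y.1 y.2) (J ×ˢ I))
    (H : IsConservationLaw n J I P q) (h0 : ∀ x ∈ kinDomain J I, pd eU q.1 x = 0) :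
    ∃ (f : ℝ → ℝ) (χ ψ : ℝ × ℝ → ℝ), ContDiffOn ℝ ∞ f I ∧
      ContDiffOn ℝ ∞ χ {y | 0 < y.2} ∧ ContDiffOn ℝ ∞ ψ {y | 0 < y.2} ∧
      (∀ y : ℝ × ℝ, 0 < y.2 → y.2 * (fderiv ℝ χ y (1, 0) + fderiv ℝ ψ y (0, 1))
        + ((n : ℝ) - 1) * ψ y = 0) ∧
      (∀ x ∈ kinDomain J I, q.1 x = x.ρ * f x.S + χ (x.t, x.r)) ∧
      ∀ x ∈ kinDomain J I, q.2 x = ψ (x.t, x.r) - x.U * χ (x.t, x.r) := by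
  have hO := isOpen_kinDomain hJ hI
  have hp : ContDiffOn ℝ ∞ (kinPressure P) (kinDomain J I) := contDiffOn_thermo hP
  have s1 := H.smooth_density
  have s2 := H.smooth_flux
  have sz := s1.pd hO eρ
  -- Three quantities separate the variables: `z` depends only on S, while `X = Φ - ρ z` and `W = Ψ
  -- + U X` depend only on t and r. They become `f`, `χ` and `ψ`.
  set z := pd eρ q.1 with hz
  set X : Kin → ℝ := fun x => q.1 x - x.ρ * z x with hX
  have sX : ContDiffOn ℝ ∞ X (kinDomain J I) := s1.sub (contDiff_ρ.contDiffOn.mul sz)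
  set W : Kin → ℝ := fun x => q.2 x + x.U * X x with hW
  have sW : ContDiffOn ℝ ∞ W (kinDomain J I) := s2.add (contDiff_U.contDiffOn.mul sX)
  have law := fun (l : Filter Kin) (_ : IsGeneric l) (hl : kinDomain J I ∈ l) =>
    isLaw_germ hn hJ hI hJpos hP H hl (eventually_ρ_ne hJpos hl)
      (eventually_contDiffAt hO hl hp) (eventually_contDiffAt hO hl (hp.pd hO eρ))
      (eventually_contDiffAt hO hl s1) (eventually_contDiffAt hO hl s2)
  have key := fun (l : Filter Kin) (il : IsGeneric l) (hl : kinDomain J I ∈ l) =>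
    (law l il hl).normal_form_of_dU_eq_zero
      ((eq_iff_of_coe (f := pd eU q.1) (g := fun _ => 0) rfl rfl).2 (mem_of_superset hl h0))
  have zT : ∀ x ∈ kinDomain J I, pd eT z x = 0 := pd_eq_zero_of_generic hJ hI sz _
    fun l il hl => by
      have e : (germField l (eventually_ρ_ne hJpos hl)).dt
        ((germField l (eventually_ρ_ne hJpos hl)).ρ * SmoothGerm.mk z (eventually_contDiffAt hO hl sz)) = 0 :=
        (key l il hl).1.2.1
      rw [Derivation.leibniz, (germField l _).dt_ρ, smul_zero, add_zero, smul_eq_mul] at e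
      exact (mul_eq_zero.1 e).resolve_left (germField l _).ρ_ne
  have zR : ∀ x ∈ kinDomain J I, pd eR z x = 0 := pd_eq_zero_of_generic hJ hI sz _
    fun l il hl => by
      have e : (germField l (eventually_ρ_ne hJpos hl)).dr
        ((germField l (eventually_ρ_ne hJpos hl)).ρ * SmoothGerm.mk z (eventually_contDiffAt hO hl sz)) = 0 :=
        (key l il hl).1.2.2.1
      rw [Derivation.leibniz, (germField l _).dr_ρ, smul_zero, add_zero, smul_eq_mul] at e
      exact (mul_eq_zero.1 e).resolve_left (germField l _).ρ_ne
  have zU : ∀ x ∈ kinDomain J I, pd eU z x = 0 := pd_eq_zero_of_generic hJ hI sz _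
    fun l il hl => by
      have e : (germField l (eventually_ρ_ne hJpos hl)).dU
        ((germField l (eventually_ρ_ne hJpos hl)).ρ * SmoothGerm.mk z (eventually_contDiffAt hO hl sz)) = 0 :=
        (key l il hl).1.1
      rw [Derivation.leibniz, (germField l _).dU_ρ, smul_zero, add_zero, smul_eq_mul] at e
      exact (mul_eq_zero.1 e).resolve_left (germField l _).ρ_ne
  have zρ : ∀ x ∈ kinDomain J I, pd eρ z x = 0 := pd_eq_zero_of_generic hJ hI sz _
    fun l il hl => by
      have e : (germField l (eventually_ρ_ne hJpos hl)).dl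
        ((germField l (eventually_ρ_ne hJpos hl)).ρ * SmoothGerm.mk z (eventually_contDiffAt hO hl sz)) =
        (germField l (eventually_ρ_ne hJpos hl)).ρ * SmoothGerm.mk z (eventually_contDiffAt hO hl sz) :=
        (key l il hl).1.2.2.2
      have ρ0 := (germField l (eventually_ρ_ne hJpos hl)).ρ_ne
      rw [Derivation.leibniz, (germField l _).dl_ρ, smul_eq_mul, smul_eq_mul] at e
      have e' : (germField l (eventually_ρ_ne hJpos hl)).ρ *
        (germField l (eventually_ρ_ne hJpos hl)).dl (SmoothGerm.mk z (eventually_contDiffAt hO hl sz)) = 0 := by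
        linear_combination e
      exact (mul_eq_zero.1 ((mul_eq_zero.1 e').resolve_left ρ0)).resolve_left ρ0
  have eX : ∀ (l : Filter Kin) (il : IsGeneric l) (hl : kinDomain J I ∈ l),
      SmoothGerm.mk X (eventually_contDiffAt hO hl sX) = -((germField l (eventually_ρ_ne hJpos hl)).dl
        (SmoothGerm.mk q.1 (eventually_contDiffAt hO hl s1)) - SmoothGerm.mk q.1 (eventually_contDiffAt hO hl s1)) :=
    fun l il hl => by rw [neg_sub]; exact Subtype.ext rfl
  have dX : ∀ (l : Filter Kin) (il : IsGeneric l) (hl : kinDomain J I ∈ l),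
      (germField l (eventually_ρ_ne hJpos hl)).dU (SmoothGerm.mk X (eventually_contDiffAt hO hl sX)) = 0 ∧
      (germField l (eventually_ρ_ne hJpos hl)).dl (SmoothGerm.mk X (eventually_contDiffAt hO hl sX)) = 0 ∧
      (germField l (eventually_ρ_ne hJpos hl)).dS (SmoothGerm.mk X (eventually_contDiffAt hO hl sX)) = 0 :=
    fun l il hl => by
      have := (key l il hl).2.1
      rw [eX l il hl]
      refine ⟨?_, ?_, ?_⟩ <;> rw [map_neg, neg_eq_zero]
      exacts [this.1, this.2.1, this.2.2]
  have eW : ∀ (l : Filter Kin) (il : IsGeneric l) (hl : kinDomain J I ∈ l),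
      SmoothGerm.mk W (eventually_contDiffAt hO hl sW) = SmoothGerm.mk q.2 (eventually_contDiffAt hO hl s2) +
        (germField l (eventually_ρ_ne hJpos hl)).U * SmoothGerm.mk X (eventually_contDiffAt hO hl sX) :=
    fun l il hl => Subtype.ext rfl
  have XU : ∀ x ∈ kinDomain J I, pd eU X x = 0 := pd_eq_zero_of_generic hJ hI sX _
    fun l il hl => (dX l il hl).1
  have Xρ : ∀ x ∈ kinDomain J I, pd eρ X x = 0 := pd_eq_zero_of_generic hJ hI sX _
    fun l il hl => (mul_eq_zero.1 (dX l il hl).2.1).resolve_left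
      (germField l (eventually_ρ_ne hJpos hl)).ρ_ne
  have XS : ∀ x ∈ kinDomain J I, pd eS X x = 0 := pd_eq_zero_of_generic hJ hI sX _
    fun l il hl => (dX l il hl).2.2
  have WU : ∀ x ∈ kinDomain J I, pd eU W x = 0 := pd_eq_zero_of_generic hJ hI sW _
    fun l il hl => by
      change (germField l (eventually_ρ_ne hJpos hl)).dU _ = 0
      rw [eW l il hl, map_add, Derivation.leibniz, (dX l il hl).1, (germField l _).dU_U,
        (law l il hl).dU_s, eX l il hl, smul_zero, zero_add, smul_eq_mul, mul_one,
        add_neg_cancel]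
  have Wρ : ∀ x ∈ kinDomain J I, pd eρ W x = 0 := pd_eq_zero_of_generic hJ hI sW _
    fun l il hl => by
      refine (mul_eq_zero.1 ?_).resolve_left (germField l (eventually_ρ_ne hJpos hl)).ρ_ne
      change (germField l (eventually_ρ_ne hJpos hl)).dl _ = 0
      rw [eW l il hl, map_add, Derivation.leibniz, (dX l il hl).2.1, (germField l _).dl_U,
        (key l il hl).2.2.1, smul_zero, zero_add, smul_zero, zero_add]
  have WS : ∀ x ∈ kinDomain J I, pd eS W x = 0 := pd_eq_zero_of_generic hJ hI sW _
    fun l il hl => by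
      change (germField l (eventually_ρ_ne hJpos hl)).dS _ = 0
      rw [eW l il hl, map_add, Derivation.leibniz, (dX l il hl).2.2, (germField l _).dS_U,
        (key l il hl).2.2.2, smul_zero, zero_add, smul_zero, zero_add]
  obtain ⟨ρ₁, hρ₁⟩ := hJne
  obtain ⟨S₁, hS₁⟩ := hIne
  set f : ℝ → ℝ := fun S => z (0, 1, 0, ρ₁, S) with hf
  have sι : ContDiff ℝ ∞ fun y : ℝ × ℝ => ((y.1, y.2, 0, ρ₁, S₁) : Kin) :=
    contDiff_fst.prodMk (contDiff_snd.prodMk contDiff_const)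
  have hι : MapsTo (fun y : ℝ × ℝ => ((y.1, y.2, 0, ρ₁, S₁) : Kin)) {y | 0 < y.2}
      (kinDomain J I) := fun y hy => ⟨hy, hρ₁, hS₁⟩
  have hzf : ∀ x ∈ kinDomain J I, z x = f x.S := fun x hx =>
    eq_of_pd_eq_zero hJ hI hJc hIc sz hx (y := (0, 1, 0, ρ₁, x.S)) ⟨one_pos, hρ₁, hx.2.2⟩
      (Or.inr zT) (Or.inr zR) (Or.inr zU) (Or.inr zρ) (Or.inl rfl)
  have hXχ : ∀ x ∈ kinDomain J I, X x = q.1 (x.t, x.r, 0, ρ₁, S₁) - ρ₁ * f S₁ := fun x hx => by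
    have hy : ((x.t, x.r, 0, ρ₁, S₁) : Kin) ∈ kinDomain J I := ⟨hx.1, hρ₁, hS₁⟩
    rw [eq_of_pd_eq_zero hJ hI hJc hIc sX hx hy
      (Or.inl rfl) (Or.inl rfl) (Or.inr XU) (Or.inr Xρ) (Or.inr XS), hX]
    simp only [hzf _ hy]
  have hWψ : ∀ x ∈ kinDomain J I, W x = q.2 (x.t, x.r, 0, ρ₁, S₁) := fun x hx => by
    have hy : ((x.t, x.r, 0, ρ₁, S₁) : Kin) ∈ kinDomain J I := ⟨hx.1, hρ₁, hS₁⟩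
    rw [eq_of_pd_eq_zero hJ hI hJc hIc sW hx hy
      (Or.inl rfl) (Or.inl rfl) (Or.inr WU) (Or.inr Wρ) (Or.inr WS), hW]
    simp
  refine ⟨f, fun y => q.1 (y.1, y.2, 0, ρ₁, S₁) - ρ₁ * f S₁,
    fun y => q.2 (y.1, y.2, 0, ρ₁, S₁), ?_, ?_, ?_, fun y hy => ?_, fun x hx => ?_, fun x hx => ?_⟩
  · exact sz.comp (f := fun S : ℝ => ((0, 1, 0, ρ₁, S) : Kin)) (by fun_prop)
      fun S hS => ⟨one_pos, hρ₁, hS⟩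
  · exact (s1.comp sι.contDiffOn hι).sub contDiffOn_const
  · exact s2.comp sι.contDiffOn hι
  -- At U = 0 the determining balance is the required equation, as the terms with U drop out.
  · have hx := hι hy
    have hD := ((isConservationLaw_iff hn hJ hI hJpos).1 H).2.2 _ hx
    have d1 := ((s1.contDiffAt (hO.mem_nhds hx)).differentiableAt (by simp)).hasFDerivAt
    have d2 := ((s2.contDiffAt (hO.mem_nhds hx)).differentiableAt (by simp)).hasFDerivAt
    have dι := ((hasFDerivAt_fst (𝕜 := ℝ) (p := y)).prodMk ((hasFDerivAt_snd (𝕜 := ℝ)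
      (p := y)).prodMk (hasFDerivAt_const ((0, ρ₁, S₁) : ℝ × ℝ × ℝ) y)))
    have e1 : fderiv ℝ (fun y : ℝ × ℝ => q.1 (y.1, y.2, 0, ρ₁, S₁) - ρ₁ * f S₁) y (1, 0)
        = fderiv ℝ q.1 (y.1, y.2, 0, ρ₁, S₁) eT :=
      congrArg (fun L => L ((1, 0) : ℝ × ℝ)) ((HasFDerivAt.comp y d1 dι).sub_const _).fderiv
    have e2 : fderiv ℝ (fun y : ℝ × ℝ => q.2 (y.1, y.2, 0, ρ₁, S₁)) y (0, 1)
        = fderiv ℝ q.2 (y.1, y.2, 0, ρ₁, S₁) eR :=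
      congrArg (fun L => L ((0, 1) : ℝ × ℝ)) (HasFDerivAt.comp y d2 dι).fderiv
    rw [e1, e2]
    have b : y.2 * (fderiv ℝ q.1 (y.1, y.2, 0, ρ₁, S₁) eT
        + 0 * fderiv ℝ q.1 (y.1, y.2, 0, ρ₁, S₁) eR + fderiv ℝ q.2 (y.1, y.2, 0, ρ₁, S₁) eR)
        + ((n : ℝ) - 1) * (q.2 (y.1, y.2, 0, ρ₁, S₁) + 0 * (q.1 (y.1, y.2, 0, ρ₁, S₁)
        - ρ₁ * fderiv ℝ q.1 (y.1, y.2, 0, ρ₁, S₁) eρ)) = 0 := hD.balance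
    linear_combination b
  · have := hXχ x hx
    simp only [hX] at this
    rw [hzf x hx] at this
    linear_combination this
  · have := hWψ x hx
    simp only [hW, hXχ x hx] at this
    linear_combination this

end

end RadialFlow
end

/-! ### Linearity of conservation laws and equivalence -/

noncomputable section
namespace RadialFlow
open Filter Topology Kin SmoothGerm

section
variable {n : ℕ} {J I : Set ℝ} {P : ℝ → ℝ → ℝ} {q q' : Pair}

lemma ContDiffOn.differentiableAt_kin (hJ : IsOpen J) (hI : IsOpen I) {f : Kin → ℝ}
    (hf : ContDiffOn ℝ ∞ f (kinDomain J I)) {x : Kin} (hx : x ∈ kinDomain J I) :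
    DifferentiableAt ℝ f x :=
  (hf.contDiffAt ((isOpen_kinDomain hJ hI).mem_nhds hx)).differentiableAt (by simp)

/-- The determining equations in terms of derivatives along coordinate lines. -/
lemma isConservationLaw_of_hasDerivAt (hn : 1 ≤ n) (hJ : IsOpen J) (hI : IsOpen I)
    (hJpos : J ⊆ Ioi 0) (h1 : ContDiffOn ℝ ∞ q.1 (kinDomain J I))
    (h2 : ContDiffOn ℝ ∞ q.2 (kinDomain J I))
    (h : ∀ t r U ρ S : ℝ, 0 < r → ρ ∈ J → S ∈ I → ∃ Φt Φr ΦU Φρ Ψr ΨU Ψρ ΨS : ℝ,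
      HasDerivAt (fun τ => q.1 (τ, r, U, ρ, S)) Φt t ∧
      HasDerivAt (fun τ => q.1 (t, τ, U, ρ, S)) Φr r ∧
      HasDerivAt (fun τ => q.1 (t, r, τ, ρ, S)) ΦU U ∧
      HasDerivAt (fun τ => q.1 (t, r, U, τ, S)) Φρ ρ ∧
      HasDerivAt (fun τ => q.2 (t, τ, U, ρ, S)) Ψr r ∧
      HasDerivAt (fun τ => q.2 (t, r, τ, ρ, S)) ΨU U ∧
      HasDerivAt (fun τ => q.2 (t, r, U, τ, S)) Ψρ ρ ∧
      HasDerivAt (fun τ => q.2 (t, r, U, ρ, τ)) ΨS S ∧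
      ΨU = ρ * Φρ - q.1 (t, r, U, ρ, S) ∧ ρ * Ψρ = pRho P ρ S * ΦU ∧
      ρ * ΨS = pS P ρ S * ΦU ∧
      r * (Φt + U * Φr + Ψr)
        + ((n : ℝ) - 1) * (q.2 (t, r, U, ρ, S) + U * (q.1 (t, r, U, ρ, S) - ρ * Φρ)) = 0) :
    IsConservationLaw n J I P q := by
  refine (isConservationLaw_iff hn hJ hI hJpos).2 ⟨h1, h2, ?_⟩
  rintro ⟨t, r, U, ρ, S⟩ hx
  obtain ⟨Φt, Φr, ΦU, Φρ, Ψr, ΨU, Ψρ, ΨS, a1, a2, a3, a4, b2, b3, b4, b5, c1, c2, c3, c4⟩ :=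
    h t r U ρ S hx.1 hx.2.1 hx.2.2
  have d1 := ContDiffOn.differentiableAt_kin hJ hI h1 hx
  have d2 := ContDiffOn.differentiableAt_kin hJ hI h2 hx
  have A1 := fderiv_eq_of_hasDerivAt d1 (hasDerivAt_line_t (t, r, U, ρ, S)) rfl a1
  have A2 := fderiv_eq_of_hasDerivAt d1 (hasDerivAt_line_r (t, r, U, ρ, S)) rfl a2
  have A3 := fderiv_eq_of_hasDerivAt d1 (hasDerivAt_line_U (t, r, U, ρ, S)) rfl a3
  have A4 := fderiv_eq_of_hasDerivAt d1 (hasDerivAt_line_ρ (t, r, U, ρ, S)) rfl a4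
  have B2 := fderiv_eq_of_hasDerivAt d2 (hasDerivAt_line_r (t, r, U, ρ, S)) rfl b2
  have B3 := fderiv_eq_of_hasDerivAt d2 (hasDerivAt_line_U (t, r, U, ρ, S)) rfl b3
  have B4 := fderiv_eq_of_hasDerivAt d2 (hasDerivAt_line_ρ (t, r, U, ρ, S)) rfl b4
  have B5 := fderiv_eq_of_hasDerivAt d2 (hasDerivAt_line_S (t, r, U, ρ, S)) rfl b5
  exact ⟨by rw [B3, A4]; exact c1, by rw [B4, A3]; exact c2, by rw [B5, A3]; exact c3,
    by rw [A1, A2, A4, B2]; exact c4⟩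

namespace IsConservationLaw

lemma add (hn : 1 ≤ n) (hJ : IsOpen J) (hI : IsOpen I) (hJpos : J ⊆ Ioi 0)
    (H : IsConservationLaw n J I P q) (H' : IsConservationLaw n J I P q') :
    IsConservationLaw n J I P (q + q') := by
  have h := (isConservationLaw_iff hn hJ hI hJpos).1 H
  have h' := (isConservationLaw_iff hn hJ hI hJpos).1 H'
  refine (isConservationLaw_iff hn hJ hI hJpos).2 ⟨h.1.add h'.1, h.2.1.add h'.2.1, fun x hx => ?_⟩
  have e1 : ∀ v, fderiv ℝ (q + q').1 x v = fderiv ℝ q.1 x v + fderiv ℝ q'.1 x v := fun v =>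
    congrArg (fun L => L v) (fderiv_add (ContDiffOn.differentiableAt_kin hJ hI h.1 hx)
      (ContDiffOn.differentiableAt_kin hJ hI h'.1 hx))
  have e2 : ∀ v, fderiv ℝ (q + q').2 x v = fderiv ℝ q.2 x v + fderiv ℝ q'.2 x v := fun v =>
    congrArg (fun L => L v) (fderiv_add (ContDiffOn.differentiableAt_kin hJ hI h.2.1 hx)
      (ContDiffOn.differentiableAt_kin hJ hI h'.2.1 hx))
  have D := h.2.2 x hx
  have D' := h'.2.2 x hx
  have f1 : (q + q').1 x = q.1 x + q'.1 x := rfl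
  have f2 : (q + q').2 x = q.2 x + q'.2 x := rfl
  constructor <;> simp only [e1, e2, f1, f2]
  · linear_combination D.flux_U + D'.flux_U
  · linear_combination D.flux_ρ + D'.flux_ρ
  · linear_combination D.flux_S + D'.flux_S
  · linear_combination D.balance + D'.balance

lemma smul (hn : 1 ≤ n) (hJ : IsOpen J) (hI : IsOpen I) (hJpos : J ⊆ Ioi 0) (c : ℝ)
    (H : IsConservationLaw n J I P q) : IsConservationLaw n J I P (c • q) := by
  have h := (isConservationLaw_iff hn hJ hI hJpos).1 H
  refine (isConservationLaw_iff hn hJ hI hJpos).2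
    ⟨h.1.const_smul c, h.2.1.const_smul c, fun x hx => ?_⟩
  have e1 : ∀ v, fderiv ℝ (c • q).1 x v = c * fderiv ℝ q.1 x v := fun v =>
    congrArg (fun L => L v) (fderiv_const_smul (ContDiffOn.differentiableAt_kin hJ hI h.1 hx) c)
  have e2 : ∀ v, fderiv ℝ (c • q).2 x v = c * fderiv ℝ q.2 x v := fun v =>
    congrArg (fun L => L v) (fderiv_const_smul (ContDiffOn.differentiableAt_kin hJ hI h.2.1 hx) c)
  have D := h.2.2 x hx
  have f1 : (c • q).1 x = c * q.1 x := rfl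
  have f2 : (c • q).2 x = c * q.2 x := rfl
  constructor <;> simp only [e1, e2, f1, f2]
  · linear_combination c * D.flux_U
  · linear_combination c * D.flux_ρ
  · linear_combination c * D.flux_S
  · linear_combination c * D.balance

lemma sub (hn : 1 ≤ n) (hJ : IsOpen J) (hI : IsOpen I) (hJpos : J ⊆ Ioi 0)
    (H : IsConservationLaw n J I P q) (H' : IsConservationLaw n J I P q') :
    IsConservationLaw n J I P (q - q') := by
  have e : q - q' = q + (-1 : ℝ) • q' := by rw [neg_one_smul, sub_eq_add_neg]
  rw [e]
  exact H.add hn hJ hI hJpos (H'.smul hn hJ hI hJpos _)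

lemma congr (hn : 1 ≤ n) (hJ : IsOpen J) (hI : IsOpen I) (hJpos : J ⊆ Ioi 0)
    (H : IsConservationLaw n J I P q) (h1 : ∀ x ∈ kinDomain J I, q'.1 x = q.1 x)
    (h2 : ∀ x ∈ kinDomain J I, q'.2 x = q.2 x) : IsConservationLaw n J I P q' := by
  have h := (isConservationLaw_iff hn hJ hI hJpos).1 H
  refine (isConservationLaw_iff hn hJ hI hJpos).2 ⟨h.1.congr h1, h.2.1.congr h2, fun x hx => ?_⟩
  have hO := (isOpen_kinDomain hJ hI).mem_nhds hx
  have e1 : fderiv ℝ q'.1 x = fderiv ℝ q.1 x :=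
    Filter.EventuallyEq.fderiv_eq (mem_of_superset hO h1)
  have e2 : fderiv ℝ q'.2 x = fderiv ℝ q.2 x :=
    Filter.EventuallyEq.fderiv_eq (mem_of_superset hO h2)
  have D := h.2.2 x hx
  exact ⟨by rw [e1, e2, h1 x hx]; exact D.flux_U, by rw [e1, e2]; exact D.flux_ρ,
    by rw [e1, e2]; exact D.flux_S, by rw [e1, e2, h1 x hx, h2 x hx]; exact D.balance⟩

end IsConservationLaw

lemma isConservationLaw_advected (hn : 1 ≤ n) (hJ : IsOpen J) (hI : IsOpen I) (hJpos : J ⊆ Ioi 0)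
    {f : ℝ → ℝ} (hf : ContDiffOn ℝ ∞ f I) : IsConservationLaw n J I P (advected f) := by
  refine isConservationLaw_of_hasDerivAt hn hJ hI hJpos
    (contDiff_ρ.contDiffOn.mul (hf.comp contDiff_S.contDiffOn fun x hx => hx.2.2))
    contDiffOn_const fun t r U ρ S hr hρ hS =>
    ⟨0, 0, 0, f S, 0, 0, 0, 0, hasDerivAt_const t (ρ * f S), hasDerivAt_const r (ρ * f S),
      hasDerivAt_const U (ρ * f S), ((hasDerivAt_id ρ).mul_const (f S)).congr_deriv (one_mul _),
      hasDerivAt_const r 0, hasDerivAt_const U 0, hasDerivAt_const ρ 0, hasDerivAt_const S 0,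
      by simp [advected], by simp, by simp, by simp [advected]⟩

/-- A locally trivial pair is a conservation law. -/
lemma IsLocallyTrivial.isConservationLaw (hn : 1 ≤ n) (hJ : IsOpen J) (hI : IsOpen I)
    (hJpos : J ⊆ Ioi 0) (h : IsLocallyTrivial n J I q) : IsConservationLaw n J I P q := by
  obtain ⟨Θ, hΘ, h⟩ := h
  set s : Set (ℝ × ℝ) := {y | 0 < y.2} with hs
  have hso : IsOpen s := isOpen_Ioi.preimage continuous_snd
  set θ : ℝ × ℝ → ℝ := fun y => Θ y.1 y.2 with hθ
  have hfd : ∀ v, ContDiffOn ℝ ∞ (fun y => fderiv ℝ θ y v) s := fun v y hy =>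
    ((hΘ.contDiffAt (hso.mem_nhds hy)).fderiv_apply_const v).contDiffWithinAt
  set G : ℝ × ℝ → ℝ := fun y => fderiv ℝ θ y (0, 1) + ((n : ℝ) - 1) / y.2 * θ y with hG
  set N : ℝ × ℝ → ℝ := fun y => -fderiv ℝ θ y (1, 0) with hN
  have sG : ContDiffOn ℝ ∞ G s := (hfd _).add ((contDiffOn_const.div contDiff_snd.contDiffOn
    fun y hy => ne_of_gt hy).mul hΘ)
  have sN : ContDiffOn ℝ ∞ N s := (hfd _).neg
  have dθ : ∀ y ∈ s, HasFDerivAt θ (fderiv ℝ θ y) y := fun y hy =>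
    ((hΘ.contDiffAt (hso.mem_nhds hy)).differentiableAt (by simp)).hasFDerivAt
  have lt : ∀ {f : ℝ × ℝ → ℝ} {t r : ℝ}, DifferentiableAt ℝ f (t, r) →
      HasDerivAt (fun τ => f (τ, r)) (fderiv ℝ f (t, r) (1, 0)) t := fun {f t r} hf =>
    hf.hasFDerivAt.comp_hasDerivAt t ((hasDerivAt_id t).prodMk (hasDerivAt_const t r))
  have lr : ∀ {f : ℝ × ℝ → ℝ} {t r : ℝ}, DifferentiableAt ℝ f (t, r) →
      HasDerivAt (fun τ => f (t, τ)) (fderiv ℝ f (t, r) (0, 1)) r := fun {f t r} hf =>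
    hf.hasFDerivAt.comp_hasDerivAt r ((hasDerivAt_const r t).prodMk (hasDerivAt_id r))
  have e1 : ∀ x ∈ kinDomain J I, q.1 x = G (x.t, x.r) := fun x hx => by
    have e := (lr (dθ (x.t, x.r) hx.1).differentiableAt).deriv
    rw [(h x hx).1, hG]
    exact congrArg (· + ((n : ℝ) - 1) / x.r * Θ x.t x.r) e
  have e2 : ∀ x ∈ kinDomain J I, q.2 x = N (x.t, x.r) - x.U * G (x.t, x.r) := fun x hx => by
    have e := (lt (dθ (x.t, x.r) hx.1).differentiableAt).deriv
    have := (h x hx).2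
    rw [e1 x hx] at this
    have e3 : N (x.t, x.r) = -deriv (fun τ => Θ τ x.r) x.t := congrArg Neg.neg e.symm
    linear_combination this - e3
  refine IsConservationLaw.congr (q := (fun x => G (x.t, x.r),
    fun x => N (x.t, x.r) - x.U * G (x.t, x.r))) hn hJ hI hJpos ?_ e1 e2
  have cG : ContDiffOn ℝ ∞ (fun x : Kin => G (x.t, x.r)) (kinDomain J I) :=
    sG.comp (contDiff_t.prodMk contDiff_r).contDiffOn fun x hx => hx.1
  have cN : ContDiffOn ℝ ∞ (fun x : Kin => N (x.t, x.r)) (kinDomain J I) :=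
    sN.comp (contDiff_t.prodMk contDiff_r).contDiffOn fun x hx => hx.1
  refine isConservationLaw_of_hasDerivAt hn hJ hI hJpos cG
    (cN.sub (contDiff_U.contDiffOn.mul cG)) fun t r U ρ S hr hρ hS => ?_
  have hy : (t, r) ∈ s := hr
  have dG := (sG.contDiffAt (hso.mem_nhds hy)).differentiableAt (by simp)
  have dN := (sN.contDiffAt (hso.mem_nhds hy)).differentiableAt (by simp)
  refine ⟨fderiv ℝ G (t, r) (1, 0), fderiv ℝ G (t, r) (0, 1), 0, 0,
    fderiv ℝ N (t, r) (0, 1) - U * fderiv ℝ G (t, r) (0, 1), -G (t, r), 0, 0,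
    lt dG, lr dG, hasDerivAt_const U (G (t, r)), hasDerivAt_const ρ (G (t, r)),
    (lr dN).sub ((lr dG).const_mul U), ?_, hasDerivAt_const ρ (N (t, r) - U * G (t, r)),
    hasDerivAt_const S (N (t, r) - U * G (t, r)), by simp, by simp, by simp, ?_⟩
  · simpa using ((hasDerivAt_id U).mul_const (G (t, r))).const_sub (N (t, r))
  -- For a trivial pair the balance is the symmetry of the second derivatives of Θ.
  · have hsym : IsSymmSndFDerivAt ℝ θ (t, r) :=
      (hΘ.contDiffAt (hso.mem_nhds hy)).isSymmSndFDerivAt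
        (by rw [minSmoothness_of_isRCLikeNormedField]; exact ENat.LEInfty.out)
    have d2 : DifferentiableAt ℝ (fderiv ℝ θ) (t, r) :=
      ((hΘ.contDiffAt (hso.mem_nhds hy)).fderiv_right (m := ∞) (by simp)).differentiableAt (by simp)
    have sec : ∀ u v, fderiv ℝ (fun y => fderiv ℝ θ y u) (t, r) v
        = fderiv ℝ (fderiv ℝ θ) (t, r) v u := fun u v => by
      have := (d2.hasFDerivAt.clm_apply (hasFDerivAt_const u (t, r))).fderiv
      rw [this]; simp
    have g1 : fderiv ℝ N (t, r) (0, 1) = -fderiv ℝ (fderiv ℝ θ) (t, r) (0, 1) (1, 0) := by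
      rw [← sec]
      exact (lr dN).unique
        ((lr (((hfd (1, 0)).contDiffAt (hso.mem_nhds hy)).differentiableAt (by simp))).neg)
    have g2 : fderiv ℝ G (t, r) (1, 0) = fderiv ℝ (fderiv ℝ θ) (t, r) (1, 0) (0, 1)
        + ((n : ℝ) - 1) / r * fderiv ℝ θ (t, r) (1, 0) := by
      rw [← sec]
      exact (lt dG).unique
        ((lt (((hfd (0, 1)).contDiffAt (hso.mem_nhds hy)).differentiableAt (by simp))).add
          ((lt (dθ _ hy).differentiableAt).const_mul (((n : ℝ) - 1) / r)))
    have hr0 : r ≠ 0 := ne_of_gt hr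
    rw [g1, g2, hsym.eq (1, 0) (0, 1)]
    simp only [hN]
    field_simp
    ring

/-- The change of the density with the velocity determines a conservation law up to
equivalence. -/
lemma IsConservationLaw.equivalent_iff (hn : 1 ≤ n) (hJ : IsOpen J) (hI : IsOpen I)
    (hJc : IsPreconnected J) (hIc : IsPreconnected I) (hJne : J.Nonempty) (hIne : I.Nonempty)
    (hJpos : J ⊆ Ioi 0) (hP : ContDiffOn ℝ ∞ (fun y : ℝ × ℝ => P y.1 y.2) (J ×ˢ I))
    (H : IsConservationLaw n J I P q) (H' : IsConservationLaw n J I P q') :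
    Equivalent n J I q q' ↔ ∀ x ∈ kinDomain J I, pd eU q.1 x = pd eU q'.1 x := by
  constructor
  · rintro ⟨f, hf, Θ, hΘ, h⟩ x hx
    have key : ∀ τ, q.1 (x.t, x.r, τ, x.ρ, x.S) = q'.1 (x.t, x.r, τ, x.ρ, x.S)
        + (x.ρ * f x.S + (deriv (Θ x.t) x.r + ((n : ℝ) - 1) / x.r * Θ x.t x.r)) := fun τ => by
      have e := (h (x.t, x.r, τ, x.ρ, x.S) ⟨hx.1, hx.2.1, hx.2.2⟩).1
      change q.1 (x.t, x.r, τ, x.ρ, x.S) - q'.1 (x.t, x.r, τ, x.ρ, x.S) - x.ρ * f x.S = _ at e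
      linear_combination e
    have d := ContDiffOn.differentiableAt_kin hJ hI H.smooth_density hx
    have d' := ContDiffOn.differentiableAt_kin hJ hI H'.smooth_density hx
    have l' : HasDerivAt (fun τ => q'.1 (x.t, x.r, τ, x.ρ, x.S)) (fderiv ℝ q'.1 x eU) x.U :=
      HasFDerivAt.comp_hasDerivAt (f := fun τ => ((x.1, x.2.1, τ, x.2.2.2) : Kin)) x.U
        (d'.hasFDerivAt : HasFDerivAt q'.1 _ _) (hasDerivAt_line_U x)
    refine fderiv_eq_of_hasDerivAt d (hasDerivAt_line_U x) rfl ?_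
    exact (l'.add_const _).congr_of_eventuallyEq (Eventually.of_forall key)
  · intro h
    -- The difference has a density independent of U, hence is an advected pair plus a law in t and
    -- r, and the latter is trivial.
    obtain ⟨f, χ, ψ, hf, hχ, hψ, hb, h1, h2⟩ := (H.sub hn hJ hI hJpos H').exists_of_pd_U_eq_zero
      hn hJ hI hJc hIc hJne hIne hJpos hP fun x hx => by
        have d := ContDiffOn.differentiableAt_kin hJ hI H.smooth_density hx
        have d' := ContDiffOn.differentiableAt_kin hJ hI H'.smooth_density hx
        have e := congrArg (fun L => L eU) (fderiv_sub d d')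
        exact e.trans (sub_eq_zero.2 (h x hx))
    refine ⟨f, hf, isLocallyTrivial_of_balance hn hχ hψ hb (fun x hx => ?_) fun x hx => ?_⟩
    · have := h1 x hx
      change (q - q').1 x - x.ρ * f x.S = _
      linear_combination this
    · have a := h1 x hx
      have b := h2 x hx
      change (q - q').2 x - 0 + x.U * ((q - q').1 x - x.ρ * f x.S) = _
      linear_combination b + x.U * a

/-- A pair which is equivalent to a conservation law is a conservation law. -/
lemma Equivalent.isConservationLaw (hn : 1 ≤ n) (hJ : IsOpen J) (hI : IsOpen I)
    (hJpos : J ⊆ Ioi 0) (h : Equivalent n J I q q') (H : IsConservationLaw n J I P q') :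
    IsConservationLaw n J I P q := by
  obtain ⟨f, hf, h⟩ := h
  have := ((h.isConservationLaw (P := P) hn hJ hI hJpos).add hn hJ hI hJpos
    (isConservationLaw_advected hn hJ hI hJpos hf)).add hn hJ hI hJpos H
  rwa [sub_add_cancel, sub_add_cancel] at this

end

end RadialFlow
end

/-! ### Verification of the explicit conservation laws -/

noncomputable section
namespace RadialFlow
open Filter Topology Kin

section
variable {n : ℕ} {J I : Set ℝ} {P p e : ℝ → ℝ → ℝ}

lemma hasDerivAt_pRho (hJ : IsOpen J) (hI : IsOpen I)
    (hP : ContDiffOn ℝ ∞ (fun y : ℝ × ℝ => P y.1 y.2) (J ×ˢ I)) {ρ S : ℝ} (hρ : ρ ∈ J)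
    (hS : S ∈ I) : HasDerivAt (fun y => P y S) (pRho P ρ S) ρ := by
  have d := (hP.contDiffAt ((hJ.prod hI).mem_nhds (x := (ρ, S)) ⟨hρ, hS⟩)).differentiableAt
    (by simp)
  exact (d.hasFDerivAt.comp_hasDerivAt ρ
    ((hasDerivAt_id ρ).prodMk (hasDerivAt_const ρ S))).differentiableAt.hasDerivAt

lemma hasDerivAt_pS (hJ : IsOpen J) (hI : IsOpen I)
    (hP : ContDiffOn ℝ ∞ (fun y : ℝ × ℝ => P y.1 y.2) (J ×ˢ I)) {ρ S : ℝ} (hρ : ρ ∈ J)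
    (hS : S ∈ I) : HasDerivAt (fun y => P ρ y) (pS P ρ S) S := by
  have d := (hP.contDiffAt ((hJ.prod hI).mem_nhds (x := (ρ, S)) ⟨hρ, hS⟩)).differentiableAt
    (by simp)
  exact (d.hasFDerivAt.comp_hasDerivAt S
    ((hasDerivAt_const S ρ).prodMk (hasDerivAt_id S))).differentiableAt.hasDerivAt

/-- A pressure and an internal energy which yield the same Euler equations as `P`. -/
structure IsGas (J I : Set ℝ) (P p e : ℝ → ℝ → ℝ) : Prop where
  smooth_p : ContDiffOn ℝ ∞ (fun y : ℝ × ℝ => p y.1 y.2) (J ×ˢ I)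
  smooth_e : ContDiffOn ℝ ∞ (fun y : ℝ × ℝ => e y.1 y.2) (J ×ˢ I)
  hasDerivAt_e : ∀ ρ ∈ J, ∀ S ∈ I, HasDerivAt (fun y => e y S) (p ρ S / ρ ^ 2) ρ
  hasDerivAt_p_ρ : ∀ ρ ∈ J, ∀ S ∈ I, HasDerivAt (fun y => p y S) (pRho P ρ S) ρ
  hasDerivAt_p_S : ∀ ρ ∈ J, ∀ S ∈ I, HasDerivAt (fun y => p ρ y) (pS P ρ S) S

lemma IsInternalEnergy.isGas (hJ : IsOpen J) (hI : IsOpen I)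
    (hP : ContDiffOn ℝ ∞ (fun y : ℝ × ℝ => P y.1 y.2) (J ×ˢ I)) (he : IsInternalEnergy J I P e) :
    IsGas J I P P e :=
  ⟨hP, he.smooth, he.hasDerivAt, fun _ hρ _ hS => hasDerivAt_pRho hJ hI hP hρ hS,
    fun _ hρ _ hS => hasDerivAt_pS hJ hI hP hρ hS⟩

/-- Only the derivatives of the pressure enter the Euler equations, so p₀ can be dropped. The
exponent 1 + 2/n is the one for which ρ e = (n/2) p, the relation behind the time-dependent laws. -/
lemma IsIdealPolytropic.isGas (hJ : IsOpen J) (hI : IsOpen I) (hJpos : J ⊆ Ioi 0) (hn : n ≠ 0)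
    (hP : ContDiffOn ℝ ∞ (fun y : ℝ × ℝ => P y.1 y.2) (J ×ˢ I)) {p₀ : ℝ} {κ : ℝ → ℝ}
    (h : IsIdealPolytropic n J I P p₀ κ) :
    IsGas J I P (idealPressure n κ) (idealEnergy n κ) ∧ ∀ ρ ∈ J, ∀ S,
      ρ * idealEnergy n κ ρ S = n / 2 * idealPressure n κ ρ S := by
  have hn' : (n : ℝ) ≠ 0 := Nat.cast_ne_zero.2 hn
  have eq : ∀ ρ ∈ J, ∀ S ∈ I, idealPressure n κ ρ S = P ρ S - p₀ := fun ρ hρ S hS => by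
    rw [h ρ hρ S hS]; ring
  have pw : ∀ ρ ∈ J, ρ ^ (1 + 2 / (n : ℝ)) = ρ * ρ ^ (2 / (n : ℝ)) := fun ρ hρ => by
    rw [Real.rpow_add (hJpos hρ), Real.rpow_one]
  have hen : ∀ ρ ∈ J, ∀ S, ρ * idealEnergy n κ ρ S = n / 2 * idealPressure n κ ρ S :=
    fun ρ hρ S => by rw [idealEnergy, idealPressure, pw ρ hρ]; ring
  have sp : ContDiffOn ℝ ∞ (fun y : ℝ × ℝ => idealPressure n κ y.1 y.2) (J ×ˢ I) :=
    (hP.sub contDiffOn_const).congr fun y hy => eq y.1 hy.1 y.2 hy.2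
  refine ⟨⟨sp, ?_, fun ρ hρ S hS => ?_, fun ρ hρ S hS => ?_, fun ρ hρ S hS => ?_⟩, hen⟩
  · refine ((contDiffOn_const (c := (n : ℝ) / 2)).mul (sp.div contDiff_fst.contDiffOn
      fun y hy => ne_of_gt (hJpos hy.1))).congr fun y hy => ?_
    have h0 : y.1 ≠ 0 := ne_of_gt (hJpos hy.1)
    have := hen y.1 hy.1 y.2
    change idealEnergy n κ y.1 y.2 = n / 2 * (idealPressure n κ y.1 y.2 / y.1)
    field_simp at this ⊢
    linear_combination this
  · have h0 : ρ ≠ 0 := ne_of_gt (hJpos hρ)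
    have d := (Real.hasDerivAt_rpow_const (p := 2 / (n : ℝ)) (Or.inl h0)).const_mul
      ((n : ℝ) / 2 * κ S)
    refine d.congr_deriv ?_
    rw [idealPressure, pw ρ hρ, Real.rpow_sub_one h0]
    field_simp
  · refine ((hasDerivAt_pRho hJ hI hP hρ hS).sub_const p₀).congr_of_eventuallyEq ?_
    filter_upwards [hJ.mem_nhds hρ] with y hy using eq y hy S hS
  · refine ((hasDerivAt_pS hJ hI hP hρ hS).sub_const p₀).congr_of_eventuallyEq ?_
    filter_upwards [hI.mem_nhds hS] with y hy using eq ρ hρ y hy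

/-- The velocity derivative of a density determines its equivalence class; it is recorded here and
below for each listed pair. -/
lemma hasDerivAt_energy (t r U ρ S : ℝ) :
    HasDerivAt (fun τ => (energy p e).1 (t, r, τ, ρ, S)) (ρ * U) U :=
  ((((hasDerivAt_pow 2 U).div_const 2).add_const (e ρ S)).const_mul ρ).congr_deriv
    (by norm_num)

lemma hasDerivAt_dilationalEnergy (t r U ρ S : ℝ) :
    HasDerivAt (fun τ => (dilationalEnergy p e).1 (t, r, τ, ρ, S)) (ρ * (t * U - r / 2)) U :=
  (((hasDerivAt_energy (p := p) (e := e) t r U ρ S).const_mul t).sub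
    (((hasDerivAt_id U).const_mul (r * ρ)).div_const 2)).congr_deriv (by ring)

lemma hasDerivAt_similarityEnergy (t r U ρ S : ℝ) :
    HasDerivAt (fun τ => (similarityEnergy p e).1 (t, r, τ, ρ, S))
      (ρ * (t ^ 2 * U - t * r)) U :=
  ((((hasDerivAt_energy (p := p) (e := e) t r U ρ S).const_mul (t ^ 2)).sub
    ((hasDerivAt_id U).const_mul (t * r * ρ))).add_const (r ^ 2 * ρ / 2)).congr_deriv (by ring)
      |>.congr_of_eventuallyEq (Eventually.of_forall fun τ => by
        simp only [similarityEnergy, energy, Pi.sub_apply, id])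

lemma hasDerivAt_enthalpyFlux {p e : ℝ → ℝ} (t r U ρ S : ℝ) :
    HasDerivAt (fun τ => (enthalpyFlux n p e).1 (t, r, τ, ρ, S)) (1 / r ^ (n - 1)) U :=
  (hasDerivAt_id U).div_const (r ^ (n - 1))

lemma hasDerivAt_weightedEnergy {F K : ℝ → ℝ} (t r U ρ S : ℝ) :
    HasDerivAt (fun τ => (weightedEnergy F K).1 (t, r, τ, ρ, S)) (ρ * U * F S) U :=
  ((((((hasDerivAt_pow 2 U).const_mul ρ).mul_const (F S)).div_const 2).sub_const (K S))).congr_deriv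
    (by norm_num; ring)

lemma IsConservationLaw.pd_U (hJ : IsOpen J) (hI : IsOpen I) {q : Pair} 
    (H : IsConservationLaw n J I P q) {x : Kin} {d : ℝ}
    (hx : x ∈ kinDomain J I) (h : HasDerivAt (fun τ => q.1 (x.t, x.r, τ, x.ρ, x.S)) d x.U) :
    pd eU q.1 x = d :=
  fderiv_eq_of_hasDerivAt (ContDiffOn.differentiableAt_kin hJ hI H.smooth_density hx)
    (hasDerivAt_line_U x) rfl h

section
variable (hn : 1 ≤ n) (hJ : IsOpen J) (hI : IsOpen I) (hJpos : J ⊆ Ioi 0)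
include hn hJ hI hJpos

lemma IsGas.isConservationLaw_energy (h : IsGas J I P p e) :
    IsConservationLaw n J I P (energy p e) := by
  have sp := contDiffOn_thermo h.smooth_p
  have se := contDiffOn_thermo h.smooth_e
  refine isConservationLaw_of_hasDerivAt hn hJ hI hJpos
    (contDiff_ρ.contDiffOn.mul (((contDiff_U.pow 2).div_const 2).contDiffOn.add se))
    (sp.mul contDiff_U.contDiffOn) fun t r U ρ S hr hρ hS =>
    ⟨0, 0, ρ * U, U ^ 2 / 2 + e ρ S + p ρ S / ρ, 0, p ρ S, pRho P ρ S * U, pS P ρ S * U,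
      hasDerivAt_const t (ρ * (U ^ 2 / 2 + e ρ S)), hasDerivAt_const r (ρ * (U ^ 2 / 2 + e ρ S)),
      hasDerivAt_energy t r U ρ S, ?_, hasDerivAt_const r (p ρ S * U),
      ((hasDerivAt_id U).const_mul (p ρ S)).congr_deriv (mul_one _),
      (h.hasDerivAt_p_ρ ρ hρ S hS).mul_const U, (h.hasDerivAt_p_S ρ hρ S hS).mul_const U,
      ?_, by ring, by ring, ?_⟩
  all_goals have h0 : ρ ≠ 0 := ne_of_gt (hJpos hρ)
  · refine ((hasDerivAt_id ρ).mul ((h.hasDerivAt_e ρ hρ S hS).const_add (U ^ 2 / 2))).congr_deriv ?_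
    simp only [id]; field_simp
  · simp only [energy]; field_simp; ring
  · simp only [energy]; field_simp; ring

/-- The balance leaves the defect ρ e - (n/2) p, which `hpe` annihilates; the similarity energy has
the same defect times 2 t. -/
lemma IsGas.isConservationLaw_dilationalEnergy (h : IsGas J I P p e)
    (hpe : ∀ ρ ∈ J, ∀ S, ρ * e ρ S = n / 2 * p ρ S) :
    IsConservationLaw n J I P (dilationalEnergy p e) := by
  have sp := contDiffOn_thermo h.smooth_p
  have se := contDiffOn_thermo h.smooth_e
  refine isConservationLaw_of_hasDerivAt hn hJ hI hJpos
    ((contDiff_t.contDiffOn.mul (contDiff_ρ.contDiffOn.mul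
      (((contDiff_U.pow 2).div_const 2).contDiffOn.add se))).sub
      (((contDiff_r.mul contDiff_ρ).mul contDiff_U).div_const 2).contDiffOn)
    (((contDiff_t.mul contDiff_U).sub (contDiff_r.div_const 2)).contDiffOn.mul sp)
    fun t r U ρ S hr hρ hS =>
    ⟨ρ * (U ^ 2 / 2 + e ρ S), -(ρ * U / 2), ρ * (t * U - r / 2),
      t * (U ^ 2 / 2 + e ρ S + p ρ S / ρ) - r * U / 2, -(p ρ S / 2), t * p ρ S,
      (t * U - r / 2) * pRho P ρ S, (t * U - r / 2) * pS P ρ S,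
      ?_, ?_, hasDerivAt_dilationalEnergy t r U ρ S, ?_, ?_, ?_,
      (h.hasDerivAt_p_ρ ρ hρ S hS).const_mul (t * U - r / 2),
      (h.hasDerivAt_p_S ρ hρ S hS).const_mul (t * U - r / 2),
      ?_, by ring, by ring, ?_⟩
  all_goals have h0 : ρ ≠ 0 := ne_of_gt (hJpos hρ)
  · exact (((hasDerivAt_id t).mul_const (ρ * (U ^ 2 / 2 + e ρ S))).sub_const (r * ρ * U / 2)).congr_deriv (by ring)
  · exact (((((hasDerivAt_id r).mul_const ρ).mul_const U).div_const 2).const_sub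
      (t * (ρ * (U ^ 2 / 2 + e ρ S)))).congr_deriv (by ring)
  · refine ((((hasDerivAt_id ρ).mul
      ((h.hasDerivAt_e ρ hρ S hS).const_add (U ^ 2 / 2))).const_mul t).sub
      ((((hasDerivAt_id ρ).const_mul r).mul_const U).div_const 2)).congr_deriv ?_
    simp only [id]; field_simp
  · exact ((((hasDerivAt_id r).div_const 2).const_sub (t * U)).mul_const (p ρ S)).congr_deriv (by ring)
  · exact ((((hasDerivAt_id U).const_mul t).sub_const (r / 2)).mul_const (p ρ S)).congr_deriv (by ring)
  · simp only [dilationalEnergy]; field_simp; ring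
  · have := hpe ρ hρ S
    simp only [dilationalEnergy]; field_simp at this ⊢; linear_combination r * this

lemma IsGas.isConservationLaw_similarityEnergy (h : IsGas J I P p e)
    (hpe : ∀ ρ ∈ J, ∀ S, ρ * e ρ S = n / 2 * p ρ S) :
    IsConservationLaw n J I P (similarityEnergy p e) := by
  have sp := contDiffOn_thermo h.smooth_p
  have se := contDiffOn_thermo h.smooth_e
  refine isConservationLaw_of_hasDerivAt hn hJ hI hJpos
    ((((contDiff_t.pow 2).contDiffOn.mul (contDiff_ρ.contDiffOn.mul
      (((contDiff_U.pow 2).div_const 2).contDiffOn.add se))).sub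
      (((contDiff_t.mul contDiff_r).mul contDiff_ρ).mul contDiff_U).contDiffOn).add
      (((contDiff_r.pow 2).mul contDiff_ρ).div_const 2).contDiffOn)
    ((contDiff_t.mul ((contDiff_t.mul contDiff_U).sub contDiff_r)).contDiffOn.mul sp)
    fun t r U ρ S hr hρ hS =>
    ⟨2 * t * (ρ * (U ^ 2 / 2 + e ρ S)) - r * ρ * U, -(t * ρ * U) + r * ρ,
      ρ * (t ^ 2 * U - t * r),
      t ^ 2 * (U ^ 2 / 2 + e ρ S + p ρ S / ρ) - t * r * U + r ^ 2 / 2, -(t * p ρ S), t ^ 2 * p ρ S,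
      t * (t * U - r) * pRho P ρ S, t * (t * U - r) * pS P ρ S,
      ?_, ?_, hasDerivAt_similarityEnergy t r U ρ S, ?_, ?_, ?_,
      (h.hasDerivAt_p_ρ ρ hρ S hS).const_mul (t * (t * U - r)),
      (h.hasDerivAt_p_S ρ hρ S hS).const_mul (t * (t * U - r)),
      ?_, by ring, by ring, ?_⟩
  all_goals have h0 : ρ ≠ 0 := ne_of_gt (hJpos hρ)
  · exact ((((hasDerivAt_pow 2 t).mul_const (ρ * (U ^ 2 / 2 + e ρ S))).sub
      ((((hasDerivAt_id t).mul_const r).mul_const ρ).mul_const U)).add_const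
      (r ^ 2 * ρ / 2)).congr_deriv (by norm_num)
  · exact ((((((hasDerivAt_id r).const_mul t).mul_const ρ).mul_const U).const_sub
      (t ^ 2 * (ρ * (U ^ 2 / 2 + e ρ S)))).add
      (((hasDerivAt_pow 2 r).mul_const ρ).div_const 2)).congr_deriv (by norm_num; ring)
  · refine (((((hasDerivAt_id ρ).mul
      ((h.hasDerivAt_e ρ hρ S hS).const_add (U ^ 2 / 2))).const_mul (t ^ 2)).sub
      (((hasDerivAt_id ρ).const_mul (t * r)).mul_const U)).add
      (((hasDerivAt_id ρ).const_mul (r ^ 2)).div_const 2)).congr_deriv ?_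
    simp only [id]; field_simp
  · exact ((((hasDerivAt_id r).const_sub (t * U)).const_mul t).mul_const (p ρ S)).congr_deriv
      (by ring)
  · exact (((((hasDerivAt_id U).const_mul t).sub_const r).const_mul t).mul_const
      (p ρ S)).congr_deriv (by ring)
  · simp only [similarityEnergy]; field_simp; ring
  · have := hpe ρ hρ S
    simp only [similarityEnergy]; field_simp at this ⊢; linear_combination 2 * r * t * this

/-- The weight r^(1-n) cancels the geometric source term, and for p = p(ρ) the pressure force is the
gradient of e₁ + p/ρ. -/
lemma IsBarotropic.isConservationLaw_enthalpyFlux (hIne : I.Nonempty)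
    (hP : ContDiffOn ℝ ∞ (fun y : ℝ × ℝ => P y.1 y.2) (J ×ˢ I)) {p e : ℝ → ℝ}
    (h : IsBarotropic J I P p) (he : ∀ ρ ∈ J, HasDerivAt e (p ρ / ρ ^ 2) ρ) :
    IsConservationLaw n J I P (enthalpyFlux n p e) := by
  obtain ⟨S₁, hS₁⟩ := hIne
  have sp : ContDiffOn ℝ ∞ p J :=
    (hP.comp (f := fun ρ : ℝ => (ρ, S₁)) (by fun_prop) fun ρ hρ => ⟨hρ, hS₁⟩).congr
      fun ρ hρ => (h ρ hρ S₁ hS₁).symm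
  -- Smoothness of `e` is not assumed but inherited from its derivative p/ρ².
  have se : ContDiffOn ℝ ∞ e J := by
    rw [contDiffOn_infty_iff_deriv_of_isOpen hJ]
    exact ⟨fun ρ hρ => (he ρ hρ).differentiableAt.differentiableWithinAt,
      (sp.div (contDiff_id.pow 2).contDiffOn fun ρ hρ =>
        pow_ne_zero 2 (ne_of_gt (hJpos hρ))).congr fun ρ hρ => (he ρ hρ).deriv⟩
  have hr0 : ∀ x ∈ kinDomain J I, x.r ^ (n - 1) ≠ 0 := fun x hx => pow_ne_zero _ (ne_of_gt hx.1)
  have cp : ContDiffOn ℝ ∞ (fun x : Kin => p x.ρ) (kinDomain J I) :=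
    sp.comp contDiff_ρ.contDiffOn fun x hx => hx.2.1
  have ce : ContDiffOn ℝ ∞ (fun x : Kin => e x.ρ) (kinDomain J I) :=
    se.comp contDiff_ρ.contDiffOn fun x hx => hx.2.1
  refine isConservationLaw_of_hasDerivAt hn hJ hI hJpos
    (contDiff_U.contDiffOn.div (contDiff_r.pow _).contDiffOn hr0)
    (((ce.add (cp.div contDiff_ρ.contDiffOn fun x hx => ne_of_gt (hJpos hx.2.1))).sub
      ((contDiff_U.pow 2).div_const 2).contDiffOn).div (contDiff_r.pow _).contDiffOn hr0)
    fun t r U ρ S hr hρ hS => ?_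
  have h0 : ρ ≠ 0 := ne_of_gt (hJpos hρ)
  have hr1 : r ≠ 0 := ne_of_gt hr
  have dp : HasDerivAt p (pRho P ρ S) ρ :=
    (hasDerivAt_pRho hJ hI hP hρ hS).congr_of_eventuallyEq
      (mem_of_superset (hJ.mem_nhds hρ) fun y hy => (h y hy S hS).symm)
  have hS0 : pS P ρ S = 0 := by
    have : HasDerivAt (fun y => P ρ y) 0 S := (hasDerivAt_const S (p ρ)).congr_of_eventuallyEq
      (mem_of_superset (hI.mem_nhds hS) fun y hy => h ρ hρ y hy)
    exact this.deriv
  have dr : HasDerivAt (fun y : ℝ => y ^ (n - 1)) (((n : ℝ) - 1) * r ^ (n - 1) / r) r := by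
    refine (hasDerivAt_pow (n - 1) r).congr_deriv ?_
    rw [Nat.cast_sub hn, Nat.cast_one]
    rcases Nat.lt_or_ge 1 n with h1 | h1
    · obtain ⟨k, rfl⟩ : ∃ k, n = k + 2 := ⟨n - 2, by omega⟩
      have : k + 2 - 1 - 1 = k := by omega
      have h3 : k + 2 - 1 = k + 1 := by omega
      rw [this, h3]; field_simp; ring
    · have : n = 1 := by omega
      subst this; simp
  refine ⟨0, -(U * ((n : ℝ) - 1) / (r * r ^ (n - 1))), 1 / r ^ (n - 1), 0,
    -((e ρ + p ρ / ρ - U ^ 2 / 2) * ((n : ℝ) - 1) / (r * r ^ (n - 1))), -U / r ^ (n - 1),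
    pRho P ρ S / ρ / r ^ (n - 1), 0, hasDerivAt_const t (U / r ^ (n - 1)),
    ((hasDerivAt_const r U).div dr (pow_ne_zero _ hr1)).congr_deriv ?_,
    hasDerivAt_enthalpyFlux t r U ρ S, hasDerivAt_const ρ (U / r ^ (n - 1)),
    ((hasDerivAt_const r (e ρ + p ρ / ρ - U ^ 2 / 2)).div dr (pow_ne_zero _ hr1)).congr_deriv ?_,
    ((((hasDerivAt_pow 2 U).div_const 2).const_sub (e ρ + p ρ / ρ)).div_const
      (r ^ (n - 1))).congr_deriv ?_,
    ((((he ρ hρ).add (dp.div (hasDerivAt_id ρ) h0)).sub_const (U ^ 2 / 2)).div_const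
      (r ^ (n - 1))).congr_deriv ?_,
    hasDerivAt_const S ((e ρ + p ρ / ρ - U ^ 2 / 2) / r ^ (n - 1)), ?_, ?_, ?_, ?_⟩
  · field_simp; ring
  · field_simp; ring
  · norm_num
  · simp only [id]; field_simp; ring
  · simp only [enthalpyFlux]; ring
  · field_simp
  · rw [hS0]; ring
  · simp only [enthalpyFlux]; field_simp; ring

lemma IsEntropic.isConservationLaw_weightedEnergy (hJne : J.Nonempty)
    (hP : ContDiffOn ℝ ∞ (fun y : ℝ × ℝ => P y.1 y.2) (J ×ˢ I)) {κ F K : ℝ → ℝ}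
    (h : IsEntropic J I P κ) (hF : IsWeight I κ F K) :
    IsConservationLaw n J I P (weightedEnergy F K) := by
  obtain ⟨ρ₁, hρ₁⟩ := hJne
  have sκ : ContDiffOn ℝ ∞ κ I :=
    (hP.comp (f := fun S : ℝ => (ρ₁, S)) (by fun_prop) fun S hS => ⟨hρ₁, hS⟩).congr
      fun S hS => (h ρ₁ hρ₁ S hS).symm
  have sK : ContDiffOn ℝ ∞ K I := by
    rw [contDiffOn_infty_iff_deriv_of_isOpen hI]
    exact ⟨fun S hS => (hF.hasDerivAt S hS).differentiableAt.differentiableWithinAt,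
      (hF.smooth.mul ((contDiffOn_infty_iff_deriv_of_isOpen hI).1 sκ).2).congr
        fun S hS => (hF.hasDerivAt S hS).deriv⟩
  have cK : ContDiffOn ℝ ∞ (fun x : Kin => K x.S) (kinDomain J I) :=
    sK.comp contDiff_S.contDiffOn fun x hx => hx.2.2
  have cF : ContDiffOn ℝ ∞ (fun x : Kin => F x.S) (kinDomain J I) :=
    hF.smooth.comp contDiff_S.contDiffOn fun x hx => hx.2.2
  refine isConservationLaw_of_hasDerivAt hn hJ hI hJpos
    ((((contDiff_ρ.mul (contDiff_U.pow 2)).contDiffOn.mul cF).div_const 2).sub cK)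
    (contDiff_U.contDiffOn.mul cK) fun t r U ρ S hr hρ hS => ?_
  have hρ0 : pRho P ρ S = 0 := by
    have : HasDerivAt (fun y => P y S) 0 ρ := (hasDerivAt_const ρ (κ S)).congr_of_eventuallyEq
      (mem_of_superset (hJ.mem_nhds hρ) fun y hy => h y hy S hS)
    exact this.deriv
  have hS0 : pS P ρ S = deriv κ S :=
    Filter.EventuallyEq.deriv_eq (mem_of_superset (hI.mem_nhds hS) fun y hy => h ρ hρ y hy)
  refine ⟨0, 0, ρ * U * F S, U ^ 2 * F S / 2, 0, K S, 0, U * (F S * deriv κ S),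
    hasDerivAt_const t (ρ * U ^ 2 * F S / 2 - K S), hasDerivAt_const r (ρ * U ^ 2 * F S / 2 - K S),
    hasDerivAt_weightedEnergy t r U ρ S,
    (((((hasDerivAt_id ρ).mul_const (U ^ 2)).mul_const (F S)).div_const 2).sub_const
      (K S)).congr_deriv (by ring),
    hasDerivAt_const r (U * K S), ((hasDerivAt_id U).mul_const (K S)).congr_deriv (one_mul _),
    hasDerivAt_const ρ (U * K S), (hF.hasDerivAt S hS).const_mul U, ?_, ?_, ?_, ?_⟩
  · simp only [weightedEnergy]; ring
  · rw [hρ0]; ring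
  · rw [hS0]; ring
  · simp only [weightedEnergy]; ring

end
end

end RadialFlow
end

/-! ### Equations of state recovered from the normal form; the entropic case -/

noncomputable section
namespace RadialFlow
open Filter Topology Kin SmoothGerm

section
variable {n : ℕ} {J I : Set ℝ} {P : ℝ → ℝ → ℝ} {q : Pair}

lemma pd_comm {f : Kin → ℝ} {x : Kin} (hf : ContDiffAt ℝ ∞ f x) (u v : Kin) :
    pd u (pd v f) x = pd v (pd u f) x := by
  have d2 : DifferentiableAt ℝ (fderiv ℝ f) x :=
    (hf.fderiv_right (m := ∞) (by simp)).differentiableAt (by simp)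
  have sec : ∀ u v, pd u (pd v f) x = fderiv ℝ (fderiv ℝ f) x u v := fun u v => by
    have := (d2.hasFDerivAt.clm_apply (hasFDerivAt_const v x)).fderiv
    refine (congrArg (fun L => L u) this).trans ?_
    simp
  rw [sec, sec]
  exact (hf.isSymmSndFDerivAt
    (by rw [minSmoothness_of_isRCLikeNormedField]; exact ENat.LEInfty.out)) u v

lemma pd_ρ_mul {g : Kin → ℝ} {x : Kin} (hg : DifferentiableAt ℝ g x) (v : Kin) :
    pd v (fun y => y.ρ * g y) x = v.ρ * g x + x.ρ * pd v g x := by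
  have hρ : DifferentiableAt ℝ Kin.ρ x := contDiff_ρ.contDiffAt.differentiableAt (by simp)
  refine (congrArg (fun L => L v) (hρ.hasFDerivAt.mul hg.hasFDerivAt).fderiv).trans ?_
  simp only [add_apply, smul_apply, smul_eq_mul, fderiv_ρ, pd]
  ring

lemma exists_isBarotropic (hJ : IsOpen J) (hI : IsOpen I) (hJc : IsPreconnected J)
    (hIc : IsPreconnected I) (hIne : I.Nonempty)
    (hP : ContDiffOn ℝ ∞ (fun y : ℝ × ℝ => P y.1 y.2) (J ×ˢ I))
    (h : ∀ x ∈ kinDomain J I, pd eS (kinPressure P) x = 0) : ∃ p, IsBarotropic J I P p := by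
  obtain ⟨S₁, hS₁⟩ := hIne
  exact ⟨fun ρ => P ρ S₁, fun ρ hρ S hS => eq_of_pd_eq_zero hJ hI hJc hIc
    (contDiffOn_thermo hP) (x := (0, 1, 0, ρ, S)) (y := (0, 1, 0, ρ, S₁)) ⟨one_pos, hρ, hS⟩
    ⟨one_pos, hρ, hS₁⟩ (Or.inl rfl) (Or.inl rfl) (Or.inl rfl) (Or.inl rfl) (Or.inr h)⟩

/-- The two conditions say that (n + 2) p - n ρ p_ρ has vanishing gradient, hence equals (n + 2) p₀.
Then p - p₀ is homogeneous of degree 1 + 2/n in ρ. -/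
lemma exists_isIdealPolytropic (hn : n ≠ 0) (hJ : IsOpen J) (hI : IsOpen I)
    (hJc : IsPreconnected J) (hIc : IsPreconnected I) (hJne : J.Nonempty) (hIne : I.Nonempty)
    (hJpos : J ⊆ Ioi 0) (hP : ContDiffOn ℝ ∞ (fun y : ℝ × ℝ => P y.1 y.2) (J ×ˢ I))
    (h : ∀ x ∈ kinDomain J I,
      n * (x.ρ * pd eρ (pd eρ (kinPressure P)) x) = 2 * pd eρ (kinPressure P) x ∧
      n * (x.ρ * pd eρ (pd eS (kinPressure P)) x) = (n + 2) * pd eS (kinPressure P) x) :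
    ∃ p₀ κ, IsIdealPolytropic n J I P p₀ κ := by
  have hO := isOpen_kinDomain hJ hI
  have hp : ContDiffOn ℝ ∞ (kinPressure P) (kinDomain J I) := contDiffOn_thermo hP
  have ha := hp.pd hO eρ
  have hn0 : (n : ℝ) ≠ 0 := Nat.cast_ne_zero.2 hn
  have hn2 : (n : ℝ) + 2 ≠ 0 := by positivity
  obtain ⟨ρ₁, hρ₁⟩ := hJne
  obtain ⟨S₁, hS₁⟩ := hIne
  set W : Kin → ℝ := fun x => (n + 2) * kinPressure P x
    - n * (x.ρ * pd eρ (kinPressure P) x) with hW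
  have sW : ContDiffOn ℝ ∞ W (kinDomain J I) :=
    (contDiffOn_const.mul hp).sub (contDiffOn_const.mul (contDiff_ρ.contDiffOn.mul ha))
  have dW : ∀ x ∈ kinDomain J I, ∀ v, pd v W x = (n + 2) * pd v (kinPressure P) x
      - n * (v.ρ * pd eρ (kinPressure P) x + x.ρ * pd v (pd eρ (kinPressure P)) x) :=
    fun x hx v => by
      have d1 := ContDiffOn.differentiableAt_kin hJ hI hp hx
      have d2 := ContDiffOn.differentiableAt_kin hJ hI ha hx
      have d3 : DifferentiableAt ℝ (fun y : Kin => y.ρ * pd eρ (kinPressure P) y) x :=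
        ContDiffOn.differentiableAt_kin hJ hI (contDiff_ρ.contDiffOn.mul ha) hx
      rw [← pd_ρ_mul d2]
      exact congrArg (fun L => L v)
        ((d1.hasFDerivAt.const_mul ((n : ℝ) + 2)).sub (d3.hasFDerivAt.const_mul (n : ℝ))).fderiv
  have Wρ : ∀ x ∈ kinDomain J I, pd eρ W x = 0 := fun x hx => by
    rw [dW x hx]
    have : (eρ : Kin).ρ = 1 := rfl
    rw [this]
    linear_combination -(h x hx).1
  have WS : ∀ x ∈ kinDomain J I, pd eS W x = 0 := fun x hx => by
    rw [dW x hx, pd_comm (hp.contDiffAt (hO.mem_nhds hx))]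
    have : (eS : Kin).ρ = 0 := rfl
    rw [this]
    linear_combination -(h x hx).2
  set p₀ : ℝ := W (0, 1, 0, ρ₁, S₁) / (n + 2) with hp₀
  have hode : ∀ ρ ∈ J, ∀ S ∈ I, n * (ρ * pRho P ρ S) = (n + 2) * (P ρ S - p₀) :=
    fun ρ hρ S hS => by
      have hx : ((0, 1, 0, ρ, S) : Kin) ∈ kinDomain J I := ⟨one_pos, hρ, hS⟩
      have e := eq_of_pd_eq_zero hJ hI hJc hIc sW hx (y := (0, 1, 0, ρ₁, S₁))
        ⟨one_pos, hρ₁, hS₁⟩ (Or.inl rfl) (Or.inl rfl) (Or.inl rfl) (Or.inr Wρ) (Or.inr WS)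
      have e1 : pRho P ρ S = pd eρ (kinPressure P) (0, 1, 0, ρ, S) := pRho_eq hJ hI hP hx
      have e2 : (n + 2) * P ρ S - n * (ρ * pRho P ρ S) = W (0, 1, 0, ρ₁, S₁) := by
        rw [e1]; exact e
      rw [hp₀]
      field_simp
      linear_combination -e2
  clear_value p₀
  -- For fixed S the quotient (p - p₀) / ρ^(1+2/n) is constant in ρ; κ is its value at the reference
  -- density.
  refine ⟨p₀, fun S => (P ρ₁ S - p₀) * ρ₁ ^ (-(1 + 2 / (n : ℝ))), fun ρ hρ S hS => ?_⟩
  have hd : ∀ y ∈ J, HasDerivAt (fun y => (P y S - p₀) * y ^ (-(1 + 2 / (n : ℝ)))) 0 y :=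
    fun y hy => by
      have hy0 : y ≠ 0 := ne_of_gt (hJpos hy)
      refine (((hasDerivAt_pRho hJ hI hP hy hS).sub_const p₀).mul
        (Real.hasDerivAt_rpow_const (Or.inl hy0))).congr_deriv ?_
      rw [Real.rpow_sub_one hy0]
      have := hode y hy S hS
      field_simp
      linear_combination y ^ (-((n + 2 : ℝ) / n)) * this
  have e : (P ρ S - p₀) * ρ ^ (-(1 + 2 / (n : ℝ))) = (P ρ₁ S - p₀) * ρ₁ ^ (-(1 + 2 / (n : ℝ))) :=
    hJ.is_const_of_deriv_eq_zero hJc (fun y hy => (hd y hy).differentiableAt.differentiableWithinAt)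
      (fun y hy => (hd y hy).deriv) hρ hρ₁
  have hρ0 : ρ ^ (1 + 2 / (n : ℝ)) ≠ 0 := (Real.rpow_pos_of_pos (hJpos hρ) _).ne'
  simp only [idealPressure]
  rw [← e, Real.rpow_neg (le_of_lt (hJpos hρ)), mul_assoc, inv_mul_cancel₀ hρ0]
  ring

/-- The normal form of a conservation law for an entropic equation of state. -/
theorem exists_normal_form_entropic (hn : 2 ≤ n) (hJ : IsOpen J) (hI : IsOpen I)
    (hJc : IsPreconnected J) (hIc : IsPreconnected I) (hJne : J.Nonempty) (hJpos : J ⊆ Ioi 0)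
    (hP : ContDiffOn ℝ ∞ (fun y : ℝ × ℝ => P y.1 y.2) (J ×ˢ I)) {κ : ℝ → ℝ}
    (hκ : IsEntropic J I P κ) (hd : J ×ˢ I ⊆ closure {x | x ∈ J ×ˢ I ∧ pS P x.1 x.2 ≠ 0})
    (H : IsConservationLaw n J I P q) :
    ∃ F K : ℝ → ℝ, IsWeight I κ F K ∧
      ∀ x ∈ kinDomain J I, pd eU q.1 x = x.ρ * x.U * F x.S := by
  have hO := isOpen_kinDomain hJ hI
  have hp : ContDiffOn ℝ ∞ (kinPressure P) (kinDomain J I) := contDiffOn_thermo hP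
  have ha := hp.pd hO eρ
  have hpS := hp.pd hO eS
  set Ω' : Set Kin := {x | x ∈ kinDomain J I ∧ pd eS (kinPressure P) x ≠ 0} with hΩ'
  have hΩo : IsOpen Ω' := isOpen_kinDomain_inter hJ hI hpS
  have hcl : kinDomain J I ⊆ closure Ω' := by
    refine (kinDomain_subset_closure (Q := fun ρ S => pS P ρ S ≠ 0) hd).trans (closure_mono ?_)
    rintro x ⟨h1, h2⟩
    exact ⟨h1, by rwa [← pS_eq hJ hI hP h1]⟩
  have ha0 : ∀ x ∈ kinDomain J I, pd eρ (kinPressure P) x = 0 := fun x hx => by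
    rw [← pRho_eq hJ hI hP hx]
    have : HasDerivAt (fun y => P y x.S) 0 x.ρ :=
      (hasDerivAt_const x.ρ (κ x.S)).congr_of_eventuallyEq
        (mem_of_superset (hJ.mem_nhds hx.2.1) fun y hy => hκ y hy x.S hx.2.2)
    exact this.deriv
  set E : Kin → ℝ := pd eU (pd eU q.1) with hE
  have sw : ContDiffOn ℝ ∞ (pd eU q.1) (kinDomain J I) := H.smooth_density.pd hO eU
  have sE : ContDiffOn ℝ ∞ E (kinDomain J I) := sw.pd hO eU
  have ρ0 : ∀ x ∈ kinDomain J I, x.ρ ≠ 0 := fun x hx => (hJpos hx.2.1).ne'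
  have key := fun (l : Filter Kin) (_ : IsGeneric l) (hl : kinDomain J I ∈ l) (hl' : Ω' ∈ l) =>
    (isLaw_germ (by omega) hJ hI hJpos hP H hl (eventually_ρ_ne hJpos hl)
      (eventually_contDiffAt hO hl hp) (eventually_contDiffAt hO hl ha)
      (eventually_contDiffAt hO hl H.smooth_density)
      (eventually_contDiffAt hO hl H.smooth_flux)).normal_form_entropic
      (E := SmoothGerm.mk E (eventually_contDiffAt hO hl sE))
      (by have : n - 1 ≠ 0 := by omega
          exact_mod_cast this)
      (mk_eq_zero.2 (mem_of_superset hl ha0))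
      (fun h0 => by
        have e := (eq_iff_of_coe (f := pd eS (kinPressure P)) (g := fun _ => 0) rfl rfl).1 h0
        obtain ⟨x, h1, h2⟩ := (e.and hl').exists
        exact h2.2 h1)
      rfl
  have sz : ContDiffOn ℝ ∞ (fun x => E x / x.ρ) (kinDomain J I) :=
    sE.div contDiff_ρ.contDiffOn ρ0
  have eU := forall_eq_zero_of_generic hO hΩo hcl (g := fun x => pd eU q.1 x - E x * x.U)
    (sw.sub (sE.mul contDiff_U.contDiffOn)).continuousOn fun l il hl hl' => by
      have e := (eq_iff_of_coe (f := pd eU q.1) (g := fun x => E x * x.U) rfl rfl).1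
        (key l il hl hl').2.2.2.2
      filter_upwards [e] with x hx using sub_eq_zero.2 hx
  have zero : ∀ v, (v = eT ∨ v = eR ∨ v = Kin.eU ∨ v = eρ) → ∀ x ∈ kinDomain J I,
      pd v (fun x => E x / x.ρ) x = 0 := fun v hv =>
    forall_eq_zero_of_generic hO hΩo hcl (sz.pd hO v).continuousOn fun l il hl hl' => by
      obtain ⟨e1, e2, e3, e4, -⟩ := key l il hl hl'
      have hq : ∀ D : Derivation ℤ (SmoothGerm l) (SmoothGerm l),
          (germField l (eventually_ρ_ne hJpos hl)).ρ *
            D (SmoothGerm.mk E (eventually_contDiffAt hO hl sE)) =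
          SmoothGerm.mk E (eventually_contDiffAt hO hl sE) *
            D (germField l (eventually_ρ_ne hJpos hl)).ρ →
          D (SmoothGerm.mk (fun x => E x / x.ρ) (eventually_contDiffAt hO hl sz)) = 0 :=
        fun D hD => by
          have e : SmoothGerm.mk (fun x => E x / x.ρ) (eventually_contDiffAt hO hl sz) =
            SmoothGerm.mk E (eventually_contDiffAt hO hl sE) /
              (germField l (eventually_ρ_ne hJpos hl)).ρ := Subtype.ext rfl
          rw [e]
          exact Derivation.div_eq_zero D hD
      refine (eq_iff_of_coe (f := pd v (fun x => E x / x.ρ)) (g := fun _ => 0)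
        (γ := dir v (SmoothGerm.mk (fun x => E x / x.ρ) (eventually_contDiffAt hO hl sz)))
        (δ := 0) rfl rfl).1 ?_
      rcases hv with rfl | rfl | rfl | rfl
      · exact hq (germField l (eventually_ρ_ne hJpos hl)).dt
          (by rw [e2, KinField.dt_ρ, mul_zero, mul_zero])
      · exact hq (germField l (eventually_ρ_ne hJpos hl)).dr
          (by rw [e3, KinField.dr_ρ, mul_zero, mul_zero])
      · exact hq (germField l (eventually_ρ_ne hJpos hl)).dU
          (by rw [e1, KinField.dU_ρ, mul_zero, mul_zero])
      · refine (mul_eq_zero.1 ?_).resolve_left (germField l (eventually_ρ_ne hJpos hl)).ρ_ne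
        exact hq (germField l (eventually_ρ_ne hJpos hl)).dl (by rw [e4, KinField.dl_ρ, mul_comm])
  obtain ⟨ρ₁, hρ₁⟩ := hJne
  have hF : ∀ x ∈ kinDomain J I, pd Kin.eU q.1 x
      = x.ρ * x.U * (E (0, 1, 0, ρ₁, x.S) / ρ₁) := fun x hx => by
    have e : E x / x.ρ = E (0, 1, 0, ρ₁, x.S) / ρ₁ := eq_of_pd_eq_zero hJ hI hJc hIc sz hx
      (y := (0, 1, 0, ρ₁, x.S)) ⟨one_pos, hρ₁, hx.2.2⟩ (Or.inr (zero _ (by simp)))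
      (Or.inr (zero _ (by simp))) (Or.inr (zero _ (by simp))) (Or.inr (zero _ (by simp)))
      (Or.inl rfl)
    have := ρ0 x hx
    have e2 := eU x hx
    rw [← e]
    field_simp
    linear_combination e2
  -- The flux at U = 1 serves as K, since ρ Ψ_S = p_S Φ_U = κ' ρ U F.
  refine ⟨fun S => E (0, 1, 0, ρ₁, S) / ρ₁, fun S => q.2 (0, 1, 1, ρ₁, S), ⟨?_, ?_⟩, hF⟩
  · exact (sE.comp (f := fun S : ℝ => ((0, 1, 0, ρ₁, S) : Kin)) (by fun_prop)
      fun S hS => ⟨one_pos, hρ₁, hS⟩).div_const _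
  · intro S hS
    have hx : ((0, 1, 1, ρ₁, S) : Kin) ∈ kinDomain J I := ⟨one_pos, hρ₁, hS⟩
    have d := ContDiffOn.differentiableAt_kin hJ hI H.smooth_flux hx
    have l : HasDerivAt (fun τ => q.2 (0, 1, 1, ρ₁, τ)) (fderiv ℝ q.2 (0, 1, 1, ρ₁, S) eS) S :=
      HasFDerivAt.comp_hasDerivAt (f := fun τ => ((0, 1, 1, ρ₁, τ) : Kin)) S
        (d.hasFDerivAt : HasFDerivAt q.2 _ _) (hasDerivAt_line_S (0, 1, 1, ρ₁, S))
    refine l.congr_deriv ?_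
    have D := (((isConservationLaw_iff (by omega) hJ hI hJpos).1 H).2.2 _ hx).flux_S
    have hS0 : pS P ρ₁ S = deriv κ S :=
      Filter.EventuallyEq.deriv_eq (mem_of_superset (hI.mem_nhds hS) fun y hy => hκ ρ₁ hρ₁ y hy)
    have D' : ρ₁ * fderiv ℝ q.2 (0, 1, 1, ρ₁, S) eS
      = pS P ρ₁ S * pd Kin.eU q.1 (0, 1, 1, ρ₁, S) := D
    have e3 := hF _ hx
    change pd Kin.eU q.1 (0, 1, 1, ρ₁, S) = ρ₁ * 1 * (E (0, 1, 0, ρ₁, S) / ρ₁) at e3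
    have hρ0 : ρ₁ ≠ 0 := (hJpos hρ₁).ne'
    rw [e3, hS0] at D'
    apply mul_left_cancel₀ hρ0
    linear_combination D'

end

end RadialFlow
end

/-! ### The moving balance along classical solutions -/

noncomputable section
namespace RadialFlow
open Filter Topology Kin

section
variable {n : ℕ} {J I : Set ℝ} {P : ℝ → ℝ → ℝ} {q : Pair} {O : Set (ℝ × ℝ)} {U ρ S : ℝ → ℝ → ℝ}

lemma hasDerivAt_slice_fst {f : ℝ → ℝ → ℝ} {t r : ℝ}
    (h : DifferentiableAt ℝ (fun y : ℝ × ℝ => f y.1 y.2) (t, r)) :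
    HasDerivAt (fun τ => f τ r) (fderiv ℝ (fun y : ℝ × ℝ => f y.1 y.2) (t, r) (1, 0)) t :=
  HasFDerivAt.comp_hasDerivAt (f := fun τ => (τ, r)) t
    (h.hasFDerivAt : HasFDerivAt (fun y : ℝ × ℝ => f y.1 y.2) _ _)
    ((hasDerivAt_id t).prodMk (hasDerivAt_const t r))

lemma hasDerivAt_slice_snd {f : ℝ → ℝ → ℝ} {t r : ℝ}
    (h : DifferentiableAt ℝ (fun y : ℝ × ℝ => f y.1 y.2) (t, r)) :
    HasDerivAt (f t) (fderiv ℝ (fun y : ℝ × ℝ => f y.1 y.2) (t, r) (0, 1)) r :=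
  HasFDerivAt.comp_hasDerivAt (f := fun τ => (t, τ)) r
    (h.hasFDerivAt : HasFDerivAt (fun y : ℝ × ℝ => f y.1 y.2) _ _)
    ((hasDerivAt_const r t).prodMk (hasDerivAt_id r))

/-- The kinematic state of a flow. -/
def flowState (U ρ S : ℝ → ℝ → ℝ) (y : ℝ × ℝ) : Kin :=
  (y.1, y.2, U y.1 y.2, ρ y.1 y.2, S y.1 y.2)

/-- The jet of a flow. -/
def flowJet (U ρ S : ℝ → ℝ → ℝ) (y : ℝ × ℝ) : Jet where
  t := y.1
  r := y.2
  U := U y.1 y.2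
  ρ := ρ y.1 y.2
  S := S y.1 y.2
  Ut := fderiv ℝ (fun y : ℝ × ℝ => U y.1 y.2) y (1, 0)
  ρt := fderiv ℝ (fun y : ℝ × ℝ => ρ y.1 y.2) y (1, 0)
  St := fderiv ℝ (fun y : ℝ × ℝ => S y.1 y.2) y (1, 0)
  Ur := fderiv ℝ (fun y : ℝ × ℝ => U y.1 y.2) y (0, 1)
  ρr := fderiv ℝ (fun y : ℝ × ℝ => ρ y.1 y.2) y (0, 1)
  Sr := fderiv ℝ (fun y : ℝ × ℝ => S y.1 y.2) y (0, 1)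

namespace IsRadialFlow
variable (hf : IsRadialFlow n J I P O U ρ S) {y : ℝ × ℝ} (hy : y ∈ O)
include hf hy

lemma differentiableAt : DifferentiableAt ℝ (fun y : ℝ × ℝ => U y.1 y.2) y ∧
    DifferentiableAt ℝ (fun y : ℝ × ℝ => ρ y.1 y.2) y ∧
    DifferentiableAt ℝ (fun y : ℝ × ℝ => S y.1 y.2) y :=
  ⟨(hf.diff_U.contDiffAt (hf.isOpen.mem_nhds hy)).differentiableAt one_ne_zero,
    (hf.diff_ρ.contDiffAt (hf.isOpen.mem_nhds hy)).differentiableAt one_ne_zero,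
    (hf.diff_S.contDiffAt (hf.isOpen.mem_nhds hy)).differentiableAt one_ne_zero⟩

lemma flowState_mem : flowState U ρ S y ∈ kinDomain J I :=
  ⟨hf.r_pos y hy, hf.ρ_mem y hy, hf.S_mem y hy⟩

lemma onShell : (flowJet U ρ S y).OnShell n J I P := by
  obtain ⟨dU, dρ, dS⟩ := hf.differentiableAt hy
  obtain ⟨t, r⟩ := y
  have e1 := hf.velocity_eqn t r hy
  have e2 := hf.density_eqn t r hy
  have e3 := hf.entropy_eqn t r hy
  rw [(hasDerivAt_slice_fst dU).deriv, (hasDerivAt_slice_snd dU).deriv,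
    (hasDerivAt_slice_snd dρ).deriv, (hasDerivAt_slice_snd dS).deriv] at e1
  rw [(hasDerivAt_slice_fst dρ).deriv,
    ((hasDerivAt_slice_snd dU).fun_mul (hasDerivAt_slice_snd dρ)).deriv] at e2
  rw [(hasDerivAt_slice_fst dS).deriv, (hasDerivAt_slice_snd dS).deriv] at e3
  exact ⟨hf.r_pos _ hy, hf.ρ_mem _ hy, hf.S_mem _ hy, e1, e2, e3⟩

lemma hasFDerivAt_flowState : ∃ L : ℝ × ℝ →L[ℝ] Kin, HasFDerivAt (flowState U ρ S) L y ∧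
    L (1, 0) = (1, 0, (flowJet U ρ S y).Ut, (flowJet U ρ S y).ρt, (flowJet U ρ S y).St) ∧
    L (0, 1) = (0, 1, (flowJet U ρ S y).Ur, (flowJet U ρ S y).ρr, (flowJet U ρ S y).Sr) := by
  obtain ⟨dU, dρ, dS⟩ := hf.differentiableAt hy
  exact ⟨_, (hasFDerivAt_fst).prodMk ((hasFDerivAt_snd).prodMk
    (dU.hasFDerivAt.prodMk (dρ.hasFDerivAt.prodMk dS.hasFDerivAt))), rfl, rfl⟩

lemma fderiv_comp_flowState {f : Kin → ℝ}
    (hd : DifferentiableAt ℝ f (flowState U ρ S y)) :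
    DifferentiableAt ℝ (fun z => f (flowState U ρ S z)) y ∧
    fderiv ℝ (fun z => f (flowState U ρ S z)) y (1, 0) = (flowJet U ρ S y).Dt f ∧
    fderiv ℝ (fun z => f (flowState U ρ S z)) y (0, 1) = (flowJet U ρ S y).Dr f := by
  obtain ⟨L, hL, h1, h2⟩ := hf.hasFDerivAt_flowState hy
  have hc : HasFDerivAt (fun z => f (flowState U ρ S z)) _ y := hd.hasFDerivAt.comp y hL
  refine ⟨hc.differentiableAt, ?_, ?_⟩
  · rw [hc.fderiv, ContinuousLinearMap.comp_apply, h1]; rfl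
  · rw [hc.fderiv, ContinuousLinearMap.comp_apply, h2]; rfl

end IsRadialFlow

/-- Compactness of the segment gives a uniform margin. The box is convex, so closed forms on it are
exact. -/
lemma exists_box_subset (hO : IsOpen O) {t a b : ℝ} (hab : a ≤ b)
    (h : ∀ r ∈ Icc a b, (t, r) ∈ O) :
    ∃ δ > 0, Ioo (t - δ) (t + δ) ×ˢ Ioo (a - δ) (b + δ) ⊆ O := by
  have hK : IsCompact (({t} : Set ℝ) ×ˢ Icc a b) := isCompact_singleton.prod isCompact_Icc
  obtain ⟨δ, hδ, hsub⟩ := hK.exists_thickening_subset_open hO (by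
    rintro ⟨τ, r⟩ ⟨rfl, hr⟩
    exact h r hr)
  refine ⟨δ, hδ, fun z hz => hsub ?_⟩
  obtain ⟨τ, r⟩ := z
  obtain ⟨⟨h1, h2⟩, h3, h4⟩ := hz
  rw [Metric.mem_thickening_iff]
  refine ⟨(t, max a (min r b)), ⟨rfl, le_max_left _ _, max_le hab (min_le_right _ _)⟩, ?_⟩
  simp only at h1 h2 h3 h4
  rw [Prod.dist_eq, max_lt_iff, Real.dist_eq, Real.dist_eq, abs_lt, abs_lt]
  refine ⟨⟨by linarith, by linarith⟩, ?_⟩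
  simp only
  rcases le_total r b with h5 | h5
  · rw [min_eq_left h5]
    rcases le_total a r with h6 | h6
    · rw [max_eq_right h6]; exact ⟨by linarith, by linarith⟩
    · rw [max_eq_left h6]; exact ⟨by linarith, by linarith⟩
  · rw [min_eq_right h5, max_eq_right hab]; exact ⟨by linarith, by linarith⟩

/-- The moving form of a conservation law. -/
theorem IsConservationLaw.hasMovingBalance (hJ : IsOpen J) (hI : IsOpen I)
    (H : IsConservationLaw n J I P q) : HasMovingBalance n J I P q := by
  intro O U ρ S T a b hf hT t ht
  set G : ℝ × ℝ → ℝ := fun y => y.2 ^ (n - 1) * q.1 (flowState U ρ S y) with hG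
  set X : ℝ × ℝ → ℝ := fun y => y.2 ^ (n - 1) *
    (q.2 (flowState U ρ S y) + U y.1 y.2 * q.1 (flowState U ρ S y)) with hX
  have s1 : ContDiffOn ℝ ∞ (fun x : Kin => x.r ^ (n - 1) * q.1 x) (kinDomain J I) :=
    (contDiff_r.pow _).contDiffOn.mul H.smooth_density
  have s2 : ContDiffOn ℝ ∞ (fun x : Kin => x.r ^ (n - 1) * (q.2 x + x.U * q.1 x))
      (kinDomain J I) := (contDiff_r.pow _).contDiffOn.mul
    (H.smooth_flux.add (contDiff_U.contDiffOn.mul H.smooth_density))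
  have dG : ∀ y ∈ O, DifferentiableAt ℝ G y ∧
      fderiv ℝ G y (1, 0) = (flowJet U ρ S y).Dt (fun x => x.r ^ (n - 1) * q.1 x) := fun y hy =>
    have h := hf.fderiv_comp_flowState hy
      (ContDiffOn.differentiableAt_kin hJ hI s1 (hf.flowState_mem hy))
    ⟨h.1, h.2.1⟩
  have dX : ∀ y ∈ O, DifferentiableAt ℝ X y ∧ fderiv ℝ X y (0, 1)
      = (flowJet U ρ S y).Dr (fun x => x.r ^ (n - 1) * (q.2 x + x.U * q.1 x)) := fun y hy =>
    have h := hf.fderiv_comp_flowState hy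
      (ContDiffOn.differentiableAt_kin hJ hI s2 (hf.flowState_mem hy))
    ⟨h.1, h.2.2⟩
  obtain ⟨δ, hδ, hbox⟩ := exists_box_subset hf.isOpen (hT.le t ht) (hT.mem t ht)
  set B : Set (ℝ × ℝ) := Ioo (t - δ) (t + δ) ×ˢ Ioo (a t - δ) (b t + δ) with hB
  -- The conservation law says that -X dt + G dr is closed on the box. With a potential `N` the
  -- integral becomes N(τ, b τ) - N(τ, a τ), and no differentiation under the integral is needed.
  obtain ⟨N, hN⟩ := exists_potential (s := B) (A := fun y => -X y) (B := G)
    ((convex_Ioo _ _).prod (convex_Ioo _ _)) (isOpen_Ioo.prod isOpen_Ioo)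
    (fun y hy => (dX y (hbox hy)).1.neg.differentiableWithinAt)
    (fun y hy => (dG y (hbox hy)).1.differentiableWithinAt) fun y hy => by
      have e : fderiv ℝ (fun y => -X y) y (0, 1) = -fderiv ℝ X y (0, 1) :=
        congrArg (fun L => L ((0, 1) : ℝ × ℝ)) (dX y (hbox hy)).1.hasFDerivAt.neg.fderiv
      rw [e, (dX y (hbox hy)).2, (dG y (hbox hy)).2]
      linear_combination -H.law _ (hf.onShell (hbox hy))
  have hab := hT.le t ht
  have ha : a t ∈ Ioo (a t - δ) (b t + δ) := ⟨by linarith, by linarith⟩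
  have hb : b t ∈ Ioo (a t - δ) (b t + δ) := ⟨by linarith, by linarith⟩
  have ht' : t ∈ Ioo (t - δ) (t + δ) := ⟨by linarith, by linarith⟩
  have ev : (fun τ => ∫ r in (a τ)..(b τ), q.1 (τ, r, U τ r, ρ τ r, S τ r) * r ^ (n - 1))
      =ᶠ[𝓝 t] fun τ => N (τ, b τ) - N (τ, a τ) := by
    filter_upwards [isOpen_Ioo.mem_nhds ht',
      (hT.inner t ht).continuousAt.preimage_mem_nhds (isOpen_Ioo.mem_nhds ha),
      (hT.outer t ht).continuousAt.preimage_mem_nhds (isOpen_Ioo.mem_nhds hb)] with τ h1 h2 h3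
    have hmem : ∀ r ∈ uIcc (a τ) (b τ), (τ, r) ∈ B := fun r hr =>
      ⟨h1, ordConnected_Ioo.uIcc_subset h2 h3 hr⟩
    have e : ∀ r, q.1 (τ, r, U τ r, ρ τ r, S τ r) * r ^ (n - 1) = G (τ, r) := fun r => mul_comm _ _
    simp only [e]
    refine intervalIntegral.integral_eq_sub_of_hasDerivAt (f := fun r => N (τ, r))
      (fun r hr => ?_) (ContinuousOn.intervalIntegrable fun r hr => ?_)
    · have h := (hN _ (hmem r hr)).comp_hasDerivAt r
        ((hasDerivAt_const r τ).prodMk (hasDerivAt_id r))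
      exact h.congr_deriv (by simp)
    · have hc : ContinuousAt (fun r : ℝ => (τ, r)) r := by fun_prop
      exact (ContinuousAt.comp (f := fun r : ℝ => (τ, r)) (g := G)
        (dG _ (hbox (hmem r hr))).1.continuousAt hc).continuousWithinAt
  refine HasDerivAt.congr_of_eventuallyEq ?_ ev
  -- Along a boundary moving with velocity U, `N` changes at the rate -X + U G = -r^(n-1) Ψ.
  have k1 := (hN (t, b t) ⟨ht', hb⟩).comp_hasDerivAt t ((hasDerivAt_id t).prodMk (hT.outer t ht))
  have k2 := (hN (t, a t) ⟨ht', ha⟩).comp_hasDerivAt t ((hasDerivAt_id t).prodMk (hT.inner t ht))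
  refine (k1.sub k2).congr_deriv ?_
  simp only [hG, hX, flowState, add_apply, smul_apply, smul_eq_mul, ContinuousLinearMap.coe_fst',
    ContinuousLinearMap.coe_snd']
  ring

end

end RadialFlow
end

/-! ### Nondegeneracy, vanishing fluxes and linear combinations -/

noncomputable section
namespace RadialFlow
open Filter Topology Kin

section
variable {n : ℕ} {J I : Set ℝ} {P e : ℝ → ℝ → ℝ} {q : Pair}

lemma IsEntropic.pRho_eq_zero (hJ : IsOpen J) {κ : ℝ → ℝ} (h : IsEntropic J I P κ) {ρ S : ℝ}
    (hρ : ρ ∈ J) (hS : S ∈ I) : pRho P ρ S = 0 := by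
  have : HasDerivAt (fun y => P y S) 0 ρ := (hasDerivAt_const ρ (κ S)).congr_of_eventuallyEq
    (mem_of_superset (hJ.mem_nhds hρ) fun y hy => h y hy S hS)
  exact this.deriv

lemma IsBarotropic.pS_eq_zero (hI : IsOpen I) {p : ℝ → ℝ} (h : IsBarotropic J I P p) {ρ S : ℝ}
    (hρ : ρ ∈ J) (hS : S ∈ I) : pS P ρ S = 0 := by
  have : HasDerivAt (fun y => P ρ y) 0 S := (hasDerivAt_const S (p ρ)).congr_of_eventuallyEq
    (mem_of_superset (hI.mem_nhds hS) fun y hy => h ρ hρ y hy)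
  exact this.deriv

lemma nonempty_of_subset_closure {Q : ℝ × ℝ → Prop} (hJne : J.Nonempty) (hIne : I.Nonempty)
    (h : J ×ˢ I ⊆ closure {x | x ∈ J ×ˢ I ∧ Q x}) : ∃ x, x ∈ J ×ˢ I ∧ Q x := by
  obtain ⟨x, hx⟩ := hJne.prod hIne
  exact closure_nonempty_iff.1 ⟨x, h hx⟩

lemma IsNondegenerate.dense_pS (hJ : IsOpen J) (hJne : J.Nonempty) (hIne : I.Nonempty)
    (h : IsNondegenerate J I P) {κ : ℝ → ℝ} (hκ : IsEntropic J I P κ) :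
    J ×ˢ I ⊆ closure {x | x ∈ J ×ˢ I ∧ pS P x.1 x.2 ≠ 0} := by
  rcases h with h | h
  · obtain ⟨x, hx, h0⟩ := nonempty_of_subset_closure hJne hIne h
    exact absurd (hκ.pRho_eq_zero hJ hx.1 hx.2) h0
  · exact h.2

lemma IsNondegenerate.dense_pRho (h : IsNondegenerate J I P)
    (hκ : ¬ ∃ κ, IsEntropic J I P κ) :
    J ×ˢ I ⊆ closure {x | x ∈ J ×ˢ I ∧ pRho P x.1 x.2 ≠ 0} :=
  h.resolve_right fun h' => hκ h'.1

lemma IsNondegenerate.not_const (hJ : IsOpen J) (hI : IsOpen I) (hJne : J.Nonempty)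
    (hIne : I.Nonempty) (h : IsNondegenerate J I P) (c : ℝ) :
    ¬ ∀ ρ ∈ J, ∀ S ∈ I, P ρ S = c := fun hc => by
  have hκ : IsEntropic J I P fun _ => c := hc
  have hp : IsBarotropic J I P fun _ => c := hc
  obtain ⟨x, hx, h0⟩ := nonempty_of_subset_closure hJne hIne (h.dense_pS hJ hJne hIne hκ)
  exact h0 (hp.pS_eq_zero hI hx.1 hx.2)

lemma IsNondegenerate.not_isEntropic_of_isBarotropic (hJ : IsOpen J) (hI : IsOpen I)
    (hJne : J.Nonempty) (hIne : I.Nonempty) (h : IsNondegenerate J I P) {p : ℝ → ℝ}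
    (hp : IsBarotropic J I P p) : ¬ ∃ κ, IsEntropic J I P κ := by
  rintro ⟨κ, hκ⟩
  obtain ⟨ρ₁, hρ₁⟩ := id hJne
  exact h.not_const hJ hI hJne hIne (p ρ₁) fun ρ hρ S hS => by
    rw [hκ ρ hρ S hS, ← hκ ρ₁ hρ₁ S hS, hp ρ₁ hρ₁ S hS]

/-- Two densities with distinct powers force κ = 0, so the pressure is the constant p₀, which
nondegeneracy excludes. -/
lemma IsNondegenerate.not_isEntropic_of_isIdealPolytropic (hJ : IsOpen J) (hI : IsOpen I)
    (hJne : J.Nonempty) (hIne : I.Nonempty) (hJpos : J ⊆ Ioi 0) (h : IsNondegenerate J I P)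
    {p₀ : ℝ} {κ : ℝ → ℝ} (hp : IsIdealPolytropic n J I P p₀ κ) :
    ¬ ∃ κ, IsEntropic J I P κ := by
  rintro ⟨κ', hκ⟩
  obtain ⟨ρ₁, hρ₁⟩ := id hJne
  obtain ⟨ρ₂, hρ₂, hlt⟩ : ∃ ρ₂ ∈ J, ρ₁ < ρ₂ := by
    obtain ⟨ε, hε, hb⟩ := Metric.isOpen_iff.1 hJ ρ₁ hρ₁
    refine ⟨ρ₁ + ε / 2, hb ?_, by linarith⟩
    rw [Metric.mem_ball, Real.dist_eq, add_sub_cancel_left, abs_of_pos (by linarith)]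
    linarith
  have hpow : ρ₁ ^ (1 + 2 / (n : ℝ)) < ρ₂ ^ (1 + 2 / (n : ℝ)) :=
    Real.rpow_lt_rpow (le_of_lt (hJpos hρ₁)) hlt (by positivity)
  refine h.not_const hJ hI hJne hIne p₀ fun ρ hρ S hS => ?_
  have e1 := hp ρ₁ hρ₁ S hS
  have e2 := hp ρ₂ hρ₂ S hS
  rw [hκ ρ₁ hρ₁ S hS, idealPressure] at e1
  rw [hκ ρ₂ hρ₂ S hS, idealPressure] at e2
  have e3 : κ S * (ρ₂ ^ (1 + 2 / (n : ℝ)) - ρ₁ ^ (1 + 2 / (n : ℝ))) = 0 := by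
    linear_combination e1 - e2
  rw [hp ρ hρ S hS, idealPressure, (mul_eq_zero.1 e3).resolve_right (sub_ne_zero.2 hpow.ne')]
  ring

/-- The kinematic conservation laws with vanishing moving flux. -/
theorem isConservationLaw_and_flux_eq_zero_iff (hn : 1 ≤ n) (hJ : IsOpen J) (hI : IsOpen I)
    (hJc : IsPreconnected J) (hIc : IsPreconnected I) (hJne : J.Nonempty) (hIne : I.Nonempty)
    (hJpos : J ⊆ Ioi 0) (hP : ContDiffOn ℝ ∞ (fun y : ℝ × ℝ => P y.1 y.2) (J ×ˢ I))
    (hnd : IsNondegenerate J I P) :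
    (IsConservationLaw n J I P q ∧ ∀ x ∈ kinDomain J I, q.2 x = 0) ↔
      ∃ f : ℝ → ℝ, ContDiffOn ℝ ∞ f I ∧ ∀ x ∈ kinDomain J I,
        q.1 x = (advected f).1 x ∧ q.2 x = (advected f).2 x := by
  constructor
  · rintro ⟨H, h0⟩
    have hO := isOpen_kinDomain hJ hI
    have hp : ContDiffOn ℝ ∞ (kinPressure P) (kinDomain J I) := contDiffOn_thermo hP
    have sw := (H.smooth_density.pd hO eU).continuousOn
    have hD := ((isConservationLaw_iff hn hJ hI hJpos).1 H).2.2
    have hz : ∀ x ∈ kinDomain J I, ∀ v, fderiv ℝ q.2 x v = 0 := fun x hx v => by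
      have : fderiv ℝ q.2 x = fderiv ℝ (fun _ => (0 : ℝ)) x :=
        Filter.EventuallyEq.fderiv_eq (mem_of_superset (hO.mem_nhds hx) h0)
      rw [this]; simp
    -- For Ψ = 0 the determining equations read p_ρ Φ_U = 0 and p_S Φ_U = 0, and one of the factors
    -- p_ρ, p_S is nonzero on a dense set.
    have hU : ∀ x ∈ kinDomain J I, pd eU q.1 x = 0 := by
      rcases hnd with h | ⟨-, h⟩
      · refine forall_eq_zero_of_generic hO
          (isOpen_kinDomain_inter hJ hI (hp.pd hO eρ))
          ((kinDomain_subset_closure (Q := fun ρ S => pRho P ρ S ≠ 0) h).trans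
            (closure_mono fun x hx => ⟨hx.1, by rw [← pRho_eq hJ hI hP hx.1]; exact hx.2⟩)) sw
          fun l _ _ hl => mem_of_superset hl fun x hx => ?_
        have := (hD x hx.1).flux_ρ
        rw [hz x hx.1, mul_zero, pRho_eq hJ hI hP hx.1] at this
        exact (mul_eq_zero.1 this.symm).resolve_left hx.2
      · refine forall_eq_zero_of_generic hO
          (isOpen_kinDomain_inter hJ hI (hp.pd hO eS))
          ((kinDomain_subset_closure (Q := fun ρ S => pS P ρ S ≠ 0) h).trans
            (closure_mono fun x hx => ⟨hx.1, by rw [← pS_eq hJ hI hP hx.1]; exact hx.2⟩)) sw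
          fun l _ _ hl => mem_of_superset hl fun x hx => ?_
        have := (hD x hx.1).flux_S
        rw [hz x hx.1, mul_zero, pS_eq hJ hI hP hx.1] at this
        exact (mul_eq_zero.1 this.symm).resolve_left hx.2
    obtain ⟨f, χ, ψ, hf, -, -, -, h1, h2⟩ :=
      H.exists_of_pd_U_eq_zero hn hJ hI hJc hIc hJne hIne hJpos hP hU
    refine ⟨f, hf, fun x hx => ⟨?_, h0 x hx⟩⟩
    -- The flux ψ - U χ vanishes at U = 0 and at U = 1.
    have hχ : χ (x.t, x.r) = 0 := by
      have a := h2 (x.t, x.r, 0, x.ρ, x.S) ⟨hx.1, hx.2.1, hx.2.2⟩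
      have b := h2 (x.t, x.r, 1, x.ρ, x.S) ⟨hx.1, hx.2.1, hx.2.2⟩
      rw [h0 (x.t, x.r, 0, x.ρ, x.S) ⟨hx.1, hx.2.1, hx.2.2⟩] at a
      rw [h0 (x.t, x.r, 1, x.ρ, x.S) ⟨hx.1, hx.2.1, hx.2.2⟩] at b
      change 0 = ψ (x.t, x.r) - 0 * χ (x.t, x.r) at a
      change 0 = ψ (x.t, x.r) - 1 * χ (x.t, x.r) at b
      linear_combination b - a
    rw [h1 x hx, hχ, add_zero]
    rfl
  · rintro ⟨f, hf, h⟩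
    exact ⟨(isConservationLaw_advected hn hJ hI hJpos hf).congr hn hJ hI hJpos
      (fun x hx => (h x hx).1) fun x hx => (h x hx).2, fun x hx => (h x hx).2⟩

section
variable (hn : 1 ≤ n) (hJ : IsOpen J) (hI : IsOpen I) (hJpos : J ⊆ Ioi 0)
include hn hJ hI hJpos

/-- Combinations of energy, dilational energy and similarity energy. -/
lemma polytropic_combination {p p' e' : ℝ → ℝ → ℝ} (h : IsGas J I P p e)
    (h' : IsGas J I P p' e') (hpe : ∀ ρ ∈ J, ∀ S, ρ * e' ρ S = n / 2 * p' ρ S) (c₀ c₁ c₂ : ℝ) :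
    IsConservationLaw n J I P
      (c₀ • energy p e + c₁ • dilationalEnergy p' e' + c₂ • similarityEnergy p' e') ∧
    ∀ x ∈ kinDomain J I,
      pd eU (c₀ • energy p e + c₁ • dilationalEnergy p' e' + c₂ • similarityEnergy p' e').1 x
        = x.ρ * ((c₀ + c₁ * x.t + c₂ * x.t ^ 2) * x.U - x.r * (c₁ + 2 * c₂ * x.t) / 2) := by
  have H : IsConservationLaw n J I P
      (c₀ • energy p e + c₁ • dilationalEnergy p' e' + c₂ • similarityEnergy p' e') :=
    (((h.isConservationLaw_energy hn hJ hI hJpos).smul hn hJ hI hJpos c₀).add hn hJ hI hJpos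
      ((h'.isConservationLaw_dilationalEnergy hn hJ hI hJpos hpe).smul hn hJ hI hJpos c₁)).add
        hn hJ hI hJpos
      ((h'.isConservationLaw_similarityEnergy hn hJ hI hJpos hpe).smul hn hJ hI hJpos c₂)
  refine ⟨H, fun x hx => H.pd_U hJ hI hx ?_⟩
  exact ((((hasDerivAt_energy x.t x.r x.U x.ρ x.S).const_mul c₀).add
    ((hasDerivAt_dilationalEnergy x.t x.r x.U x.ρ x.S).const_mul c₁)).add
    ((hasDerivAt_similarityEnergy x.t x.r x.U x.ρ x.S).const_mul c₂)).congr_deriv (by ring)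

/-- Combinations of energy and enthalpy flux. -/
lemma barotropic_combination (hIne : I.Nonempty)
    (hP : ContDiffOn ℝ ∞ (fun y : ℝ × ℝ => P y.1 y.2) (J ×ˢ I)) (h : IsGas J I P P e)
    {p e₁ : ℝ → ℝ} (hp : IsBarotropic J I P p) (he : ∀ ρ ∈ J, HasDerivAt e₁ (p ρ / ρ ^ 2) ρ)
    (c₀ c₃ : ℝ) :
    IsConservationLaw n J I P (c₀ • energy P e + c₃ • enthalpyFlux n p e₁) ∧
    ∀ x ∈ kinDomain J I, pd eU (c₀ • energy P e + c₃ • enthalpyFlux n p e₁).1 x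
      = c₃ / x.r ^ (n - 1) + c₀ * x.ρ * x.U := by
  have H : IsConservationLaw n J I P (c₀ • energy P e + c₃ • enthalpyFlux n p e₁) :=
    ((h.isConservationLaw_energy hn hJ hI hJpos).smul hn hJ hI hJpos c₀).add hn hJ hI hJpos
      ((hp.isConservationLaw_enthalpyFlux hn hJ hI hJpos hIne hP he).smul hn hJ hI hJpos c₃)
  refine ⟨H, fun x hx => H.pd_U hJ hI hx ?_⟩
  exact (((hasDerivAt_energy x.t x.r x.U x.ρ x.S).const_mul c₀).add
    ((hasDerivAt_enthalpyFlux x.t x.r x.U x.ρ x.S).const_mul c₃)).congr_deriv (by ring)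

/-- Combinations of energy, dilational energy, similarity energy and enthalpy flux. -/
lemma polytropic_barotropic_combination (hIne : I.Nonempty)
    (hP : ContDiffOn ℝ ∞ (fun y : ℝ × ℝ => P y.1 y.2) (J ×ˢ I)) {p' e' : ℝ → ℝ → ℝ}
    (h : IsGas J I P P e) (h' : IsGas J I P p' e')
    (hpe : ∀ ρ ∈ J, ∀ S, ρ * e' ρ S = n / 2 * p' ρ S) {p e₁ : ℝ → ℝ}
    (hp : IsBarotropic J I P p) (he : ∀ ρ ∈ J, HasDerivAt e₁ (p ρ / ρ ^ 2) ρ)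
    (c₀ c₁ c₂ c₃ : ℝ) :
    IsConservationLaw n J I P (c₀ • energy P e + c₁ • dilationalEnergy p' e'
      + c₂ • similarityEnergy p' e' + c₃ • enthalpyFlux n p e₁) ∧
    ∀ x ∈ kinDomain J I, pd eU (c₀ • energy P e + c₁ • dilationalEnergy p' e'
      + c₂ • similarityEnergy p' e' + c₃ • enthalpyFlux n p e₁).1 x = c₃ / x.r ^ (n - 1)
        + x.ρ * ((c₀ + c₁ * x.t + c₂ * x.t ^ 2) * x.U - x.r * (c₁ + 2 * c₂ * x.t) / 2) := by
  have H : IsConservationLaw n J I P (c₀ • energy P e + c₁ • dilationalEnergy p' e'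
      + c₂ • similarityEnergy p' e' + c₃ • enthalpyFlux n p e₁) :=
    (polytropic_combination hn hJ hI hJpos h h' hpe c₀ c₁ c₂).1.add hn hJ hI hJpos
      ((hp.isConservationLaw_enthalpyFlux hn hJ hI hJpos hIne hP he).smul hn hJ hI hJpos c₃)
  refine ⟨H, fun x hx => H.pd_U hJ hI hx ?_⟩
  exact (((((hasDerivAt_energy x.t x.r x.U x.ρ x.S).const_mul c₀).add
    ((hasDerivAt_dilationalEnergy x.t x.r x.U x.ρ x.S).const_mul c₁)).add
    ((hasDerivAt_similarityEnergy x.t x.r x.U x.ρ x.S).const_mul c₂)).add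
    ((hasDerivAt_enthalpyFlux x.t x.r x.U x.ρ x.S).const_mul c₃)).congr_deriv (by ring)

/-- Multiples of energy. -/
lemma energy_multiple (h : IsGas J I P P e) (c : ℝ) : IsConservationLaw n J I P (c • energy P e) ∧
    ∀ x ∈ kinDomain J I, pd eU (c • energy P e).1 x = c * x.ρ * x.U := by
  have H := (h.isConservationLaw_energy hn hJ hI hJpos).smul hn hJ hI hJpos c
  exact ⟨H, fun x hx => H.pd_U hJ hI hx
    (((hasDerivAt_energy x.t x.r x.U x.ρ x.S).const_mul c).congr_deriv (by ring))⟩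

end

/-- A combination vanishing identically has vanishing coefficients. -/
lemma coeff_eq_zero (hJne : J.Nonempty) (hIne : I.Nonempty) (hJpos : J ⊆ Ioi 0)
    {c₀ c₁ c₂ c₃ : ℝ} (h : ∀ x ∈ kinDomain J I, c₃ / x.r ^ (n - 1)
      + x.ρ * ((c₀ + c₁ * x.t + c₂ * x.t ^ 2) * x.U - x.r * (c₁ + 2 * c₂ * x.t) / 2) = 0) :
    c₀ = 0 ∧ c₁ = 0 ∧ c₂ = 0 ∧ c₃ = 0 := by
  obtain ⟨S, hS⟩ := hIne
  have ev : ∀ t U ρ : ℝ, ρ ∈ J →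
      c₃ + ρ * ((c₀ + c₁ * t + c₂ * t ^ 2) * U - (c₁ + 2 * c₂ * t) / 2) = 0 := fun t U ρ hρ => by
    have := h (t, 1, U, ρ, S) ⟨one_pos, hρ, hS⟩
    change c₃ / (1 : ℝ) ^ (n - 1)
      + ρ * ((c₀ + c₁ * t + c₂ * t ^ 2) * U - 1 * (c₁ + 2 * c₂ * t) / 2) = 0 at this
    rw [one_pow, div_one, one_mul] at this
    exact this
  obtain ⟨ρ₁, hρ₁⟩ := hJne
  have hρ0 : ρ₁ ≠ 0 := (hJpos hρ₁).ne'
  have key : ∀ t, c₀ + c₁ * t + c₂ * t ^ 2 = 0 := fun t => by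
    apply mul_left_cancel₀ hρ0
    linear_combination ev t 1 ρ₁ hρ₁ - ev t 0 ρ₁ hρ₁
  have k0 := key 0
  have k1 := key 1
  have k2 := key (-1)
  have h0 : c₀ = 0 := by linarith
  have h2 : c₂ = 0 := by linarith
  have h1 : c₁ = 0 := by linarith
  refine ⟨h0, h1, h2, ?_⟩
  have := ev 0 0 ρ₁ hρ₁
  rw [h0, h1, h2] at this
  linarith

end

end RadialFlow
end

/-! ### The classification -/

open RadialFlow RadialFlow.Kin

theorem theorem5 (n : ℕ) (hn : 2 ≤ n) (J I : Set ℝ)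
    (hJ : IsOpen J) (hJc : IsPreconnected J) (hJne : J.Nonempty) (hJpos : J ⊆ Set.Ioi 0)
    (hI : IsOpen I) (hIc : IsPreconnected I) (hIne : I.Nonempty)
    (P e : ℝ → ℝ → ℝ)
    (hP : ContDiffOn ℝ ∞ (fun y : ℝ × ℝ => P y.1 y.2) (J ×ˢ I))
    (hnd : RadialFlow.IsNondegenerate J I P)
    (he : RadialFlow.IsInternalEnergy J I P e) :
    -- every conservation law gives a conserved integral on all transported domains
    (∀ q, RadialFlow.IsConservationLaw n J I P q → RadialFlow.HasMovingBalance n J I P q) ∧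
    -- the kinematic integral invariants (zero moving flux)
    (∀ q, (RadialFlow.IsConservationLaw n J I P q ∧
        ∀ x ∈ RadialFlow.kinDomain J I, q.2 x = 0) ↔
      ∃ f : ℝ → ℝ, ContDiffOn ℝ ∞ f I ∧ ∀ x ∈ RadialFlow.kinDomain J I,
        q.1 x = (RadialFlow.advected f).1 x ∧ q.2 x = (RadialFlow.advected f).2 x) ∧
    -- energy is conserved and is not equivalent to an integral invariant
    (RadialFlow.IsConservationLaw n J I P (RadialFlow.energy P e) ∧
      ¬ RadialFlow.Equivalent n J I (RadialFlow.energy P e) 0) ∧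
    -- (i) outside of the three special cases, energy is the only one
    ((¬ ∃ p₀ κ, RadialFlow.IsIdealPolytropic n J I P p₀ κ) →
      (¬ ∃ p, RadialFlow.IsBarotropic J I P p) →
      (¬ ∃ κ, RadialFlow.IsEntropic J I P κ) →
      ∀ q, RadialFlow.IsConservationLaw n J I P q ↔
        ∃ c : ℝ, RadialFlow.Equivalent n J I q (c • RadialFlow.energy P e)) ∧
    -- (ii) additional ones exist exactly in the three special cases
    ((∃ q, RadialFlow.IsConservationLaw n J I P q ∧
        ¬ ∃ c : ℝ, RadialFlow.Equivalent n J I q (c • RadialFlow.energy P e)) ↔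
      (∃ p₀ κ, RadialFlow.IsIdealPolytropic n J I P p₀ κ) ∨
      (∃ p, RadialFlow.IsBarotropic J I P p) ∨
      (∃ κ, RadialFlow.IsEntropic J I P κ)) ∧
    -- ideal polytropic, not barotropic
    (∀ p₀ κ, RadialFlow.IsIdealPolytropic n J I P p₀ κ →
      (¬ ∃ p, RadialFlow.IsBarotropic J I P p) →
      (∀ q, RadialFlow.IsConservationLaw n J I P q ↔
        ∃ c₀ c₁ c₂ : ℝ, RadialFlow.Equivalent n J I q
          (c₀ • RadialFlow.energy P e
            + c₁ • RadialFlow.dilationalEnergy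
                (RadialFlow.idealPressure n κ) (RadialFlow.idealEnergy n κ)
            + c₂ • RadialFlow.similarityEnergy
                (RadialFlow.idealPressure n κ) (RadialFlow.idealEnergy n κ))) ∧
      (∀ c₀ c₁ c₂ : ℝ, RadialFlow.Equivalent n J I
          (c₀ • RadialFlow.energy P e
            + c₁ • RadialFlow.dilationalEnergy
                (RadialFlow.idealPressure n κ) (RadialFlow.idealEnergy n κ)
            + c₂ • RadialFlow.similarityEnergy
                (RadialFlow.idealPressure n κ) (RadialFlow.idealEnergy n κ)) 0 →
        c₀ = 0 ∧ c₁ = 0 ∧ c₂ = 0)) ∧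
    -- barotropic, not ideal polytropic
    (∀ p e₁ : ℝ → ℝ, RadialFlow.IsBarotropic J I P p →
      (∀ ρ ∈ J, HasDerivAt e₁ (p ρ / ρ ^ 2) ρ) →
      (¬ ∃ p₀ κ, RadialFlow.IsIdealPolytropic n J I P p₀ κ) →
      (∀ q, RadialFlow.IsConservationLaw n J I P q ↔
        ∃ c₀ c₃ : ℝ, RadialFlow.Equivalent n J I q
          (c₀ • RadialFlow.energy P e + c₃ • RadialFlow.enthalpyFlux n p e₁)) ∧
      (∀ c₀ c₃ : ℝ, RadialFlow.Equivalent n J I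
          (c₀ • RadialFlow.energy P e + c₃ • RadialFlow.enthalpyFlux n p e₁) 0 →
        c₀ = 0 ∧ c₃ = 0)) ∧
    -- ideal polytropic and barotropic at once
    (∀ (p₀ : ℝ) (κ p e₁ : ℝ → ℝ), RadialFlow.IsIdealPolytropic n J I P p₀ κ →
      RadialFlow.IsBarotropic J I P p →
      (∀ ρ ∈ J, HasDerivAt e₁ (p ρ / ρ ^ 2) ρ) →
      (∀ q, RadialFlow.IsConservationLaw n J I P q ↔
        ∃ c₀ c₁ c₂ c₃ : ℝ, RadialFlow.Equivalent n J I q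
          (c₀ • RadialFlow.energy P e
            + c₁ • RadialFlow.dilationalEnergy
                (RadialFlow.idealPressure n κ) (RadialFlow.idealEnergy n κ)
            + c₂ • RadialFlow.similarityEnergy
                (RadialFlow.idealPressure n κ) (RadialFlow.idealEnergy n κ)
            + c₃ • RadialFlow.enthalpyFlux n p e₁)) ∧
      (∀ c₀ c₁ c₂ c₃ : ℝ, RadialFlow.Equivalent n J I
          (c₀ • RadialFlow.energy P e
            + c₁ • RadialFlow.dilationalEnergy
                (RadialFlow.idealPressure n κ) (RadialFlow.idealEnergy n κ)
            + c₂ • RadialFlow.similarityEnergy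
                (RadialFlow.idealPressure n κ) (RadialFlow.idealEnergy n κ)
            + c₃ • RadialFlow.enthalpyFlux n p e₁) 0 →
        c₀ = 0 ∧ c₁ = 0 ∧ c₂ = 0 ∧ c₃ = 0)) ∧
    -- entropic: entropy-weighted energy, which is a multiple of energy just for constant weights
    (∀ κ : ℝ → ℝ, RadialFlow.IsEntropic J I P κ →
      (∀ q, RadialFlow.IsConservationLaw n J I P q ↔
        ∃ F K : ℝ → ℝ, RadialFlow.IsWeight I κ F K ∧
          RadialFlow.Equivalent n J I q (RadialFlow.weightedEnergy F K)) ∧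
      (∀ (F K : ℝ → ℝ) (c : ℝ), RadialFlow.IsWeight I κ F K →
        (RadialFlow.Equivalent n J I (RadialFlow.weightedEnergy F K)
            (c • RadialFlow.energy P e) ↔ ∀ S ∈ I, F S = c))) := by
  have hn1 : 1 ≤ n := by omega
  have hn0 : n ≠ 0 := by omega
  have hg := he.isGas hJ hI hP
  have hEnergy := hg.isConservationLaw_energy (n := n) hn1 hJ hI hJpos
  have hEc := energy_multiple (n := n) hn1 hJ hI hJpos hg
  have hzero : IsConservationLaw n J I P 0 := by
    have := hEnergy.smul hn1 hJ hI hJpos 0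
    rwa [zero_smul] at this
  have pd_zero : ∀ x : Kin, pd eU (0 : Pair).1 x = 0 := fun x => by
    change fderiv ℝ (fun _ : Kin => (0 : ℝ)) x eU = 0
    simp
  have eqv : ∀ {q q' : Pair}, IsConservationLaw n J I P q → IsConservationLaw n J I P q' →
      (Equivalent n J I q q' ↔ ∀ x ∈ kinDomain J I, pd eU q.1 x = pd eU q'.1 x) :=
    fun H H' => H.equivalent_iff hn1 hJ hI hJc hIc hJne hIne hJpos hP H'
  have back : ∀ {q q' : Pair}, Equivalent n J I q q' → IsConservationLaw n J I P q' →
      IsConservationLaw n J I P q := fun h H => h.isConservationLaw hn1 hJ hI hJpos H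
  have baro : ∀ {c₃ : ℝ}, (¬ ∃ p, IsBarotropic J I P p) →
      (c₃ ≠ 0 → ∀ x ∈ kinDomain J I, pd eS (kinPressure P) x = 0) → c₃ = 0 := fun hb h => by
    by_contra h3
    exact hb (exists_isBarotropic hJ hI hJc hIc hIne hP (h h3))
  -- Outside the entropic case nondegeneracy means p_ρ ≠ 0 on a dense set, as the normal form
  -- requires.
  have normal := fun hne (q : Pair) (H : IsConservationLaw n J I P q) =>
    exists_normal_form hn hJ hI hJc hIc hJne hIne hJpos hP (hnd.dense_pRho hne) H
  have one : (¬ ∃ p₀ κ, IsIdealPolytropic n J I P p₀ κ) → (¬ ∃ p, IsBarotropic J I P p) →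
      (¬ ∃ κ, IsEntropic J I P κ) → ∀ q, IsConservationLaw n J I P q ↔
        ∃ c : ℝ, Equivalent n J I q (c • energy P e) := fun hp hb hne q => by
    refine ⟨fun H => ?_, fun ⟨c, h⟩ => back h (hEc c).1⟩
    obtain ⟨c₀, c₁, c₂, c₃, h, h3, h12⟩ := normal hne q H
    have z3 := baro hb h3
    have z12 : ¬ (c₁ ≠ 0 ∨ c₂ ≠ 0) := fun h' => hp
      (exists_isIdealPolytropic hn0 hJ hI hJc hIc hJne hIne hJpos hP (h12 h'))
    push Not at z12
    refine ⟨c₀, (eqv H (hEc c₀).1).2 fun x hx => ?_⟩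
    rw [h x hx, (hEc c₀).2 x hx, z3, z12.1, z12.2]
    ring
  refine ⟨fun q H => H.hasMovingBalance hJ hI,
    fun q => isConservationLaw_and_flux_eq_zero_iff hn1 hJ hI hJc hIc hJne hIne hJpos hP hnd,
    ⟨hEnergy, fun h => ?_⟩, one, ⟨?_, ?_⟩, ?_, ?_, ?_, ?_⟩
  · obtain ⟨ρ₁, hρ₁⟩ := hJne
    obtain ⟨S₁, hS₁⟩ := hIne
    have hx : ((0, 1, 1, ρ₁, S₁) : Kin) ∈ kinDomain J I := ⟨one_pos, hρ₁, hS₁⟩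
    have h1 := (hEc 1).2 _ hx
    rw [one_smul, (eqv hEnergy hzero).1 h _ hx, pd_zero] at h1
    have h2 : (0 : ℝ) = 1 * ρ₁ * 1 := h1
    have := hJpos hρ₁
    simp only [Set.mem_Ioi] at this
    linarith
  · rintro ⟨q, H, h⟩
    by_contra! hc
    obtain ⟨hp, hb, hne⟩ := hc
    exact h ((one (fun ⟨p₀, κ, h⟩ => hp p₀ κ h) (fun ⟨p, h⟩ => hb p h) (fun ⟨κ, h⟩ => hne κ h)
      q).1 H)
  · obtain ⟨ρ₁, hρ₁⟩ := id hJne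
    obtain ⟨S₁, hS₁⟩ := id hIne
    have hρ0 : ρ₁ ≠ 0 := ne_of_gt (hJpos hρ₁)
    have hx : ((0, 1, 0, ρ₁, S₁) : Kin) ∈ kinDomain J I := ⟨one_pos, hρ₁, hS₁⟩
    rintro (⟨p₀, κ, h⟩ | ⟨p, h⟩ | ⟨κ, h⟩)
    -- At t = 0, r = 1, U = 0 the dilational energy has Φ_U = -ρ/2, whereas Φ_U = c ρ U vanishes for
    -- every multiple of energy. The enthalpy flux is separated at the same point.
    · obtain ⟨hg', hpe⟩ := h.isGas hJ hI hJpos hn0 hP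
      have H := hg'.isConservationLaw_dilationalEnergy hn1 hJ hI hJpos hpe
      refine ⟨_, H, fun ⟨c, hc⟩ => ?_⟩
      have e1 := (eqv H (hEc c).1).1 hc _ hx
      rw [(hEc c).2 _ hx, H.pd_U hJ hI hx (hasDerivAt_dilationalEnergy _ _ _ _ _)] at e1
      have e2 : ρ₁ * (0 * 0 - 1 / 2) = c * ρ₁ * 0 := e1
      exact hρ0 (by linarith)
    · have he₁ : ∀ ρ ∈ J, HasDerivAt (fun y => e y S₁) (p ρ / ρ ^ 2) ρ := fun ρ hρ => by
        rw [← h ρ hρ S₁ hS₁]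
        exact he.hasDerivAt ρ hρ S₁ hS₁
      have H := h.isConservationLaw_enthalpyFlux hn1 hJ hI hJpos hIne hP he₁
      refine ⟨_, H, fun ⟨c, hc⟩ => ?_⟩
      have e1 := (eqv H (hEc c).1).1 hc _ hx
      rw [(hEc c).2 _ hx, H.pd_U hJ hI hx (hasDerivAt_enthalpyFlux _ _ _ _ _)] at e1
      have e2 : 1 / (1 : ℝ) ^ (n - 1) = c * ρ₁ * 0 := e1
      rw [one_pow] at e2
      linarith
    · have sκ : ContDiffOn ℝ ∞ κ I :=
        (hP.comp (f := fun S : ℝ => (ρ₁, S)) (by fun_prop) fun S hS => ⟨hρ₁, hS⟩).congr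
          fun S hS => (h ρ₁ hρ₁ S hS).symm
      -- The weight F = κ, with K = κ²/2, is not constant: otherwise the pressure would be constant.
      have hw : IsWeight I κ κ fun S => κ S ^ 2 / 2 := ⟨sκ, fun S hS => by
        have d := ((sκ.contDiffAt (hI.mem_nhds hS)).differentiableAt (by simp)).hasDerivAt
        refine ((d.pow 2).div_const 2).congr_deriv ?_
        norm_num
        ring⟩
      have H := h.isConservationLaw_weightedEnergy hn1 hJ hI hJpos hJne hP hw
      refine ⟨_, H, fun ⟨c, hc⟩ => ?_⟩
      refine hnd.not_const hJ hI hJne hIne c fun ρ hρ S hS => ?_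
      have hx' : ((0, 1, 1, ρ, S) : Kin) ∈ kinDomain J I := ⟨one_pos, hρ, hS⟩
      have e1 := (eqv H (hEc c).1).1 hc _ hx'
      rw [(hEc c).2 _ hx', H.pd_U hJ hI hx' (hasDerivAt_weightedEnergy _ _ _ _ _)] at e1
      have e2 : ρ * 1 * κ S = c * ρ * 1 := e1
      rw [h ρ hρ S hS]
      apply mul_left_cancel₀ (ne_of_gt (hJpos hρ))
      linear_combination e2
  · intro p₀ κ h hb
    obtain ⟨hg', hpe⟩ := h.isGas hJ hI hJpos hn0 hP
    have comb := polytropic_combination (n := n) hn1 hJ hI hJpos hg hg' hpe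
    have hne := hnd.not_isEntropic_of_isIdealPolytropic hJ hI hJne hIne hJpos h
    refine ⟨fun q => ⟨fun H => ?_, fun ⟨c₀, c₁, c₂, h⟩ => back h (comb c₀ c₁ c₂).1⟩,
      fun c₀ c₁ c₂ hc => ?_⟩
    · obtain ⟨c₀, c₁, c₂, c₃, h, h3, -⟩ := normal hne q H
      refine ⟨c₀, c₁, c₂, (eqv H (comb c₀ c₁ c₂).1).2 fun x hx => ?_⟩
      rw [h x hx, (comb c₀ c₁ c₂).2 x hx, baro hb h3]
      ring
    · have k := coeff_eq_zero (n := n) (c₀ := c₀) (c₁ := c₁) (c₂ := c₂) (c₃ := 0) hJne hIne hJpos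
        fun x hx => by
          have e1 := (eqv (comb c₀ c₁ c₂).1 hzero).1 hc x hx
          rw [(comb c₀ c₁ c₂).2 x hx, pd_zero] at e1
          linear_combination e1
      exact ⟨k.1, k.2.1, k.2.2.1⟩
  · intro p e₁ h he₁ hp
    have comb := barotropic_combination (n := n) hn1 hJ hI hJpos hIne hP hg h he₁
    have hne := hnd.not_isEntropic_of_isBarotropic hJ hI hJne hIne h
    refine ⟨fun q => ⟨fun H => ?_, fun ⟨c₀, c₃, h⟩ => back h (comb c₀ c₃).1⟩, fun c₀ c₃ hc => ?_⟩
    · obtain ⟨c₀, c₁, c₂, c₃, h, -, h12⟩ := normal hne q H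
      have z12 : ¬ (c₁ ≠ 0 ∨ c₂ ≠ 0) := fun h' => hp
        (exists_isIdealPolytropic hn0 hJ hI hJc hIc hJne hIne hJpos hP (h12 h'))
      push Not at z12
      refine ⟨c₀, c₃, (eqv H (comb c₀ c₃).1).2 fun x hx => ?_⟩
      rw [h x hx, (comb c₀ c₃).2 x hx, z12.1, z12.2]
      ring
    · have k := coeff_eq_zero (n := n) (c₀ := c₀) (c₁ := 0) (c₂ := 0) (c₃ := c₃) hJne hIne hJpos
        fun x hx => by
          have e1 := (eqv (comb c₀ c₃).1 hzero).1 hc x hx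
          rw [(comb c₀ c₃).2 x hx, pd_zero] at e1
          linear_combination e1
      exact ⟨k.1, k.2.2.2⟩
  · intro p₀ κ p e₁ hp h he₁
    obtain ⟨hg', hpe⟩ := hp.isGas hJ hI hJpos hn0 hP
    have comb := polytropic_barotropic_combination (n := n) hn1 hJ hI hJpos hIne hP hg hg' hpe h he₁
    have hne := hnd.not_isEntropic_of_isBarotropic hJ hI hJne hIne h
    refine ⟨fun q => ⟨fun H => ?_, fun ⟨c₀, c₁, c₂, c₃, h⟩ => back h (comb c₀ c₁ c₂ c₃).1⟩,
      fun c₀ c₁ c₂ c₃ hc => coeff_eq_zero (n := n) hJne hIne hJpos fun x hx => ?_⟩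
    · obtain ⟨c₀, c₁, c₂, c₃, h, -, -⟩ := normal hne q H
      refine ⟨c₀, c₁, c₂, c₃, (eqv H (comb c₀ c₁ c₂ c₃).1).2 fun x hx => ?_⟩
      rw [h x hx, (comb c₀ c₁ c₂ c₃).2 x hx]
    · rw [← (comb c₀ c₁ c₂ c₃).2 x hx, (eqv (comb c₀ c₁ c₂ c₃).1 hzero).1 hc x hx, pd_zero]
  · intro κ hκ
    have law := fun {F K : ℝ → ℝ} (hF : IsWeight I κ F K) =>
      hκ.isConservationLaw_weightedEnergy hn1 hJ hI hJpos hJne hP hF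
    have der := fun {F K : ℝ → ℝ} (hF : IsWeight I κ F K) {x : Kin} (hx : x ∈ kinDomain J I) =>
      (law hF).pd_U hJ hI hx (hasDerivAt_weightedEnergy x.t x.r x.U x.ρ x.S)
    refine ⟨fun q => ⟨fun H => ?_, fun ⟨F, K, hF, h⟩ => back h (law hF)⟩, fun F K c hF => ?_⟩
    · obtain ⟨F, K, hF, h⟩ := exists_normal_form_entropic hn hJ hI hJc hIc hJne hJpos hP hκ
        (hnd.dense_pS hJ hJne hIne hκ) H
      exact ⟨F, K, hF, (eqv H (law hF)).2 fun x hx => by rw [h x hx, der hF hx]⟩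
    · rw [eqv (law hF) (hEc c).1]
      constructor
      · intro h S hS
        obtain ⟨ρ₁, hρ₁⟩ := hJne
        have hx : ((0, 1, 1, ρ₁, S) : Kin) ∈ kinDomain J I := ⟨one_pos, hρ₁, hS⟩
        have e1 := h _ hx
        rw [(hEc c).2 _ hx, der hF hx] at e1
        have e2 : ρ₁ * 1 * F S = c * ρ₁ * 1 := e1
        apply mul_left_cancel₀ (ne_of_gt (hJpos hρ₁))
        linear_combination e2
      · intro h x hx
        rw [(hEc c).2 x hx, der hF hx, h x.S hx.2.2]
        ring
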